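/- Let $d>10$ and let $(p_k)_{k\ge 0}$ be the law of an offspring variable $Z$ with $\mathbf E[Z]=1$, $\mathbf P[Z=1]<1$ and $\mathbf E[Z^2]<\infty$. Let $\tilde Z$ have the size-biased law $\mathbf P[\tilde Z=k]=kp_k$. Let $(\alpha(n))_{n\in\mathbb Z}$ be a two-sided simple random walk on $\mathbb Z^d$ with $\alpha(0)=0$. To each time $n\in\mathbb Z$ attach, independently of each other and of $\alpha$, a Galton–Watson tree whose root has $\tilde Z-1$ children and whose other vertices have independent numbers of children with the law of $Z$. Embed this tree in $\mathbb Z^d$ by mapping its root to $\alpha(n)$ and giving its edges independent simple random walk jumps; let $\mathcal B(\alpha(n))\subset\mathbb Z^d$ be the set of the locations of its vertices, and for $A\subset\mathbb Z$ put $\mathcal B(\alpha(A))=\bigcup_{n\in A}\mathcal B(\alpha(n))$. Joining, for every $n$, the roots of the trees attached at times $n$ and $n+1$ by an edge yields the incipient bi-infinite critical branching random walk. Its law is denoted $\mathbf P^{-\infty,\infty}$, and the subgraph of $\mathbb Z^d$ which consists of the images of the vertices and edges of the tree is denoted $\omega_{-\infty,\infty}$. The time $i\in\mathbb Z$ (and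 the point $\alpha(i)$) is pivotal if $\mathcal B(\alpha((-\infty,i]))\cap\mathcal B(\alpha([i+1,\infty)))=\emptyset$. Then almost surely the pivotal times form an increasing sequence $(\gamma_i)_{i\in\mathbb Z}$, unbounded in both directions, which we index so that $\gamma_1$ is the smallest positive pivotal time, and the following hold. 1. There is a constant $C<\infty$, depending only on $d$ and on the law of $Z$, such that for all $i\in\mathbb Z$ and all integers $n\ge 2$ $$\mathbf P^{-\infty,\infty}[\gamma_{i+1}-\gamma_i\ge n]\le C(\log n)^{(d-6)/2}n^{-(d-8)/2}.$$ 2. There is $\epsilon>0$ such that, as $n\to\infty$, $$\mathbf P^{-\infty,\infty}\Bigl[\max_{i\in[-n,n]}(\gamma_{i+1}-\gamma_i)\ge n^{1-\epsilon}\Bigr]=o\bigl(n^{-\frac{d-10}2-\epsilon}\bigr),$$ $$\mathbf P^{-\infty,\infty}\Bigl[\max_{i\in[-n,n]}R_{\mathrm{eff}}^{-\infty,\infty}(\alpha(\gamma_{i+1}),\alpha(\gamma_i))\ge n^{1-\epsilon}\Bigr]=o\bigl(n^{-\frac{d-10}2-\epsilon}\bigr),$$ $$\mathbf P^{-\infty,\infty}\Bigl[\max_{i\in[-n,n]}d_{\omega_{-\infty,\infty}}(\alpha(\gamma_{i+1}),\alpha(\gamma_i))\ge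 n^{1-\epsilon}\Bigr]=o\bigl(n^{-\frac{d-10}2-\epsilon}\bigr),$$ where $d_{\omega_{-\infty,\infty}}$ is the graph distance in $\omega_{-\infty,\infty}$, and $R_{\mathrm{eff}}^{-\infty,\infty}(x,y)$ is the effective resistance in $\omega_{-\infty,\infty}$ with unit resistances: its inverse is the infimum of $\sum_{\{u,v\}\in E(\omega_{-\infty,\infty})}(f(u)-f(v))^2$ over all real functions $f$ with $f(x)=1$ and $f(y)=0$. -/

import Mathlib

open MeasureTheory Filter Asymptotics
open scoped ENNReal

noncomputable section

namespace BRW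

/-! ### Offspring laws -/

/-- The size-biased law `k ↦ k p_k` of a law `p` on `ℕ` with mean `1`. -/
def sizeBiased (p : PMF ℕ) (hmean : ∑' k : ℕ, (k : ℝ≥0∞) * p k = 1) : PMF ℕ :=
  ⟨fun k => (k : ℝ≥0∞) * p k, ENNReal.summable.hasSum_iff.2 hmean⟩

/-- The offspring law of the vertex `u` of a bush: `Z̃ - 1` at the root (here `Z̃ ≥ 1` almost
surely, so that the subtraction is not truncated), and `Z` at every other vertex. -/
def offspringLaw (p : PMF ℕ) (hmean : ∑' k : ℕ, (k : ℝ≥0∞) * p k = 1) (u : List ℕ) : PMF ℕ :=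
  if u = [] then (sizeBiased p hmean).map (fun k => k - 1) else p

/-! ### Simple random walk steps -/

/-- A step of the simple random walk on `ℤ^d`: a coordinate direction and a sign. -/
abbrev Step (d : ℕ) : Type := Fin d × Bool

/-- The unit vector `± e_j` which a step encodes. -/
def Step.vec {d : ℕ} (s : Step d) : Fin d → ℤ :=
  Pi.single s.1 (if s.2 then 1 else -1)

/-- The jump distribution of the simple random walk: uniform on the `2d` steps. -/
def stepLaw (d : ℕ) [NeZero d] : PMF (Step d) := PMF.uniformOfFintype (Step d)

/-! ### Bushes

Vertices of trees are Ulam–Harris addresses: `[]` is the root and `k :: u` is the `k`-th child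
(`k = 0, 1, …`) of `u`. -/

/-- The randomness of one bush: the number `b.1 u` of children of the vertex `u`, and the jump
`b.2 (k :: u)` along the edge from `u` to its child `k :: u` (`b.2 []` is not used). -/
abbrev Bush (d : ℕ) : Type := (List ℕ → ℕ) × (List ℕ → Step d)

/-- The address is a vertex of the tree with the given numbers of children. -/
def Bush.IsVertex {d : ℕ} (b : Bush d) : List ℕ → Prop
  | [] => True
  | k :: u => k < b.1 u ∧ Bush.IsVertex b u

/-- The location of a vertex relative to the root: the sum of the jumps along the path to it. -/
def Bush.pos {d : ℕ} (b : Bush d) : List ℕ → (Fin d → ℤ)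
  | [] => 0
  | k :: u => Bush.pos b u + (b.2 (k :: u)).vec

/-- The law of a bush: all numbers of children and all jumps are independent. -/
def bushLaw (d : ℕ) [NeZero d] (p : PMF ℕ) (hmean : ∑' k : ℕ, (k : ℝ≥0∞) * p k = 1) :
    Measure (Bush d) :=
  (Measure.infinitePi fun u : List ℕ => (offspringLaw p hmean u).toMeasure).prod
    (Measure.infinitePi fun _ : List ℕ => (stepLaw d).toMeasure)

instance (d : ℕ) [NeZero d] (p : PMF ℕ) (hmean : ∑' k : ℕ, (k : ℝ≥0∞) * p k = 1) :
    IsProbabilityMeasure (bushLaw d p hmean) := by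
  unfold bushLaw
  infer_instance

/-! ### The bi-infinite critical branching random walk -/

/-- The sample space: for every `n : ℤ` the jump `(ω n).1` of the backbone from time `n` to time
`n + 1`, and the bush `(ω n).2` which is attached to the backbone at time `n`. -/
abbrev Sample (d : ℕ) : Type := ℤ → Step d × Bush d

/-- The law of the incipient bi-infinite critical branching random walk: the backbone jumps and
the bushes are independent. -/
def law (d : ℕ) [NeZero d] (p : PMF ℕ) (hmean : ∑' k : ℕ, (k : ℝ≥0∞) * p k = 1) :
    Measure (Sample d) :=
  Measure.infinitePi fun _ : ℤ => (stepLaw d).toMeasure.prod (bushLaw d p hmean)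

instance (d : ℕ) [NeZero d] (p : PMF ℕ) (hmean : ∑' k : ℕ, (k : ℝ≥0∞) * p k = 1) :
    IsProbabilityMeasure (law d p hmean) := by
  unfold law
  infer_instance

variable {d : ℕ}

/-- The backbone: the two-sided walk with `α 0 = 0` and `α (n + 1) = α n + (jump number n)`
(at most one of the two sums is non-empty). -/
def backbone (ω : Sample d) (n : ℤ) : Fin d → ℤ :=
  ∑ k ∈ Finset.Ico 0 n, (ω k).1.vec - ∑ k ∈ Finset.Ico n 0, (ω k).1.vec

/-- The location in `ℤ^d` of the vertex with address `u` in the bush at backbone time `n`. -/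
def embed (ω : Sample d) (v : ℤ × List ℕ) : Fin d → ℤ :=
  backbone ω v.1 + (ω v.1).2.pos v.2

/-- The range `𝓑(α(n))` of the bush at backbone time `n` (it contains `α(n)`). -/
def bushRange (ω : Sample d) (n : ℤ) : Set (Fin d → ℤ) :=
  {x | ∃ u, (ω n).2.IsVertex u ∧ embed ω (n, u) = x}

/-- `α(i)` is a pivotal point: `𝓑(α((-∞, i])) ∩ 𝓑(α([i + 1, ∞))) = ∅`. -/
def IsPivotal (ω : Sample d) (i : ℤ) : Prop :=
  (⋃ m ∈ Set.Iic i, bushRange ω m) ∩ (⋃ m ∈ Set.Ici (i + 1), bushRange ω m) = ∅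

/-- The pivotal times `(γ_i)`: `γ_1 < γ_2 < …` are the positive pivotal times in increasing order
and `γ_0 > γ_{-1} > …` are the non-positive ones in decreasing order. The values are meaningful
when there are infinitely many of both. -/
def pivotalTime (ω : Sample d) (i : ℤ) : ℤ :=
  if 0 < i then (Nat.nth (fun m : ℕ => IsPivotal ω ((m : ℤ) + 1)) (i - 1).toNat : ℤ) + 1
  else -(Nat.nth (fun m : ℕ => IsPivotal ω (-(m : ℤ))) (-i).toNat : ℤ)

/-- `γ` is the increasing enumeration by `ℤ` of all pivotal times, such that `γ 1` is the smallest
positive one. -/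
structure IsPivotalEnumeration (ω : Sample d) (γ : ℤ → ℤ) : Prop where
  strictMono : StrictMono γ
  range_eq : Set.range γ = {i | IsPivotal ω i}
  zero_nonpos : γ 0 ≤ 0
  one_pos : 0 < γ 1

/-- The (oriented) edges of the bi-infinite tree: those of the backbone and those of the bushes. -/
inductive TreeEdge (ω : Sample d) : ℤ × List ℕ → ℤ × List ℕ → Prop
  | backbone (n : ℤ) : TreeEdge ω (n, []) (n + 1, [])
  | bush (n : ℤ) (k : ℕ) (u : List ℕ) (h : (ω n).2.IsVertex (k :: u)) :
      TreeEdge ω (n, u) (n, k :: u)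

/-- The embedded graph `ω_{-∞,∞}`: its edges are the images of the edges of the tree. (Points of
`ℤ^d` outside the range of the embedding are isolated, and play no role.) -/
def graph (ω : Sample d) : SimpleGraph (Fin d → ℤ) :=
  SimpleGraph.fromRel fun x y => ∃ a b, TreeEdge ω a b ∧ embed ω a = x ∧ embed ω b = y

/-! ### Effective resistance -/

/-- The Dirichlet energy of `f` on `G` with unit resistances; each edge is counted once. -/
def energy {V : Type*} (G : SimpleGraph V) (f : V → ℝ) : ℝ≥0∞ :=
  open Classical in
  (∑' x, ∑' y, if G.Adj x y then ENNReal.ofReal ((f x - f y) ^ 2) else 0) / 2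

/-- The effective resistance between `x` and `y` in `G` with unit resistances, through the
Dirichlet principle `R(x, y)⁻¹ = inf {energy f : f x = 1, f y = 0}`. -/
def effectiveResistance {V : Type*} (G : SimpleGraph V) (x y : V) : ℝ≥0∞ :=
  (⨅ (f : V → ℝ) (_ : f x = 1 ∧ f y = 0), energy G f)⁻¹

/-! ### Gaps, resistances and distances between consecutive pivotal points -/

/-- The gap `γ_{i+1} - γ_i`. -/
def gap (ω : Sample d) (i : ℤ) : ℝ :=
  (pivotalTime ω (i + 1) : ℝ) - pivotalTime ω i

/-- The effective resistance in `ω_{-∞,∞}` between `α(γ_{i+1})` and `α(γ_i)`. -/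
def pivotalResistance (ω : Sample d) (i : ℤ) : ℝ≥0∞ :=
  effectiveResistance (graph ω) (backbone ω (pivotalTime ω (i + 1)))
    (backbone ω (pivotalTime ω i))

/-- The graph distance in `ω_{-∞,∞}` between `α(γ_{i+1})` and `α(γ_i)` (which are joined by a path
in `ω_{-∞,∞}`, the image of the backbone). -/
def pivotalDist (ω : Sample d) (i : ℤ) : ℝ :=
  (graph ω).dist (backbone ω (pivotalTime ω (i + 1))) (backbone ω (pivotalTime ω i))

/-- The maximum of `f i` over the integers `i ∈ [-n, n]`. -/
def maxOver {β : Type*} [LinearOrder β] (n : ℕ) (f : ℤ → β) : β :=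
  (Finset.Icc (-(n : ℤ)) n).sup' ⟨0, by simp⟩ f

end BRW

end

/-! The time `i` fails to be pivotal exactly when a bush at a time m ≤ i meets one at a time m' > i,
so everything rests on the probability that two bushes meet. The tree path from a vertex of
generation a in one bush to a vertex of generation b in the other consists of a + b + (m' - m)
independent steps, so by a local limit bound its two ends coincide with probability at most of order
(a + b + m' - m)^(-d/2). Criticality and the second moment bound the expected size of every
generation. Summing over a and b leaves order (m' - m)^(2 - d/2) (`exists_law_meetAt_le`).

The time 0 is pivotal with positive probability (`law_isPivotal_zero_ne_zero`). Force the backbone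
to be straight on [-K, K], with tiny bushes pointing away from the cut. This costs a positive
factor, and the only remaining obstructions depend on the times outside of [-K, K]. They are
independent of the forced event and have a probability that tends to 0 with K.

For an interval of length n without pivotal times (`exists_law_noPivot_le`), place J of order log n
disjoint blocks of length 2L in it, with L of order n / log n. Either no block has a centre that is
pivotal within its block, which by independence has probability at most (1 - c)^J ≤ n^(-(d-8)/2), or
two bushes at times more than L apart meet across the interval. The latter has probability of order
n L^(-(d-6)/2), and this is where the logarithm comes from.

The gap of index 0 contains the origin, so if it is long then one half of it is a long interval
without pivotal times at a fixed place. The other gaps are reached through mass transport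
(`natCast_mul_law_gap_le`): if the gap i is longer than M and the gap of the origin is at most b,
then shifting the origin into any of about M/b parts of the gap i gives disjoint events of the same
kind at the origin. One part is enough for the first tail bound. For the maximum over 2n + 1 gaps a
plain union bound only reaches the exponent (d - 10)/2 up to small losses; the extra factor b/M,
with b a smaller power of n than M, improves it strictly. Finally, the backbone joins consecutive
pivotal points by a walk whose length is the gap, so the gap bounds both the graph distance and the
resistance. -/

namespace BRW

open Finset

/-! ### Words and their letter counts -/

/-- The number of occurrences of the letter `j` in the word `w`. -/
def letterCount {n d : ℕ} (w : Fin n → Fin d) (j : Fin d) : ℕ := #{i | w i = j}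

lemma letterCount_eq_sum {n d : ℕ} (w : Fin n → Fin d) (j : Fin d) :
    letterCount w j = ∑ i, if w i = j then 1 else 0 := by
  simp [letterCount]

lemma letterCount_insertNth {n d : ℕ} (i : Fin (n + 1)) (a : Fin d) (w : Fin n → Fin d)
    (j : Fin d) :
    letterCount (i.insertNth a w : Fin (n + 1) → Fin d) j
      = letterCount w j + if a = j then 1 else 0 := by
  rw [letterCount_eq_sum, letterCount_eq_sum, Fin.sum_univ_succAbove _ i]
  simp [add_comm]

lemma sum_letterCount {n d : ℕ} (w : Fin n → Fin d) : ∑ j, letterCount w j = n := by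
  simp_rw [letterCount_eq_sum]
  rw [sum_comm]
  simp

/-- Double counting of the insertions of the letter `a` into words of length `n`. A word of length
`n + 1` arises once for each of its occurrences of `a`; with the weight 1 / (number of occurrences)
on each, these contribute at most 1 in total. Inserting `a` does not change the counts of the
letters in `A`. -/
lemma sum_words_insert_le {n d : ℕ} (A : Finset (Fin d)) (a : Fin d) (ha : a ∉ A) :
    ((n : ℝ) + 1) * ∑ w : Fin n → Fin d, ∏ j ∈ insert a A, ((letterCount w j : ℝ) + 1)⁻¹
      ≤ ∑ w : Fin (n + 1) → Fin d, ∏ j ∈ A, ((letterCount w j : ℝ) + 1)⁻¹ := by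
  have h1 : ∀ w : Fin (n + 1) → Fin d,
      ∑ i, (if w i = a then (∏ j ∈ A, ((letterCount w j : ℝ) + 1)⁻¹) * (letterCount w a : ℝ)⁻¹
        else 0) ≤ ∏ j ∈ A, ((letterCount w j : ℝ) + 1)⁻¹ := by
    intro w
    have h0 : (0 : ℝ) ≤ ∏ j ∈ A, ((letterCount w j : ℝ) + 1)⁻¹ :=
      prod_nonneg fun j _ => by positivity
    rw [← sum_filter, sum_const, nsmul_eq_mul, mul_left_comm]
    change _ * ((letterCount w a : ℝ) * _) ≤ _
    exact mul_le_of_le_one_right h0 mul_inv_le_one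
  refine le_trans ?_ (sum_le_sum fun w _ => h1 w)
  rw [sum_comm]
  have h2 : ∀ i : Fin (n + 1), ∑ w : Fin (n + 1) → Fin d,
      (if w i = a then (∏ j ∈ A, ((letterCount w j : ℝ) + 1)⁻¹) * (letterCount w a : ℝ)⁻¹
        else 0) = ∑ w : Fin n → Fin d, ∏ j ∈ insert a A, ((letterCount w j : ℝ) + 1)⁻¹ := by
    intro i
    rw [← (Fin.insertNthEquiv (fun _ : Fin (n + 1) => Fin d) i).sum_comp, Fintype.sum_prod_type,
      sum_comm]
    refine sum_congr rfl fun w _ => ?_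
    rw [prod_insert ha]
    have hc : ∀ b j, letterCount ((Fin.insertNthEquiv (fun _ : Fin (n + 1) => Fin d) i) (b, w)) j
        = letterCount w j + if b = j then 1 else 0 := fun b => letterCount_insertNth i b w
    simp only [hc, Fin.insertNthEquiv_apply, Fin.insertNth_apply_same]
    rw [sum_ite_eq' univ a]
    simp only [mem_univ, if_true]
    rw [mul_comm]
    congr 1
    · simp
    · refine prod_congr rfl fun j hj => ?_
      have : a ≠ j := fun h => ha (h ▸ hj)
      simp [this]
  rw [sum_congr rfl fun i _ => h2 i, sum_const, nsmul_eq_mul]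
  simp

/-- Each letter of `A` is traded for a factor `n + 1` and one more letter in the word, until the
plain number of words of length `n + #A` is left. -/
lemma sum_words_prod_inv_le {d : ℕ} (A : Finset (Fin d)) : ∀ n : ℕ,
    ((n : ℝ) + 1) ^ #A * ∑ w : Fin n → Fin d, ∏ j ∈ A, ((letterCount w j : ℝ) + 1)⁻¹
      ≤ (d : ℝ) ^ (n + #A) := by
  induction A using Finset.induction_on with
  | empty => intro n; simp
  | insert a A ha ih =>
    intro n
    rw [card_insert_of_notMem ha, pow_succ, mul_assoc]
    calc ((n : ℝ) + 1) ^ #A * (((n : ℝ) + 1) *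
          ∑ w : Fin n → Fin d, ∏ j ∈ insert a A, ((letterCount w j : ℝ) + 1)⁻¹)
        ≤ (((n + 1 : ℕ) : ℝ) + 1) ^ #A *
          ∑ w : Fin (n + 1) → Fin d, ∏ j ∈ A, ((letterCount w j : ℝ) + 1)⁻¹ := by
          refine mul_le_mul ?_ (sum_words_insert_le A a ha) ?_ (by positivity)
          · push_cast
            gcongr
            linarith
          · exact mul_nonneg (by positivity)
              (sum_nonneg fun w _ => prod_nonneg fun j _ => by positivity)
      _ ≤ (d : ℝ) ^ (n + 1 + #A) := ih (n + 1)
      _ = (d : ℝ) ^ (n + (#A + 1)) := by ring_nf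

/-- The negative moment of order `1/2` of the letter counts of a uniform word. -/
lemma sum_words_prod_rsqrt_le {d n : ℕ} :
    ∑ w : Fin n → Fin d, ∏ j, √((letterCount w j : ℝ) + 1)⁻¹
      ≤ (d : ℝ) ^ n * √((d : ℝ) ^ d / ((n : ℝ) + 1) ^ d) := by
  have hF := sum_words_prod_inv_le (univ : Finset (Fin d)) n
  simp only [card_univ, Fintype.card_fin] at hF
  have hF' : ∑ w : Fin n → Fin d, ∏ j, ((letterCount w j : ℝ) + 1)⁻¹
      ≤ (d : ℝ) ^ n * ((d : ℝ) ^ d / ((n : ℝ) + 1) ^ d) := by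
    rw [← mul_div_assoc, le_div_iff₀ (by positivity), mul_comm, ← pow_add]
    exact hF
  -- Cauchy–Schwarz over the `d ^ n` words passes from the moment of order -1 to that of order -1/2,
  -- without loss in the power of `n`.
  have hcs := sum_mul_sq_le_sq_mul_sq (univ : Finset (Fin n → Fin d)) (fun _ => (1 : ℝ))
    (fun w => ∏ j, √((letterCount w j : ℝ) + 1)⁻¹)
  have hsq : ∀ w : Fin n → Fin d, (∏ j, √((letterCount w j : ℝ) + 1)⁻¹) ^ 2
      = ∏ j, ((letterCount w j : ℝ) + 1)⁻¹ := by
    intro w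
    rw [← prod_pow]
    exact prod_congr rfl fun j _ => Real.sq_sqrt (by positivity)
  simp only [one_mul, one_pow, hsq, sum_const, nsmul_eq_mul, mul_one] at hcs
  have hcard : (#(univ : Finset (Fin n → Fin d)) : ℝ) = (d : ℝ) ^ n := by simp
  rw [hcard] at hcs
  refine le_of_sq_le_sq ?_ (by positivity)
  rw [mul_pow, Real.sq_sqrt (by positivity)]
  refine hcs.trans ?_
  rw [sq ((d : ℝ) ^ n), mul_assoc]
  gcongr

/-! ### The central binomial coefficient -/

/-- The induction step reduces to (2k + 1)(2k + 3) ≤ 4(k + 1)². The factor 2k + 1 is the square of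
the inverse square root decay of the return probability. -/
lemma centralBinom_sq_mul_le (k : ℕ) : k.centralBinom ^ 2 * (2 * k + 1) ≤ 16 ^ k := by
  induction k with
  | zero => simp
  | succ k ih =>
    have h := Nat.succ_mul_centralBinom_succ k
    have h2 : (k + 1) ^ 2 * ((k + 1).centralBinom ^ 2 * (2 * (k + 1) + 1))
        ≤ (k + 1) ^ 2 * 16 ^ (k + 1) := by
      calc (k + 1) ^ 2 * ((k + 1).centralBinom ^ 2 * (2 * (k + 1) + 1))
          = ((k + 1) * (k + 1).centralBinom) ^ 2 * (2 * k + 3) := by ring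
        _ = (k.centralBinom ^ 2 * (2 * k + 1)) * (4 * (2 * k + 1) * (2 * k + 3)) := by
            rw [h]; ring
        _ ≤ 16 ^ k * (16 * (k + 1) ^ 2) := by
            refine Nat.mul_le_mul ih ?_
            nlinarith
        _ = _ := by ring
    exact Nat.le_of_mul_le_mul_left h2 (by positivity)

lemma choose_half_sq_mul_le (m : ℕ) : (m.choose (m / 2)) ^ 2 * (m + 1) ≤ 2 * 4 ^ m := by
  rcases Nat.even_or_odd' m with ⟨k, rfl | rfl⟩
  · have h := centralBinom_sq_mul_le k
    rw [Nat.centralBinom] at h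
    rw [Nat.mul_div_cancel_left k two_pos, pow_mul]
    norm_num
    omega
  · have h := centralBinom_sq_mul_le (k + 1)
    -- The two equal middle entries of an odd row add up to the next central coefficient.
    have hc : 2 * (2 * k + 1).choose k = (k + 1).centralBinom := by
      rw [Nat.centralBinom, show 2 * (k + 1) = (2 * k + 1) + 1 by ring, Nat.choose_succ_succ,
        two_mul, Nat.choose_symm_half]
    have hd : (2 * k + 1) / 2 = k := by omega
    rw [hd]
    rw [← hc] at h
    have e1 : (4 : ℕ) ^ (2 * k + 1) = 4 * 16 ^ k := by
      rw [pow_succ, pow_mul]; norm_num; ring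
    rw [e1]
    rw [pow_succ 16] at h
    nlinarith

lemma choose_le_two_pow_mul (m r : ℕ) :
    ((m.choose r : ℕ) : ℝ) ≤ √2 * (2 ^ m * √((m : ℝ) + 1)⁻¹) := by
  have h1 : ((m.choose r : ℕ) : ℝ) ≤ (m.choose (m / 2) : ℕ) := by
    exact_mod_cast Nat.choose_le_middle r m
  refine h1.trans ?_
  have h2 : (((m.choose (m / 2) : ℕ) : ℝ)) ^ 2 * ((m : ℝ) + 1) ≤ 2 * 4 ^ m := by
    exact_mod_cast choose_half_sq_mul_le m
  refine le_of_sq_le_sq ?_ (by positivity)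
  rw [mul_pow, mul_pow, Real.sq_sqrt (by positivity), Real.sq_sqrt (by positivity), ← pow_mul,
    mul_comm m 2, pow_mul, ← div_eq_mul_inv, ← mul_div_assoc, le_div_iff₀ (by positivity)]
  norm_num
  exact h2

/-! ### Counting signed walks -/

/-- The number of choices of signs for a walk with given directions and given end point. -/
lemma card_signs_le {n d : ℕ} (J : Fin n → Fin d) (x : Fin d → ℤ) :
    (#{e : Fin n → Bool | ∑ i, Pi.single (J i) (if e i then (1 : ℤ) else -1) = x} : ℝ)
      ≤ √2 ^ d * (2 ^ n * ∏ j, √((letterCount J j : ℝ) + 1)⁻¹) := by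
  classical
  -- The end point forces the number of positive signs among the steps in direction `j`: twice this
  -- number is the letter count plus `x j`. If the parity or the sign is wrong then no choice of
  -- signs exists, and the rounded or truncated value of `t j` is irrelevant.
  let t : Fin d → ℕ := fun j => ((letterCount J j + x j) / 2).toNat
  let T : Finset ((j : Fin d) → Finset (Fin n)) :=
    Fintype.piFinset fun j => powersetCard (t j) {i | J i = j}
  have hcard : #{e : Fin n → Bool | ∑ i, Pi.single (J i) (if e i then (1 : ℤ) else -1) = x} ≤ #T := by
    refine card_le_card_of_injOn (fun e j => {i | J i = j ∧ e i = true}) ?_ ?_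
    · intro e he
      simp only [coe_filter, mem_univ, true_and, Set.mem_ofPred_eq] at he
      simp only [T, Fintype.coe_piFinset, Set.mem_pi, mem_coe, mem_powersetCard]
      intro j _
      refine ⟨fun i hi => ?_, ?_⟩
      · simp only [mem_filter, mem_univ, true_and] at hi ⊢
        exact hi.1
      · have hj := congrFun he j
        simp only [Finset.sum_apply, Pi.single_apply] at hj
        have e1 : ∀ i, (if j = J i then (if e i then (1 : ℤ) else -1) else 0)
            = 2 * (if J i = j ∧ e i = true then 1 else 0) - (if J i = j then 1 else 0) := by
          intro i
          by_cases h1 : J i = j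
          · by_cases h2 : e i = true <;> simp [h1, h2]
          · simp [h1, Ne.symm h1]
        simp only [e1, sum_sub_distrib, ← mul_sum] at hj
        have e2 : (∑ i, if J i = j then (1 : ℤ) else 0) = letterCount J j := by
          simp [letterCount]
        have e3 : (∑ i, if J i = j ∧ e i = true then (1 : ℤ) else 0)
            = #{i | J i = j ∧ e i = true} := by simp
        rw [e2, e3] at hj
        simp only [t]
        omega
    · intro e _ e' _ h
      funext i
      have := congrFun h (J i)
      simp only at this
      have h2 : i ∈ ({i' | J i' = J i ∧ e i' = true} : Finset (Fin n)) ↔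
        i ∈ ({i' | J i' = J i ∧ e' i' = true} : Finset (Fin n)) := by rw [this]
      simp only [mem_filter, mem_univ, true_and] at h2
      cases h3 : e i <;> cases h4 : e' i <;> simp_all
  have hT : (#T : ℝ) ≤ ∏ j, (√2 * (2 ^ (letterCount J j) * √((letterCount J j : ℝ) + 1)⁻¹)) := by
    simp only [T, Fintype.card_piFinset, card_powersetCard, Nat.cast_prod]
    exact prod_le_prod (fun j _ => by positivity) fun j _ => choose_le_two_pow_mul _ _
  calc _ ≤ (#T : ℝ) := by exact_mod_cast hcard
    _ ≤ _ := hT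
    _ = _ := by
      rw [prod_mul_distrib, prod_mul_distrib, prod_pow_eq_pow_sum, sum_letterCount]
      simp

/-- The number of signed walks of length `n` with a given end point. -/
lemma card_walks_le {n d : ℕ} (η : Fin n → Bool) (x : Fin d → ℤ) :
    (#{w : Fin n → Step d | ∑ i, (if η i then (w i).vec else -(w i).vec) = x} : ℝ)
      ≤ √2 ^ d * √((d : ℝ) ^ d) * (2 * d) ^ n * √(((n : ℝ) + 1) ^ d)⁻¹ := by
  classical
  let S : Finset (Fin n → Step d) := {w | ∑ i, (if η i then (w i).vec else -(w i).vec) = x}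
  let U : (J : Fin n → Fin d) → Finset (Fin n → Bool) := fun J =>
    {e | ∑ i, Pi.single (J i) (if e i then (1 : ℤ) else -1) = x}
  have hS : #S ≤ ∑ J, #(U J) := by
    rw [← card_sigma]
    -- The prescribed signs `η` are absorbed into the signs of the steps, a bijection for every
    -- fixed `η`.
    refine card_le_card_of_injOn
      (fun w => ⟨fun i => (w i).1, fun i => if η i then (w i).2 else !(w i).2⟩) ?_ ?_
    · intro w hw
      simp only [S, coe_filter, mem_univ, true_and, Set.mem_ofPred_eq] at hw
      simp only [coe_sigma, Set.mem_sigma_iff, coe_univ, Set.mem_univ, true_and, U, coe_filter,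
        mem_univ, Set.mem_ofPred_eq]
      rw [← hw]
      refine sum_congr rfl fun i _ => ?_
      unfold Step.vec
      by_cases h1 : η i = true <;> by_cases h2 : (w i).2 = true <;> simp [h1, h2, ← Pi.single_neg]
    · intro w _ w' _ h
      simp only [Sigma.mk.injEq] at h
      obtain ⟨h1, h2⟩ := h
      have h2 := eq_of_heq h2
      funext i
      refine Prod.ext (congrFun h1 i) ?_
      have := congrFun h2 i
      cases h3 : η i <;> simp_all
  calc (#S : ℝ) ≤ ∑ J, (#(U J) : ℝ) := by exact_mod_cast hS
    _ ≤ ∑ J, √2 ^ d * (2 ^ n * ∏ j, √((letterCount J j : ℝ) + 1)⁻¹) :=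
        sum_le_sum fun J _ => card_signs_le J x
    _ = √2 ^ d * 2 ^ n * ∑ J : Fin n → Fin d, ∏ j, √((letterCount J j : ℝ) + 1)⁻¹ := by
        rw [mul_sum]; simp only [mul_assoc]
    _ ≤ √2 ^ d * 2 ^ n * ((d : ℝ) ^ n * √((d : ℝ) ^ d / ((n : ℝ) + 1) ^ d)) := by
        gcongr
        exact sum_words_prod_rsqrt_le
    _ = _ := by
        rw [div_eq_mul_inv, Real.sqrt_mul (by positivity), mul_pow]
        ring

end BRW

namespace BRW

open ProbabilityTheory

/-! ### Power sums -/

/-- The extended nonnegative number `n ^ (-r)`. -/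
noncomputable def powInv (r : ℝ) (n : ℕ) : ℝ≥0∞ := ENNReal.ofReal ((n : ℝ) ^ (-r))

lemma powInv_anti {r : ℝ} (hr : 0 ≤ r) {m n : ℕ} (hm : 1 ≤ m) (h : m ≤ n) :
    powInv r n ≤ powInv r m := by
  refine ENNReal.ofReal_le_ofReal (Real.rpow_le_rpow_of_nonpos ?_ ?_ (by linarith))
  · exact_mod_cast hm
  · exact_mod_cast h

lemma natCast_mul_powInv {r : ℝ} {n : ℕ} (hn : 1 ≤ n) :
    (n : ℝ≥0∞) * powInv r n = powInv (r - 1) n := by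
  have h0 : (0 : ℝ) < n := by exact_mod_cast hn
  rw [powInv, powInv, ← ENNReal.ofReal_natCast, ← ENNReal.ofReal_mul h0.le]
  congr 1
  rw [show -(r - 1) = 1 + -r by ring, Real.rpow_add h0, Real.rpow_one]

/-- Mean value theorem for y ^ (1 - r) on [x, x + 1]; the constant 2 ^ r comes from the intermediate
point being at most x + 1 ≤ 2x. -/
lemma rpow_neg_le_sub {r x : ℝ} (hr : 1 < r) (hx : 1 ≤ x) :
    x ^ (-r) ≤ 2 ^ r / (r - 1) * (x ^ (1 - r) - (x + 1) ^ (1 - r)) := by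
  have hx0 : 0 < x := by linarith
  obtain ⟨ξ, ⟨h1, h2⟩, h3⟩ := exists_hasDerivAt_eq_slope (fun y : ℝ => y ^ (1 - r))
    (fun y => (1 - r) * y ^ (1 - r - 1)) (show x < x + 1 by linarith)
    (fun y hy => (Real.continuousAt_rpow_const y _ (Or.inl (by linarith [hy.1]))).continuousWithinAt)
    (fun y hy => Real.hasDerivAt_rpow_const (Or.inl (by linarith [hy.1])))
  have h4 : x ^ (1 - r) - (x + 1) ^ (1 - r) = (r - 1) * ξ ^ (-r) := by
    have : (x + 1 : ℝ) - x = 1 := by ring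
    rw [this, div_one] at h3
    rw [show (1 : ℝ) - r - 1 = -r by ring] at h3
    linarith
  have h5 : (2 * x) ^ (-r) ≤ ξ ^ (-r) :=
    Real.rpow_le_rpow_of_nonpos (by linarith) (by linarith) (by linarith)
  rw [Real.mul_rpow (by norm_num) hx0.le, Real.rpow_neg (by norm_num)] at h5
  rw [h4]
  have h6 : (0 : ℝ) < 2 ^ r := by positivity
  have h7 : 0 < r - 1 := by linarith
  calc x ^ (-r) = 2 ^ r * ((2 ^ r)⁻¹ * x ^ (-r)) := by field_simp
    _ ≤ 2 ^ r * ξ ^ (-r) := by gcongr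
    _ = _ := by field_simp

/-- The preceding differences telescope. Each infinite sum below, over generations or over times, is
evaluated in this way and costs one power. -/
lemma exists_tsum_powInv_le {r : ℝ} (hr : 1 < r) :
    ∃ C : ℝ≥0∞, C ≠ ⊤ ∧ ∀ n : ℕ, 1 ≤ n → ∑' a, powInv r (n + a) ≤ C * powInv (r - 1) n := by
  refine ⟨ENNReal.ofReal (2 ^ r / (r - 1)), ENNReal.ofReal_ne_top, fun n hn => ?_⟩
  have hr1 : 0 < r - 1 := by linarith
  have hc : (0 : ℝ) ≤ 2 ^ r / (r - 1) := by positivity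
  refine ENNReal.tsum_le_of_sum_range_le fun k => ?_
  unfold powInv
  rw [← ENNReal.ofReal_mul hc, ← ENNReal.ofReal_sum_of_nonneg (fun _ _ => by positivity)]
  refine ENNReal.ofReal_le_ofReal ?_
  rw [show -(r - 1) = 1 - r by ring]
  calc ∑ i ∈ Finset.range k, ((n + i : ℕ) : ℝ) ^ (-r)
      ≤ ∑ i ∈ Finset.range k, 2 ^ r / (r - 1) *
        (((n + i : ℕ) : ℝ) ^ (1 - r) - ((n + (i + 1) : ℕ) : ℝ) ^ (1 - r)) := by
        refine Finset.sum_le_sum fun i _ => ?_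
        have h := rpow_neg_le_sub (x := ((n + i : ℕ) : ℝ)) hr (by exact_mod_cast (by omega))
        refine h.trans (le_of_eq ?_)
        push_cast
        ring_nf
    _ = 2 ^ r / (r - 1) * ((n : ℝ) ^ (1 - r) - ((n + k : ℕ) : ℝ) ^ (1 - r)) := by
        rw [← Finset.mul_sum, Finset.sum_range_sub' (fun i => ((n + i : ℕ) : ℝ) ^ (1 - r))]
        simp
    _ ≤ _ := by
        gcongr
        have : (0 : ℝ) ≤ ((n + k : ℕ) : ℝ) ^ (1 - r) := by positivity
        linarith

/-! ### The local limit upper bound -/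

/-- Each word of steps has probability (2d)^(-n), and `card_walks_le` counts those with the given
end point. The signs `η` are there because part of a tree path is traversed from the vertex back to
the root. -/
lemma measure_signedWalk_le {Ω ι : Type*} [MeasurableSpace Ω] {μ : Measure Ω} {d : ℕ}
    [NeZero d] {X : ι → Ω → Step d} (hX : iIndepFun X μ)
    (hlaw : ∀ i a, μ {ω | X i ω = a} = (2 * d : ℝ≥0∞)⁻¹) (η : ι → Bool) (s : Finset ι)
    (x : Fin d → ℤ) :
    μ {ω | ∑ i ∈ s, (if η i then (X i ω).vec else -(X i ω).vec) = x}
      ≤ ENNReal.ofReal (√2 ^ d * √((d : ℝ) ^ d)) * powInv (d / 2) (s.card + 1) := by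
  classical
  set n := s.card
  let e : Fin n ≃ s := s.equivFin.symm
  let W : Finset (Fin n → Step d) :=
    {w | ∑ i, (if η (e i) then (w i).vec else -(w i).vec) = x}
  have hsub : {ω | ∑ i ∈ s, (if η i then (X i ω).vec else -(X i ω).vec) = x}
      ⊆ ⋃ w ∈ W, ⋂ i, {ω | X (e i) ω = w i} := by
    intro ω hω
    simp only [Set.mem_iUnion, Set.mem_iInter]
    refine ⟨fun i => X (e i) ω, ?_, fun i => rfl⟩
    simp only [W, Finset.mem_filter, Finset.mem_univ, true_and]
    have h : ∑ i ∈ s, (if η i then (X i ω).vec else -(X i ω).vec) = x := hω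
    rwa [← Finset.sum_coe_sort, ← e.sum_comp] at h
  have hind : iIndepFun (fun i : Fin n => X (e i)) μ :=
    hX.precomp (g := fun i : Fin n => (e i : ι)) (Subtype.val_injective.comp e.injective)
  have hterm : ∀ w : Fin n → Step d,
      μ (⋂ i, {ω | X (e i) ω = w i}) = ((2 * d : ℝ≥0∞)⁻¹) ^ n := by
    intro w
    rw [hind.meas_iInter (s := fun i => {ω | X (e i) ω = w i})]
    · simp [hlaw]
    · exact fun i => ⟨{w i}, MeasurableSet.of_discrete, rfl⟩
  have hd : (0 : ℝ) < 2 * d := by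
    have := NeZero.pos d
    positivity
  calc _ ≤ ∑ w ∈ W, μ (⋂ i, {ω | X (e i) ω = w i}) :=
        (measure_mono hsub).trans (measure_biUnion_finset_le _ _)
    _ = ENNReal.ofReal ((W.card : ℝ) * ((2 * d : ℝ)⁻¹) ^ n) := by
        rw [Finset.sum_congr rfl fun w _ => hterm w, Finset.sum_const, nsmul_eq_mul,
          ENNReal.ofReal_mul (by positivity), ENNReal.ofReal_natCast,
          ENNReal.ofReal_pow (by positivity), ENNReal.ofReal_inv_of_pos hd,
          ENNReal.ofReal_mul (by norm_num)]
        simp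
    _ ≤ ENNReal.ofReal ((√2 ^ d * √((d : ℝ) ^ d)) * (((n + 1 : ℕ) : ℝ) ^ (-((d : ℝ) / 2)))) := by
        refine ENNReal.ofReal_le_ofReal ?_
        have h := card_walks_le (fun i => η (e i)) x
        have h2 : √(((n : ℝ) + 1) ^ d)⁻¹ = ((n + 1 : ℕ) : ℝ) ^ (-((d : ℝ) / 2)) := by
          push_cast
          rw [Real.sqrt_inv, Real.sqrt_eq_rpow, ← Real.rpow_natCast, ← Real.rpow_mul (by positivity),
            Real.rpow_neg (by positivity)]
          congr 2
          ring
        rw [h2] at h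
        calc _ ≤ _ := mul_le_mul_of_nonneg_right h (by positivity)
          _ = _ := by rw [inv_pow]; field_simp
    _ = _ := by rw [ENNReal.ofReal_mul (by positivity)]; rfl

end BRW

namespace BRW

open ProbabilityTheory

/-! ### Independence in product spaces -/

lemma iIndep_sumElim_prod {ι κ Ω₁ Ω₂ : Type*} {M₁ : MeasurableSpace Ω₁} {M₂ : MeasurableSpace Ω₂}
    {μ : Measure Ω₁} {ν : Measure Ω₂} [IsProbabilityMeasure μ] [IsProbabilityMeasure ν]
    {m₁ : ι → MeasurableSpace Ω₁} {m₂ : κ → MeasurableSpace Ω₂}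
    (h₁ : iIndep m₁ μ) (h₂ : iIndep m₂ ν) :
    iIndep (Sum.elim (fun i => (m₁ i).comap Prod.fst) fun j => (m₂ j).comap Prod.snd)
      (μ.prod ν) := by
  rw [iIndep_iff]
  intro S f hf
  have hl : ∀ i, Sum.inl i ∈ S → ∃ g, MeasurableSet[m₁ i] g ∧
      (Prod.fst : Ω₁ × Ω₂ → Ω₁) ⁻¹' g = f (Sum.inl i) := fun i hi => hf _ hi
  have hr : ∀ j, Sum.inr j ∈ S → ∃ g, MeasurableSet[m₂ j] g ∧
      (Prod.snd : Ω₁ × Ω₂ → Ω₂) ⁻¹' g = f (Sum.inr j) := fun j hj => hf _ hj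
  choose! g hg hg' using hl
  choose! k hk hk' using hr
  have hset : ⋂ i ∈ S, f i = (⋂ i ∈ S.toLeft, g i) ×ˢ (⋂ j ∈ S.toRight, k j) := by
    ext ⟨x, y⟩
    simp only [Set.mem_iInter, Set.mem_prod, Finset.mem_toLeft, Finset.mem_toRight]
    constructor
    · intro h
      refine ⟨fun i hi => ?_, fun j hj => ?_⟩
      · have := h _ hi
        rw [← hg' i hi] at this
        exact this
      · have := h _ hj
        rw [← hk' j hj] at this
        exact this
    · rintro ⟨h1, h2⟩ (i | j) hi
      · rw [← hg' i hi]
        exact h1 i hi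
      · rw [← hk' j hi]
        exact h2 j hi
  rw [hset, Measure.prod_prod, h₁.meas_biInter (fun i hi => hg i (by simpa using hi)),
    h₂.meas_biInter (fun i hi => hk i (by simpa using hi)), ← Finset.toLeft_disjSum_toRight (u := S),
    Finset.prod_disjSum]
  simp only [Finset.toLeft_disjSum, Finset.toRight_disjSum]
  congr 1
  · refine Finset.prod_congr rfl fun i hi => ?_
    rw [← hg' i (by simpa using hi)]
    have : (Prod.fst : Ω₁ × Ω₂ → Ω₁) ⁻¹' g i = g i ×ˢ Set.univ := by ext; simp
    rw [this, Measure.prod_prod]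
    simp
  · refine Finset.prod_congr rfl fun i hi => ?_
    rw [← hk' i (by simpa using hi)]
    have : (Prod.snd : Ω₁ × Ω₂ → Ω₂) ⁻¹' k i = Set.univ ×ˢ k i := by ext; simp
    rw [this, Measure.prod_prod]
    simp

lemma iIndep_infinitePi {ι κ Ω : Type*} {M : MeasurableSpace Ω} {P : Measure Ω}
    [IsProbabilityMeasure P] {m : κ → MeasurableSpace Ω} (hm : ∀ j, m j ≤ M) (h : iIndep m P) :
    iIndep (fun a : ι × κ => (m a.2).comap fun ω : ι → Ω => ω a.1)
      (Measure.infinitePi fun _ : ι => P) := by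
  -- The coordinate map `ω ↦ ω i` is regarded as a separate random variable for every `j`, with the
  -- target carrying the smaller σ-algebra `m j`. Independence between coordinates and independence
  -- within one coordinate then combine into joint independence.
  have key := iIndepFun_uncurry' (P := Measure.infinitePi fun _ : ι => P)
    (X := fun (i : ι) (_ : κ) (ω : ι → Ω) => ω i) (m𝓧 := fun _ j => m j)
    (fun i j => (measurable_pi_apply i).mono le_rfl (hm j)) ?_ ?_
  · exact (iIndepFun_iff_iIndep _ _ _).1 key
  · exact iIndepFun_infinitePi (X := fun _ x _ => x)
      (fun i => @measurable_pi_lambda _ _ _ _ (fun j => m j) _ fun j => measurable_id.mono le_rfl (hm j))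
  · intro i
    rw [iIndepFun_iff_iIndep, iIndep_iff]
    intro S f hf
    choose! g hg hg' using hf
    have e : ∀ A : Set Ω, MeasurableSet A →
        (Measure.infinitePi fun _ : ι => P) ((fun ω : ι → Ω => ω i) ⁻¹' A) = P A := by
      intro A hA
      exact (measurePreserving_eval_infinitePi (fun _ : ι => P) i).measure_preimage
        hA.nullMeasurableSet
    have h1 : ⋂ j ∈ S, f j = (fun ω : ι → Ω => ω i) ⁻¹' (⋂ j ∈ S, g j) := by
      rw [Set.preimage_iInter₂]
      exact Set.iInter₂_congr fun j hj => (hg' j hj).symm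
    rw [h1, e _ (Finset.measurableSet_biInter _ fun j hj => hm j _ (hg j hj)),
      h.meas_biInter hg]
    refine Finset.prod_congr rfl fun j hj => ?_
    rw [← hg' j hj, e _ (hm j _ (hg j hj))]

/-! ### The independent coordinates of the branching random walk -/

/-- The randomness at one backbone time. -/
abbrev Site (d : ℕ) : Type := Step d × Bush d

/-- The law of the randomness at one backbone time. -/
noncomputable def siteLaw (d : ℕ) [NeZero d] (p : PMF ℕ)
    (hmean : ∑' k : ℕ, (k : ℝ≥0∞) * p k = 1) : Measure (Site d) :=
  (stepLaw d).toMeasure.prod (bushLaw d p hmean)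

instance (d : ℕ) [NeZero d] (p : PMF ℕ) (hmean : ∑' k : ℕ, (k : ℝ≥0∞) * p k = 1) :
    IsProbabilityMeasure (siteLaw d p hmean) := by
  unfold siteLaw
  infer_instance

/-- The `σ`-algebras of the single random choices at one backbone time: the backbone jump, the
numbers of children, and the jumps in the bush. -/
@[reducible] def siteAlg (d : ℕ) : Unit ⊕ (List ℕ ⊕ List ℕ) → MeasurableSpace (Site d) :=
  Sum.elim (fun _ => (inferInstance : MeasurableSpace (Step d)).comap Prod.fst) fun j =>
    (Sum.elim (fun u => ((inferInstance : MeasurableSpace ℕ).comap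
        fun c : List ℕ → ℕ => c u).comap Prod.fst)
      (fun u => ((inferInstance : MeasurableSpace (Step d)).comap
        fun c : List ℕ → Step d => c u).comap Prod.snd) j : MeasurableSpace (Bush d)).comap Prod.snd

lemma siteAlg_le (d : ℕ) (j : Unit ⊕ (List ℕ ⊕ List ℕ)) :
    siteAlg d j ≤ (inferInstance : MeasurableSpace (Site d)) := by
  rcases j with j | u | u
  · exact measurable_fst.comap_le
  · change MeasurableSpace.comap _ (MeasurableSpace.comap _ (MeasurableSpace.comap _ _)) ≤ _
    rw [MeasurableSpace.comap_comp, MeasurableSpace.comap_comp]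
    exact Measurable.comap_le (by fun_prop)
  · change MeasurableSpace.comap _ (MeasurableSpace.comap _ (MeasurableSpace.comap _ _)) ≤ _
    rw [MeasurableSpace.comap_comp, MeasurableSpace.comap_comp]
    exact Measurable.comap_le (by fun_prop)

lemma iIndep_siteAlg {d : ℕ} [NeZero d] (p : PMF ℕ)
    (hmean : ∑' k : ℕ, (k : ℝ≥0∞) * p k = 1) : iIndep (siteAlg d) (siteLaw d p hmean) := by
  unfold siteAlg siteLaw bushLaw
  refine iIndep_sumElim_prod iIndep.of_subsingleton (iIndep_sumElim_prod ?_ ?_)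
  · exact (iIndepFun_iff_iIndep _ _ _).1 (iIndepFun_infinitePi (X := fun _ x => x)
      (fun _ => measurable_id))
  · exact (iIndepFun_iff_iIndep _ _ _).1 (iIndepFun_infinitePi (X := fun _ x => x)
      (fun _ => measurable_id))

/-- The `σ`-algebras of all single random choices. -/
@[reducible] def atomAlg (d : ℕ) (a : ℤ × (Unit ⊕ (List ℕ ⊕ List ℕ))) : MeasurableSpace (Sample d) :=
  (siteAlg d a.2).comap fun ω => ω a.1

lemma atomAlg_le {d : ℕ} (a : ℤ × (Unit ⊕ (List ℕ ⊕ List ℕ))) :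
    atomAlg d a ≤ (inferInstance : MeasurableSpace (Sample d)) := by
  refine (MeasurableSpace.comap_mono (siteAlg_le d a.2)).trans ?_
  exact (measurable_pi_apply a.1).comap_le

lemma iIndep_atomAlg {d : ℕ} [NeZero d] (p : PMF ℕ)
    (hmean : ∑' k : ℕ, (k : ℝ≥0∞) * p k = 1) : iIndep (atomAlg d) (law d p hmean) :=
  iIndep_infinitePi (siteAlg_le d) (iIndep_siteAlg p hmean)

end BRW

/-! ### Independence of disjoint sets of random choices. -/

namespace BRW

open ProbabilityTheory

/-- The `σ`-algebra of the random choices in `S`. -/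
@[reducible] def choiceAlg (d : ℕ) (S : Set (ℤ × (Unit ⊕ (List ℕ ⊕ List ℕ)))) :
    MeasurableSpace (Sample d) := ⨆ a ∈ S, atomAlg d a

lemma choiceAlg_le {d : ℕ} (S : Set (ℤ × (Unit ⊕ (List ℕ ⊕ List ℕ)))) :
    choiceAlg d S ≤ (inferInstance : MeasurableSpace (Sample d)) :=
  iSup₂_le fun a _ => atomAlg_le a

lemma atomAlg_le_choiceAlg {d : ℕ} {S : Set (ℤ × (Unit ⊕ (List ℕ ⊕ List ℕ)))}
    {a : ℤ × (Unit ⊕ (List ℕ ⊕ List ℕ))} (ha : a ∈ S) : atomAlg d a ≤ choiceAlg d S :=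
  le_iSup₂_of_le a ha le_rfl

lemma measurable_jump_choiceAlg {d : ℕ} {S : Set (ℤ × (Unit ⊕ (List ℕ ⊕ List ℕ)))} {m : ℤ}
    (h : (m, Sum.inl ()) ∈ S) : Measurable[choiceAlg d S] fun ω : Sample d => (ω m).1 := by
  have h1 : Measurable[siteAlg d (Sum.inl ())] fun y : Site d => y.1 :=
    comap_measurable _
  exact (h1.comp (comap_measurable (m := siteAlg d (Sum.inl ()))
    fun ω : Sample d => ω m)).mono (atomAlg_le_choiceAlg h) le_rfl

lemma measurable_children_choiceAlg {d : ℕ} {S : Set (ℤ × (Unit ⊕ (List ℕ ⊕ List ℕ)))} {m : ℤ}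
    {u : List ℕ} (h : (m, Sum.inr (Sum.inl u)) ∈ S) :
    Measurable[choiceAlg d S] fun ω : Sample d => (ω m).2.1 u := by
  have h1 : Measurable[siteAlg d (Sum.inr (Sum.inl u))] fun y : Site d => y.2.1 u := by
    intro t ht
    exact ⟨_, ⟨_, ⟨t, ht, rfl⟩, rfl⟩, rfl⟩
  exact (h1.comp (comap_measurable (m := siteAlg d (Sum.inr (Sum.inl u)))
    fun ω : Sample d => ω m)).mono (atomAlg_le_choiceAlg h) le_rfl

lemma measurable_bushJump_choiceAlg {d : ℕ} {S : Set (ℤ × (Unit ⊕ (List ℕ ⊕ List ℕ)))} {m : ℤ}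
    {u : List ℕ} (h : (m, Sum.inr (Sum.inr u)) ∈ S) :
    Measurable[choiceAlg d S] fun ω : Sample d => (ω m).2.2 u := by
  have h1 : Measurable[siteAlg d (Sum.inr (Sum.inr u))] fun y : Site d => y.2.2 u := by
    intro t ht
    exact ⟨_, ⟨_, ⟨t, ht, rfl⟩, rfl⟩, rfl⟩
  exact (h1.comp (comap_measurable (m := siteAlg d (Sum.inr (Sum.inr u)))
    fun ω : Sample d => ω m)).mono (atomAlg_le_choiceAlg h) le_rfl

lemma law_inter_of_disjoint {d : ℕ} [NeZero d] (p : PMF ℕ)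
    (hmean : ∑' k : ℕ, (k : ℝ≥0∞) * p k = 1)
    {S T : Set (ℤ × (Unit ⊕ (List ℕ ⊕ List ℕ)))} (hST : Disjoint S T) {A B : Set (Sample d)}
    (hA : MeasurableSet[choiceAlg d S] A) (hB : MeasurableSet[choiceAlg d T] B) :
    law d p hmean (A ∩ B) = law d p hmean A * law d p hmean B :=
  (Indep_iff _ _ _).1 (indep_iSup_of_disjoint (fun a => atomAlg_le a) (iIndep_atomAlg p hmean) hST)
    A B hA hB

/-! ### Measurability -/

lemma measurableSet_isVertex {Ω : Type*} [MeasurableSpace Ω] {d : ℕ} {b : Ω → Bush d}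
    (u : List ℕ) (h : ∀ w, w.length < u.length → Measurable fun x => (b x).1 w) :
    MeasurableSet {x | (b x).IsVertex u} := by
  induction u with
  | nil => simp [Bush.IsVertex]
  | cons k u ih =>
    have h1 : MeasurableSet {x | k < (b x).1 u} :=
      h u (by simp) (measurableSet_Ioi (a := k))
    exact h1.inter (ih fun w hw => h w (by simp; omega))

lemma measurable_pos {Ω : Type*} [MeasurableSpace Ω] {d : ℕ} {b : Ω → Bush d}
    (u : List ℕ) (h : ∀ w, Measurable fun x => (b x).2 w) :
    Measurable fun x => (b x).pos u := by
  induction u with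
  | nil => exact measurable_const
  | cons k u ih => exact ih.add ((Measurable.of_discrete (f := Step.vec)).comp (h (k :: u)))

/-! ### Numbers of vertices -/

lemma tsum_toMeasure_Ioi (r : PMF ℕ) :
    ∑' k : ℕ, r.toMeasure {z | k < z} = ∑' z : ℕ, (z : ℝ≥0∞) * r z := by
  have h1 : ∀ k : ℕ, r.toMeasure {z | k < z} = ∑' z, if k < z then r z else 0 := by
    intro k
    rw [PMF.toMeasure_apply _ MeasurableSet.of_discrete]
    exact tsum_congr fun z => by simp [Set.indicator_apply]
  simp_rw [h1]
  rw [ENNReal.tsum_comm]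
  refine tsum_congr fun z => ?_
  rw [tsum_eq_sum (s := Finset.range z) (fun k hk => by simp at hk; simp [hk])]
  rw [Finset.sum_congr rfl fun k hk => if_pos (Finset.mem_range.1 hk)]
  simp

lemma tsum_offspringLaw_Ioi_of_ne_nil (p : PMF ℕ) (hmean : ∑' k : ℕ, (k : ℝ≥0∞) * p k = 1)
    {u : List ℕ} (hu : u ≠ []) :
    ∑' k : ℕ, (offspringLaw p hmean u).toMeasure {z | k < z} = 1 := by
  rw [tsum_toMeasure_Ioi]
  simp [offspringLaw, hu, hmean]

/-- Dropping the subtraction of 1 leaves the mean of the size-biased law, which is the second moment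
of the offspring law. -/
lemma tsum_offspringLaw_Ioi_nil (p : PMF ℕ) (hmean : ∑' k : ℕ, (k : ℝ≥0∞) * p k = 1) :
    ∑' k : ℕ, (offspringLaw p hmean []).toMeasure {z | k < z}
      ≤ ∑' k : ℕ, (k : ℝ≥0∞) ^ 2 * p k := by
  have h : ∀ k : ℕ, (offspringLaw p hmean []).toMeasure {z | k < z}
      ≤ (sizeBiased p hmean).toMeasure {z | k < z} := by
    intro k
    simp only [offspringLaw, if_true]
    rw [PMF.toMeasure_map_apply _ _ _ Measurable.of_discrete MeasurableSet.of_discrete]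
    refine measure_mono fun z hz => ?_
    have hz' : k < z - 1 := hz
    change k < z
    omega
  refine (ENNReal.tsum_le_tsum h).trans (le_of_eq ?_)
  rw [tsum_toMeasure_Ioi]
  refine tsum_congr fun k => ?_
  change (k : ℝ≥0∞) * ((k : ℝ≥0∞) * p k) = _
  ring

section

variable {d : ℕ} [NeZero d] (p : PMF ℕ) (hmean : ∑' k : ℕ, (k : ℝ≥0∞) * p k = 1)

lemma measurePreserving_site (m : ℤ) :
    MeasurePreserving (fun ω : Sample d => ω m) (law d p hmean) (siteLaw d p hmean) :=
  measurePreserving_eval_infinitePi (fun _ : ℤ => siteLaw d p hmean) m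

lemma measurePreserving_jump (m : ℤ) :
    MeasurePreserving (fun ω : Sample d => (ω m).1) (law d p hmean) (stepLaw d).toMeasure :=
  measurePreserving_fst.comp (measurePreserving_site p hmean m)

lemma measurePreserving_children (m : ℤ) (u : List ℕ) :
    MeasurePreserving (fun ω : Sample d => (ω m).2.1 u) (law d p hmean)
      (offspringLaw p hmean u).toMeasure :=
  (measurePreserving_eval_infinitePi
    (fun u : List ℕ => (offspringLaw p hmean u).toMeasure) u).comp
    (measurePreserving_fst.comp (measurePreserving_snd.comp (measurePreserving_site p hmean m)))

lemma measurePreserving_bushJump (m : ℤ) (u : List ℕ) :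
    MeasurePreserving (fun ω : Sample d => (ω m).2.2 u) (law d p hmean)
      (stepLaw d).toMeasure :=
  (measurePreserving_eval_infinitePi (fun _ : List ℕ => (stepLaw d).toMeasure) u).comp
    (measurePreserving_snd.comp (measurePreserving_snd.comp (measurePreserving_site p hmean m)))

/-- The probability that `u` is a vertex of the bush at time `m`. -/
noncomputable def vertexProb (m : ℤ) (u : List ℕ) : ℝ≥0∞ :=
  law d p hmean {ω | (ω m).2.IsVertex u}

lemma vertexProb_nil (m : ℤ) : vertexProb (d := d) p hmean m [] = 1 := by
  simp [vertexProb, Bush.IsVertex]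

/-- Whether `u` is a vertex depends only on the numbers of children at strictly shorter addresses,
hence is independent of the number of children of `u` itself. -/
lemma vertexProb_cons (m : ℤ) (k : ℕ) (u : List ℕ) :
    vertexProb (d := d) p hmean m (k :: u)
      = (offspringLaw p hmean u).toMeasure {z | k < z} * vertexProb (d := d) p hmean m u := by
  have h0 : law d p hmean {ω | k < (ω m).2.1 u} = (offspringLaw p hmean u).toMeasure {z | k < z} :=
    (measurePreserving_children p hmean m u).measure_preimage
      MeasurableSet.of_discrete.nullMeasurableSet
  rw [← h0]
  refine law_inter_of_disjoint p hmean (S := {(m, Sum.inr (Sum.inl u))})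
    (T := {a | ∃ w : List ℕ, w.length < u.length ∧ a = (m, Sum.inr (Sum.inl w))}) ?_ ?_ ?_
  · rw [Set.disjoint_singleton_left]
    rintro ⟨w, hw, h⟩
    simp only [Prod.mk.injEq, Sum.inr.injEq, Sum.inl.injEq, true_and] at h
    exact absurd hw (by simp [h])
  · exact (measurable_children_choiceAlg (Set.mem_singleton _)) (measurableSet_Ioi (a := k))
  · exact @measurableSet_isVertex _ (choiceAlg d _) d (fun ω => (ω m).2) u fun w hw =>
      measurable_children_choiceAlg ⟨w, hw, rfl⟩

/-- The expected number of vertices in a generation of a bush is bounded. -/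
lemma tsum_vertexProb_generation_le (m : ℤ) (a : ℕ) :
    ∑' u : List ℕ, (if u.length = a then vertexProb (d := d) p hmean m u else 0)
      ≤ 1 + ∑' k : ℕ, (k : ℝ≥0∞) ^ 2 * p k := by
  set V := ∑' k : ℕ, (k : ℝ≥0∞) ^ 2 * p k
  have h0 : ∑' u : List ℕ, (if u.length = 0 then vertexProb (d := d) p hmean m u else 0) = 1 := by
    rw [tsum_eq_single [] fun u hu => by simp [hu]]
    simp [vertexProb_nil]
  -- The addresses of length `a + 1` are the children `k :: u` of those of length `a`; summing over
  -- `k` produces the mean number of children of `u`.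
  have hrec : ∀ a, ∑' u : List ℕ,
      (if u.length = a + 1 then vertexProb (d := d) p hmean m u else 0)
      = ∑' u : List ℕ, (∑' k, (offspringLaw p hmean u).toMeasure {z | k < z}) *
        (if u.length = a then vertexProb (d := d) p hmean m u else 0) := by
    intro a
    have hinj : Function.Injective fun y : List ℕ × ℕ => y.2 :: y.1 := by
      rintro ⟨u, k⟩ ⟨u', k'⟩ h
      simp_all
    rw [← hinj.tsum_eq (f := fun u : List ℕ =>
      if u.length = a + 1 then vertexProb (d := d) p hmean m u else 0)]
    · rw [ENNReal.tsum_prod (f := fun (u : List ℕ) (k : ℕ) =>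
        if (k :: u).length = a + 1 then vertexProb (d := d) p hmean m (k :: u) else 0)]
      refine tsum_congr fun u => ?_
      rw [← ENNReal.tsum_mul_right]
      refine tsum_congr fun k => ?_
      simp only [List.length_cons, Nat.add_right_cancel_iff, vertexProb_cons]
      split_ifs <;> simp
    · intro u hu
      cases u with
      | nil => simp at hu
      | cons k u => exact ⟨(u, k), rfl⟩
  have h1 : ∑' u : List ℕ, (if u.length = 1 then vertexProb (d := d) p hmean m u else 0) ≤ V := by
    rw [hrec 0, tsum_eq_single [] fun u hu => by simp [hu]]
    simpa [vertexProb_nil] using tsum_offspringLaw_Ioi_nil p hmean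
  -- From the first generation on, no parent is the root, so every mean is 1 and the expected size
  -- stays constant.
  have h2 : ∀ a, ∑' u : List ℕ,
      (if u.length = a + 1 then vertexProb (d := d) p hmean m u else 0) ≤ V := by
    intro a
    induction a with
    | zero => exact h1
    | succ a ih =>
      refine le_trans (le_of_eq ?_) ih
      rw [hrec (a + 1)]
      refine tsum_congr fun u => ?_
      by_cases hu : u.length = a + 1
      · have : u ≠ [] := by rintro rfl; simp at hu
        rw [tsum_offspringLaw_Ioi_of_ne_nil p hmean this, one_mul]
      · simp [hu]
  cases a with
  | zero => rw [h0]; exact le_self_add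
  | succ a => exact (h2 a).trans le_add_self

lemma tsum_vertexProb_mul_le (m : ℤ) (g : ℕ → ℝ≥0∞) :
    ∑' u : List ℕ, vertexProb (d := d) p hmean m u * g u.length
      ≤ (1 + ∑' k : ℕ, (k : ℝ≥0∞) ^ 2 * p k) * ∑' a, g a := by
  have h : ∀ u : List ℕ, vertexProb (d := d) p hmean m u * g u.length
      = ∑' a, (if u.length = a then vertexProb (d := d) p hmean m u else 0) * g a := by
    intro u
    rw [tsum_eq_single u.length fun a ha => by simp [Ne.symm ha]]
    simp
  simp_rw [h]
  rw [ENNReal.tsum_comm, ← ENNReal.tsum_mul_left]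
  refine ENNReal.tsum_le_tsum fun a => ?_
  rw [ENNReal.tsum_mul_right]
  gcongr
  exact tsum_vertexProb_generation_le p hmean m a

end

end BRW

/-! ### Jumps along tree paths and the probability that two bushes meet. -/

namespace BRW

open ProbabilityTheory

/-- The addresses other than the root on the path from the root to `u`. -/
def ancestors : List ℕ → Finset (List ℕ)
  | [] => ∅
  | k :: u => insert (k :: u) (ancestors u)

lemma length_le_of_mem_ancestors {u w : List ℕ} (h : w ∈ ancestors u) :
    w.length ≤ u.length := by
  induction u with
  | nil => simp [ancestors] at h
  | cons k u ih =>
    rw [ancestors, Finset.mem_insert] at h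
    rcases h with rfl | h
    · exact le_rfl
    · exact (ih h).trans (by simp)

lemma cons_notMem_ancestors (k : ℕ) (u : List ℕ) : k :: u ∉ ancestors u := fun h => by
  have := length_le_of_mem_ancestors h
  simp at this

lemma card_ancestors (u : List ℕ) : (ancestors u).card = u.length := by
  induction u with
  | nil => rfl
  | cons k u ih =>
    rw [ancestors, Finset.card_insert_of_notMem (cons_notMem_ancestors k u), ih, List.length_cons]

lemma pos_eq_sum {d : ℕ} (b : Bush d) (u : List ℕ) :
    b.pos u = ∑ w ∈ ancestors u, (b.2 w).vec := by
  induction u with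
  | nil => rfl
  | cons k u ih =>
    rw [ancestors, Finset.sum_insert (cons_notMem_ancestors k u), Bush.pos, ih, add_comm]

lemma abs_vec_le {d : ℕ} (s : Step d) (i : Fin d) : |s.vec i| ≤ 1 := by
  unfold Step.vec
  rw [Pi.single_apply]
  split_ifs <;> simp

/-- All jumps: that of the backbone at time `n` is `(n, none)`, those of the bush at time `n` are
`(n, some u)`. -/
def jump {d : ℕ} (a : ℤ × Option (List ℕ)) (ω : Sample d) : Step d :=
  a.2.elim (ω a.1).1 (ω a.1).2.2

/-- The position in the list of all random choices of the jump with the given index. -/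
def jumpIndex (a : ℤ × Option (List ℕ)) : ℤ × (Unit ⊕ (List ℕ ⊕ List ℕ)) :=
  (a.1, a.2.elim (Sum.inl ()) fun u => Sum.inr (Sum.inr u))

lemma jumpIndex_injective : Function.Injective jumpIndex := by
  rintro ⟨m, o⟩ ⟨m', o'⟩ h
  cases o <;> cases o' <;> simp_all [jumpIndex]

lemma measurable_jump {d : ℕ} {S : Set (ℤ × (Unit ⊕ (List ℕ ⊕ List ℕ)))}
    (a : ℤ × Option (List ℕ)) (h : jumpIndex a ∈ S) :
    Measurable[choiceAlg d S] (jump (d := d) a) := by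
  rcases a with ⟨m, _ | u⟩
  · exact measurable_jump_choiceAlg h
  · exact measurable_bushJump_choiceAlg h

section

variable {d : ℕ} [NeZero d] (p : PMF ℕ) (hmean : ∑' k : ℕ, (k : ℝ≥0∞) * p k = 1)

lemma iIndepFun_jump : iIndepFun (jump (d := d)) (law d p hmean) := by
  rw [iIndepFun_iff_iIndep]
  refine iIndep_of_iIndep_of_le ((iIndep_atomAlg p hmean).precomp jumpIndex_injective) fun a => ?_
  have h := measurable_jump (d := d) (S := {jumpIndex a}) a (Set.mem_singleton _)
  have h2 : choiceAlg d {jumpIndex a} = atomAlg d (jumpIndex a) := iSup_singleton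
  rw [h2] at h
  exact h.comap_le

lemma law_jump_eq (i : ℤ × Option (List ℕ)) (a : Step d) :
    law d p hmean {ω | jump i ω = a} = (2 * d : ℝ≥0∞)⁻¹ := by
  have h : MeasurePreserving (jump (d := d) i) (law d p hmean) (stepLaw d).toMeasure := by
    rcases i with ⟨m, _ | u⟩
    · exact measurePreserving_jump p hmean m
    · exact measurePreserving_bushJump p hmean m u
  change law d p hmean (jump i ⁻¹' {a}) = _
  rw [h.measure_preimage MeasurableSet.of_discrete.nullMeasurableSet,
    PMF.toMeasure_apply_singleton _ _ MeasurableSet.of_discrete]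
  simp [stepLaw, mul_comm]

/-- Two bounds in one: the local limit bound in the number of steps, and the fact that a target at
distance `R` is out of reach of fewer than `R` steps. The decay in `R` is what makes a long straight
stretch of the backbone useful later. -/
lemma exists_law_signedWalk_le (d : ℕ) [NeZero d] : ∃ C : ℝ≥0∞, C ≠ ⊤ ∧
    ∀ (p : PMF ℕ) (hmean : ∑' k : ℕ, (k : ℝ≥0∞) * p k = 1)
      (η : ℤ × Option (List ℕ) → Bool) (s : Finset (ℤ × Option (List ℕ))) (x : Fin d → ℤ)
      (i : Fin d) (R : ℕ), (R : ℤ) ≤ |x i| →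
      law d p hmean {ω | ∑ a ∈ s, (if η a then (jump a ω).vec else -(jump a ω).vec) = x}
        ≤ C * powInv (d / 2) (s.card + 1 + R) := by
  refine ⟨ENNReal.ofReal (√2 ^ d * √((d : ℝ) ^ d)) * ENNReal.ofReal (2 ^ ((d : ℝ) / 2)),
    ENNReal.mul_ne_top ENNReal.ofReal_ne_top ENNReal.ofReal_ne_top,
    fun p hmean η s x i R hR => ?_⟩
  -- If `R ≤ s.card` then `s.card + 1 + R ≤ 2 * (s.card + 1)`, at the cost of the constant 2 ^
  -- (d/2); otherwise the event is empty.
  by_cases hs : R ≤ s.card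
  · refine (measure_signedWalk_le (iIndepFun_jump p hmean) (law_jump_eq p hmean) η s x).trans ?_
    rw [mul_assoc]
    gcongr
    unfold powInv
    rw [← ENNReal.ofReal_mul (by positivity)]
    refine ENNReal.ofReal_le_ofReal ?_
    have hb : (0 : ℝ) < ((s.card + 1 : ℕ) : ℝ) := by positivity
    have ha : (0 : ℝ) < ((s.card + 1 + R : ℕ) : ℝ) := by positivity
    have hab : ((s.card + 1 + R : ℕ) : ℝ) ≤ 2 * ((s.card + 1 : ℕ) : ℝ) := by
      exact_mod_cast (by omega)
    have h := Real.rpow_le_rpow ha.le hab (by positivity : (0 : ℝ) ≤ (d : ℝ) / 2)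
    rw [Real.mul_rpow two_pos.le hb.le] at h
    rw [Real.rpow_neg hb.le, Real.rpow_neg ha.le, ← div_eq_mul_inv, inv_eq_one_div,
      div_le_div_iff₀ (by positivity) (by positivity), one_mul]
    exact h
  · have hemp : {ω : Sample d | ∑ a ∈ s, (if η a then (jump a ω).vec else -(jump a ω).vec) = x}
        = ∅ := by
      rw [Set.eq_empty_iff_forall_notMem]
      intro ω hω
      have hω : ∑ a ∈ s, (if η a then (jump a ω).vec else -(jump a ω).vec) = x := hω
      have h1 : |x i| ≤ s.card := by
        rw [← hω, Finset.sum_apply]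
        refine (Finset.abs_sum_le_sum_abs _ _).trans ?_
        refine (Finset.sum_le_card_nsmul _ _ 1 fun a _ => ?_).trans (by simp)
        split_ifs
        · exact abs_vec_le _ _
        · rw [Pi.neg_apply, abs_neg]; exact abs_vec_le _ _
      omega
    rw [hemp]
    simp

/-- The bushes at the times `m` and `m'` have vertices whose positions relative to the roots
differ by `x` up to the sum of the backbone jumps in `S`. -/
def MeetAt (ω : Sample d) (S : Finset ℤ) (m m' : ℤ) (x : Fin d → ℤ) : Prop :=
  ∃ u v, (ω m).2.IsVertex u ∧ (ω m').2.IsVertex v ∧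
    ∑ k ∈ S, (ω k).1.vec + (ω m').2.pos v - (ω m).2.pos u = x

lemma measurableSet_meetAt {Ω : Type*} [MeasurableSpace Ω] {d : ℕ} {W : Ω → Sample d} {S : Finset ℤ}
    {m m' : ℤ} {x : Fin d → ℤ} (hS : ∀ k ∈ S, Measurable fun y => W y k)
    (hm : Measurable fun y => W y m) (hm' : Measurable fun y => W y m') :
    MeasurableSet {y | MeetAt (W y) S m m' x} := by
  simp only [MeetAt, Set.ofPred_exists]
  refine MeasurableSet.iUnion fun u => MeasurableSet.iUnion fun v => ?_
  refine (measurableSet_isVertex (b := fun y => (W y m).2) u fun w _ => by fun_prop).inter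
    ((measurableSet_isVertex (b := fun y => (W y m').2) v fun w _ => by fun_prop).inter ?_)
  have h1 : Measurable fun y => ∑ k ∈ S, (W y k).1.vec :=
    Finset.measurable_fun_sum S fun k hk =>
      (Measurable.of_discrete (f := Step.vec)).comp (measurable_fst.comp (hS k hk))
  have h2 := (h1.add (measurable_pos (b := fun y => (W y m').2) v fun w => by fun_prop)).sub
    (measurable_pos (b := fun y => (W y m).2) u fun w => by fun_prop)
  exact h2 (measurableSet_singleton x)

/-- Since `m ≠ m'`, the path through the two bushes and the backbone uses `S.card + u.length +
v.length` distinct jumps. Once the addresses are fixed, these jumps are independent of the numbers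
of children. -/
lemma law_pair_le {C : ℝ≥0∞} (hC : ∀ (p : PMF ℕ) (hmean : ∑' k : ℕ, (k : ℝ≥0∞) * p k = 1)
      (η : ℤ × Option (List ℕ) → Bool) (s : Finset (ℤ × Option (List ℕ))) (x : Fin d → ℤ)
      (i : Fin d) (R : ℕ), (R : ℤ) ≤ |x i| →
      law d p hmean {ω | ∑ a ∈ s, (if η a then (jump a ω).vec else -(jump a ω).vec) = x}
        ≤ C * powInv (d / 2) (s.card + 1 + R))
    (S : Finset ℤ) {m m' : ℤ} (hmm : m ≠ m') (u v : List ℕ) (x : Fin d → ℤ) (i : Fin d) (R : ℕ)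
    (hR : (R : ℤ) ≤ |x i|) :
    law d p hmean {ω | (ω m).2.IsVertex u ∧ (ω m').2.IsVertex v ∧
      ∑ k ∈ S, (ω k).1.vec + (ω m').2.pos v - (ω m).2.pos u = x}
      ≤ vertexProb (d := d) p hmean m u * (vertexProb (d := d) p hmean m' v *
        (C * powInv (d / 2) (S.card + 1 + R + u.length + v.length))) := by
  classical
  let c : ℤ → Set (ℤ × (Unit ⊕ (List ℕ ⊕ List ℕ))) := fun m =>
    Set.range fun u => (m, Sum.inr (Sum.inl u))
  have hv : ∀ m u, MeasurableSet[choiceAlg d (c m)] {ω : Sample d | (ω m).2.IsVertex u} :=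
    fun m u => @measurableSet_isVertex _ (choiceAlg d (c m)) d (fun ω => (ω m).2) u fun w _ =>
      measurable_children_choiceAlg ⟨w, rfl⟩
  have hi₀ : Function.Injective fun k : ℤ => (k, (none : Option (List ℕ))) := fun a b h => by
    simpa using h
  have hi₁ : ∀ m : ℤ, Function.Injective fun w : List ℕ => (m, some w) := fun m a b h => by
    simpa using h
  let s₀ : Finset (ℤ × Option (List ℕ)) := S.image fun k => (k, none)
  let s₁ : ℤ → List ℕ → Finset (ℤ × Option (List ℕ)) := fun m u =>
    (ancestors u).image fun w => (m, some w)
  let s : Finset (ℤ × Option (List ℕ)) := s₀ ∪ (s₁ m' v ∪ s₁ m u)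
  have hd1 : Disjoint (s₁ m' v) (s₁ m u) := by
    rw [Finset.disjoint_left]
    rintro ⟨k, o⟩ h1 h2
    simp only [s₁, Finset.mem_image, Prod.mk.injEq] at h1 h2
    obtain ⟨_, _, rfl, _⟩ := h1
    obtain ⟨_, _, h3, _⟩ := h2
    exact hmm h3
  have hd2 : Disjoint s₀ (s₁ m' v ∪ s₁ m u) := by
    rw [Finset.disjoint_left]
    rintro ⟨k, o⟩ h1 h2
    simp only [s₀, s₁, Finset.mem_union, Finset.mem_image, Prod.mk.injEq] at h1 h2
    obtain ⟨_, _, _, rfl⟩ := h1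
    rcases h2 with ⟨_, _, _, h⟩ | ⟨_, _, _, h⟩ <;> simp at h
  have hcard : s.card = S.card + v.length + u.length := by
    rw [Finset.card_union_of_disjoint hd2, Finset.card_union_of_disjoint hd1]
    rw [Finset.card_image_of_injective _ hi₀, Finset.card_image_of_injective _ (hi₁ m'),
      Finset.card_image_of_injective _ (hi₁ m), card_ancestors, card_ancestors, add_assoc]
  -- The jumps on the path to `u` enter the displacement with a minus sign.
  let η : ℤ × Option (List ℕ) → Bool := fun a => decide (a ∉ s₁ m u)
  have hsum : ∀ ω : Sample d, ∑ a ∈ s, (if η a then (jump a ω).vec else -(jump a ω).vec)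
      = ∑ k ∈ S, (ω k).1.vec + (ω m').2.pos v - (ω m).2.pos u := by
    intro ω
    rw [Finset.sum_union hd2, Finset.sum_union hd1, pos_eq_sum, pos_eq_sum, add_sub_assoc,
      sub_eq_add_neg]
    congr 1
    · rw [Finset.sum_congr rfl fun a ha => if_pos ?_]
      · rw [Finset.sum_image hi₀.injOn]; rfl
      · have : a ∉ s₁ m u := fun h =>
          Finset.disjoint_left.1 hd2 ha (Finset.mem_union_right _ h)
        simp [η, this]
    congr 1
    · rw [Finset.sum_congr rfl fun a ha => if_pos ?_]
      · rw [Finset.sum_image (hi₁ m').injOn]; rfl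
      · have : a ∉ s₁ m u := fun h => Finset.disjoint_left.1 hd1 ha h
        simp [η, this]
    · rw [Finset.sum_congr rfl fun a ha => if_neg ?_]
      · rw [Finset.sum_image (hi₁ m).injOn, Finset.sum_neg_distrib]; rfl
      · simp [η, ha]
  have hBm : MeasurableSet[choiceAlg d (Set.range jumpIndex)]
      {ω : Sample d | ∑ a ∈ s, (if η a then (jump a ω).vec else -(jump a ω).vec) = x} := by
    have : @Measurable _ _ (choiceAlg d (Set.range jumpIndex)) _
        fun ω : Sample d => ∑ a ∈ s, (if η a then (jump a ω).vec else -(jump a ω).vec) := by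
      refine Finset.measurable_fun_sum (m := choiceAlg d (Set.range jumpIndex)) s fun a _ => ?_
      have h1 := (Measurable.of_discrete (f := Step.vec (d := d))).comp
        (measurable_jump (d := d) (S := Set.range jumpIndex) a ⟨a, rfl⟩)
      split_ifs
      · exact h1
      · exact h1.neg
    exact this (measurableSet_singleton x)
  have hset : {ω : Sample d | (ω m).2.IsVertex u ∧ (ω m').2.IsVertex v ∧
      ∑ k ∈ S, (ω k).1.vec + (ω m').2.pos v - (ω m).2.pos u = x}
      = {ω | (ω m).2.IsVertex u} ∩ ({ω | (ω m').2.IsVertex v} ∩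
        {ω | ∑ a ∈ s, (if η a then (jump a ω).vec else -(jump a ω).vec) = x}) := by
    ext ω
    simp only [Set.mem_inter_iff, Set.mem_ofPred_eq, hsum]
  -- Three disjoint groups of choices: the numbers of children at `m`, those at `m'`, and all jumps.
  rw [hset, law_inter_of_disjoint p hmean (S := c m) (T := c m' ∪ Set.range jumpIndex) ?_ (hv m u) ?_,
    law_inter_of_disjoint p hmean (S := c m') (T := Set.range jumpIndex) ?_ (hv m' v) hBm]
  · refine mul_le_mul_right (mul_le_mul_right ?_ _) _
    refine (hC p hmean η s x i R hR).trans (le_of_eq ?_)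
    rw [hcard]
    congr 2
    ring
  · rw [Set.disjoint_left]
    rintro _ ⟨w, rfl⟩ ⟨⟨n, _ | w'⟩, h⟩ <;> simp [jumpIndex] at h
  · rw [Set.disjoint_left]
    rintro _ ⟨w, rfl⟩ (⟨w', h⟩ | ⟨⟨n, _ | w'⟩, h⟩)
    · simp only [Prod.mk.injEq] at h
      exact hmm h.1.symm
    · simp [jumpIndex] at h
    · simp [jumpIndex] at h
  · have hl : choiceAlg d (c m') ≤ choiceAlg d (c m' ∪ Set.range jumpIndex) :=
      biSup_mono fun _ h => Or.inl h
    have hr : choiceAlg d (Set.range jumpIndex) ≤ choiceAlg d (c m' ∪ Set.range jumpIndex) :=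
      biSup_mono fun _ h => Or.inr h
    exact @MeasurableSet.inter _ (choiceAlg d (c m' ∪ Set.range jumpIndex)) _ _
      (hl _ (hv m' v)) (hr _ hBm)

/-- The probability that two bushes meet. -/
lemma exists_law_meetAt_le (hd : 10 < d) (hsq : ∑' k : ℕ, (k : ℝ≥0∞) ^ 2 * p k < ⊤) :
    ∃ C : ℝ≥0∞, C ≠ ⊤ ∧ ∀ (S : Finset ℤ) (m m' : ℤ) (x : Fin d → ℤ) (i : Fin d) (R : ℕ),
      m ≠ m' → (R : ℤ) ≤ |x i| →
      law d p hmean {ω | MeetAt ω S m m' x} ≤ C * powInv (d / 2 - 2) (S.card + 1 + R) := by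
  have hd' : (11 : ℝ) ≤ d := by exact_mod_cast hd
  obtain ⟨C₀, hC₀, hC⟩ := exists_law_signedWalk_le d
  obtain ⟨C₁, hC₁, h1⟩ := exists_tsum_powInv_le (r := (d : ℝ) / 2) (by linarith)
  obtain ⟨C₂, hC₂, h2⟩ := exists_tsum_powInv_le (r := (d : ℝ) / 2 - 1) (by linarith)
  set V : ℝ≥0∞ := 1 + ∑' k : ℕ, (k : ℝ≥0∞) ^ 2 * p k
  have hV : V ≠ ⊤ := by simp [V, hsq.ne]
  refine ⟨V * (V * (C₀ * (C₁ * C₂))), by finiteness, fun S m m' x i R hmm hR => ?_⟩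
  set n := S.card + 1 + R
  have hn : 1 ≤ n := by omega
  -- Union bound over the two vertices. The sum over each generation lowers the exponent by one,
  -- from d/2 to d/2 - 2.
  calc law d p hmean {ω | MeetAt ω S m m' x}
      ≤ ∑' u, ∑' v, law d p hmean {ω | (ω m).2.IsVertex u ∧ (ω m').2.IsVertex v ∧
          ∑ k ∈ S, (ω k).1.vec + (ω m').2.pos v - (ω m).2.pos u = x} := by
        simp only [MeetAt, Set.ofPred_exists]
        exact (measure_iUnion_le _).trans (ENNReal.tsum_le_tsum fun u => measure_iUnion_le _)
    _ ≤ ∑' u, ∑' v, vertexProb (d := d) p hmean m u * (vertexProb (d := d) p hmean m' v *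
          (C₀ * powInv (d / 2) (n + u.length + v.length))) :=
        ENNReal.tsum_le_tsum fun u => ENNReal.tsum_le_tsum fun v =>
          law_pair_le p hmean hC S hmm u v x i R hR
    _ ≤ ∑' u : List ℕ, vertexProb (d := d) p hmean m u *
          (V * ∑' b, C₀ * powInv (d / 2) (n + u.length + b)) := by
        refine ENNReal.tsum_le_tsum fun u => ?_
        rw [ENNReal.tsum_mul_left]
        gcongr
        exact tsum_vertexProb_mul_le p hmean m' fun b => C₀ * powInv (d / 2) (n + u.length + b)
    _ ≤ V * ∑' a, (V * ∑' b, C₀ * powInv (d / 2) (n + a + b)) :=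
        tsum_vertexProb_mul_le p hmean m fun a => V * ∑' b, C₀ * powInv (d / 2) (n + a + b)
    _ ≤ V * ∑' a, (V * (C₀ * (C₁ * powInv (d / 2 - 1) (n + a)))) := by
        gcongr with a
        rw [ENNReal.tsum_mul_left]
        gcongr
        exact h1 (n + a) (by omega)
    _ = V * (V * (C₀ * (C₁ * ∑' a, powInv (d / 2 - 1) (n + a)))) := by
        simp only [ENNReal.tsum_mul_left]
    _ ≤ V * (V * (C₀ * (C₁ * (C₂ * powInv (d / 2 - 1 - 1) n)))) := by
        gcongr
        exact h2 n hn
    _ = _ := by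
        rw [show (d : ℝ) / 2 - 1 - 1 = d / 2 - 2 by ring]
        ring

end

end BRW

namespace BRW

open ProbabilityTheory

/-! ### Pivotal times through meeting bushes -/

lemma backbone_add_one {d : ℕ} (ω : Sample d) (n : ℤ) :
    backbone ω (n + 1) = backbone ω n + (ω n).1.vec := by
  unfold backbone
  rcases le_or_gt 0 n with hn | hn
  · rw [Finset.Ico_eq_empty_of_le (show (0 : ℤ) ≤ n + 1 by omega),
      Finset.Ico_eq_empty_of_le hn, ← Finset.insert_Ico_right_eq_Ico_add_one hn,
      Finset.sum_insert (by simp)]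
    simp [add_comm]
  · rw [Finset.Ico_eq_empty_of_le (show n + 1 ≤ (0 : ℤ) by omega),
      Finset.Ico_eq_empty_of_le hn.le, ← Finset.insert_Ico_add_one_left_eq_Ico hn,
      Finset.sum_insert (by simp)]
    simp

lemma backbone_eq_add_sum {d : ℕ} (ω : Sample d) {m n : ℤ} (h : m ≤ n) :
    backbone ω n = backbone ω m + ∑ k ∈ Finset.Ico m n, (ω k).1.vec := by
  induction n, h using Int.leInduction with
  | base => simp
  | succ n h ih =>
    rw [backbone_add_one, ih, ← Finset.insert_Ico_right_eq_Ico_add_one h,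
      Finset.sum_insert (by simp), add_assoc, add_comm (ω n).1.vec]

/-- The bushes at the times `m` and `m'` have a common point. -/
def Meet {d : ℕ} (ω : Sample d) (m m' : ℤ) : Prop := MeetAt ω (Finset.Ico m m') m m' 0

lemma meet_iff {d : ℕ} (ω : Sample d) {m m' : ℤ} (h : m ≤ m') :
    Meet ω m m' ↔ (bushRange ω m ∩ bushRange ω m').Nonempty := by
  have key : ∀ u v, ∑ k ∈ Finset.Ico m m', (ω k).1.vec + (ω m').2.pos v - (ω m).2.pos u = 0
      ↔ embed ω (m, u) = embed ω (m', v) := by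
    intro u v
    simp only [embed]
    rw [backbone_eq_add_sum ω h, sub_eq_zero, add_assoc, add_right_inj, eq_comm]
  constructor
  · rintro ⟨u, v, hu, hv, he⟩
    exact ⟨_, ⟨u, hu, rfl⟩, ⟨v, hv, ((key u v).1 he).symm⟩⟩
  · rintro ⟨x, ⟨u, hu, h1⟩, ⟨v, hv, h2⟩⟩
    exact ⟨u, v, hu, hv, (key u v).2 (h1.trans h2.symm)⟩

lemma isPivotal_iff {d : ℕ} (ω : Sample d) (i : ℤ) :
    IsPivotal ω i ↔ ∀ m ≤ i, ∀ m', i < m' → ¬ Meet ω m m' := by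
  unfold IsPivotal
  rw [Set.eq_empty_iff_forall_notMem]
  constructor
  · intro h m hm m' hm' hmeet
    obtain ⟨x, h1, h2⟩ := (meet_iff ω (by omega)).1 hmeet
    exact h x ⟨Set.mem_biUnion (Set.mem_Iic.2 hm) h1,
      Set.mem_biUnion (Set.mem_Ici.2 (show i + 1 ≤ m' by omega)) h2⟩
  · rintro h x ⟨h1, h2⟩
    simp only [Set.mem_iUnion, Set.mem_Iic, Set.mem_Ici, exists_prop] at h1 h2
    obtain ⟨m, hm, h1⟩ := h1
    obtain ⟨m', hm', h2⟩ := h2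
    exact h m hm m' (by omega) ((meet_iff ω (by omega)).2 ⟨x, h1, h2⟩)

/-- The shift of the backbone time. -/
def shift {d : ℕ} (k : ℤ) (ω : Sample d) : Sample d := fun n => ω (n + k)

lemma meet_shift {d : ℕ} (k : ℤ) (ω : Sample d) (m m' : ℤ) :
    Meet (shift k ω) m m' ↔ Meet ω (m + k) (m' + k) := by
  unfold Meet MeetAt shift
  rw [← Finset.map_add_right_Ico, Finset.sum_map]
  rfl

lemma isPivotal_shift {d : ℕ} (k : ℤ) (ω : Sample d) (i : ℤ) :
    IsPivotal (shift k ω) i ↔ IsPivotal ω (i + k) := by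
  simp only [isPivotal_iff, meet_shift]
  constructor
  · intro h m hm m' hm'
    have := h (m - k) (by omega) (m' - k) (by omega)
    simpa using this
  · intro h m hm m' hm'
    exact h _ (by omega) _ (by omega)

lemma measurePreserving_shift {d : ℕ} [NeZero d] (p : PMF ℕ)
    (hmean : ∑' k : ℕ, (k : ℝ≥0∞) * p k = 1) (k : ℤ) :
    MeasurePreserving (shift k) (law d p hmean) (law d p hmean) := by
  refine ⟨measurable_pi_lambda _ fun n => measurable_pi_apply _, ?_⟩
  exact Measure.map_infinitePi_infinitePi_of_inj (P := fun _ : ℤ => siteLaw d p hmean)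
    (f := fun n : ℤ => n + k) (add_left_injective k)

/-! ### The choices at a set of times -/

/-- The `σ`-algebra of all random choices at the times in `T`. -/
@[reducible] def timesAlg (d : ℕ) (T : Set ℤ) : MeasurableSpace (Sample d) :=
  choiceAlg d {a | a.1 ∈ T}

lemma timesAlg_mono {d : ℕ} {T T' : Set ℤ} (h : T ⊆ T') : timesAlg d T ≤ timesAlg d T' :=
  biSup_mono fun _ ha => h ha

lemma measurable_site_timesAlg {d : ℕ} {T : Set ℤ} {m : ℤ} (h : m ∈ T) :
    Measurable[timesAlg d T] fun ω : Sample d => ω m := by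
  have h1 : Measurable[timesAlg d T] fun ω : Sample d => (ω m).1 := measurable_jump_choiceAlg h
  have h2 : Measurable[timesAlg d T] fun ω : Sample d => (ω m).2.1 :=
    @measurable_pi_lambda _ _ _ (timesAlg d T) _ _ fun _ => measurable_children_choiceAlg h
  have h3 : Measurable[timesAlg d T] fun ω : Sample d => (ω m).2.2 :=
    @measurable_pi_lambda _ _ _ (timesAlg d T) _ _ fun _ => measurable_bushJump_choiceAlg h
  exact h1.prodMk (h2.prodMk h3)

lemma law_inter_of_disjoint_times {d : ℕ} [NeZero d] (p : PMF ℕ)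
    (hmean : ∑' k : ℕ, (k : ℝ≥0∞) * p k = 1)
    {T T' : Set ℤ} (hT : Disjoint T T') {A B : Set (Sample d)}
    (hA : MeasurableSet[timesAlg d T] A) (hB : MeasurableSet[timesAlg d T'] B) :
    law d p hmean (A ∩ B) = law d p hmean A * law d p hmean B :=
  law_inter_of_disjoint p hmean (Set.disjoint_left.2 fun _ h h' => Set.disjoint_left.1 hT h h') hA hB

lemma measurableSet_meetAt_timesAlg {d : ℕ} {T : Set ℤ} {S : Finset ℤ} {m m' : ℤ}
    (x : Fin d → ℤ) (hS : ∀ k ∈ S, k ∈ T) (hm : m ∈ T) (hm' : m' ∈ T) :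
    MeasurableSet[timesAlg d T] {ω : Sample d | MeetAt ω S m m' x} :=
  @measurableSet_meetAt _ (timesAlg d T) d (fun ω => ω) S m m' x
    (fun k hk => measurable_site_timesAlg (hS k hk)) (measurable_site_timesAlg hm)
    (measurable_site_timesAlg hm')

lemma measurableSet_meet_timesAlg {d : ℕ} {T : Set ℤ} {m m' : ℤ}
    (hS : ∀ k, m ≤ k → k < m' → k ∈ T) (hm : m ∈ T) (hm' : m' ∈ T) :
    MeasurableSet[timesAlg d T] {ω : Sample d | Meet ω m m'} :=
  measurableSet_meetAt_timesAlg 0 (fun k hk => hS k (Finset.mem_Ico.1 hk).1 (Finset.mem_Ico.1 hk).2)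
    hm hm'

lemma measurableSet_isPivotal {d : ℕ} (i : ℤ) :
    MeasurableSet {ω : Sample d | IsPivotal ω i} := by
  simp only [isPivotal_iff, Set.ofPred_forall]
  refine MeasurableSet.iInter fun m => MeasurableSet.iInter fun _ => MeasurableSet.iInter fun m' =>
    MeasurableSet.iInter fun _ => MeasurableSet.compl ?_
  exact choiceAlg_le _ _ (measurableSet_meet_timesAlg (T := Set.univ) (by simp) (by simp) (by simp))

/-! ### Sites with a small bush -/

/-- The backbone jump is in the first direction, and the bush consists of the root and `r` children,
all of which lie at the same side in the first direction. -/
def IsStraight {d : ℕ} [NeZero d] (r : ℕ) (b : Bool) (y : Site d) : Prop :=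
  y.1 = (0, true) ∧ y.2.1 [] = r ∧ ∀ j < r, y.2.1 [j] = 0 ∧ y.2.2 [j] = (0, b)

lemma IsStraight.pos_eq {d : ℕ} [NeZero d] {r : ℕ} {b : Bool} {y : Site d} (h : IsStraight r b y)
    {u : List ℕ} (hu : y.2.IsVertex u) :
    y.2.pos u = 0 ∨ y.2.pos u = Step.vec ((0 : Fin d), b) := by
  have h1 : ∀ u, y.2.IsVertex u → u = [] ∨ ∃ j < r, u = [j] := by
    intro u
    induction u with
    | nil => exact fun _ => Or.inl rfl
    | cons k u ih =>
      rintro ⟨hk, hu⟩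
      right
      rcases ih hu with rfl | ⟨j, hj, rfl⟩
      · exact ⟨k, by rwa [h.2.1] at hk, rfl⟩
      · rw [(h.2.2 j hj).1] at hk
        exact absurd hk (by simp)
  rcases h1 u hu with rfl | ⟨j, hj, rfl⟩
  · exact Or.inl rfl
  · right
    simp [Bush.pos, (h.2.2 j hj).2]

lemma measurableSet_isStraight {d : ℕ} [NeZero d] (r : ℕ) (b : Bool) :
    MeasurableSet {y : Site d | IsStraight r b y} := by
  unfold IsStraight
  refine MeasurableSet.inter ?_ (MeasurableSet.inter ?_ ?_)
  · exact (show Measurable fun y : Site d => y.1 by fun_prop)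
      (measurableSet_singleton ((0 : Fin d), true))
  · exact (show Measurable fun y : Site d => y.2.1 [] by fun_prop) (measurableSet_singleton r)
  · change MeasurableSet {y : Site d | ∀ j < r, y.2.1 [j] = 0 ∧ y.2.2 [j] = (0, b)}
    simp only [Set.ofPred_forall]
    refine MeasurableSet.iInter fun j => MeasurableSet.iInter fun _ => MeasurableSet.inter ?_ ?_
    · exact (show Measurable fun y : Site d => y.2.1 [j] by fun_prop) (measurableSet_singleton 0)
    · exact (show Measurable fun y : Site d => y.2.2 [j] by fun_prop)
        (measurableSet_singleton ((0 : Fin d), b))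

/-- Supplies the number `r` of children of a small bush: the size-biased law charges `r + 1`, so a
root has `r` children with positive probability. -/
lemma exists_succ_ne_zero (p : PMF ℕ) (hmean : ∑' k : ℕ, (k : ℝ≥0∞) * p k = 1) : ∃ r, p (r + 1) ≠ 0 := by
  by_contra! h
  have : ∑' k : ℕ, (k : ℝ≥0∞) * p k = 0 := by
    rw [ENNReal.tsum_eq_zero]
    rintro (_ | k)
    · simp
    · simp [h k]
  rw [hmean] at this
  exact one_ne_zero this

/-- If the offspring number is never 0 then it is at least 1, and its mean 1 forces it to be 1
almost surely. The children of the root of a small bush can therefore be childless. -/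
lemma apply_zero_ne_zero (p : PMF ℕ) (hmean : ∑' k : ℕ, (k : ℝ≥0∞) * p k = 1) (hone : p 1 ≠ 1) : p 0 ≠ 0 := by
  intro h0
  have hle : ∀ k, p k ≤ (k : ℝ≥0∞) * p k := by
    rintro (_ | k)
    · simp [h0]
    · calc p (k + 1) = 1 * p (k + 1) := (one_mul _).symm
        _ ≤ _ := by gcongr; exact_mod_cast (by omega)
  have hz : ∀ k, k ≠ 1 → p k = 0 := by
    intro k hk
    by_contra hpk
    have hk0 : k ≠ 0 := fun h => hpk (h ▸ h0)
    have hlt : p k < (k : ℝ≥0∞) * p k := by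
      calc p k = 1 * p k := (one_mul _).symm
        _ < _ := by
          refine ENNReal.mul_lt_mul_left hpk (p.apply_ne_top k) ?_
          exact_mod_cast (by omega)
    have := ENNReal.tsum_lt_tsum (by rw [p.tsum_coe]; simp) hle hlt
    rw [p.tsum_coe, hmean] at this
    exact lt_irrefl _ this
  apply hone
  rw [← p.tsum_coe, tsum_eq_single 1 hz]

lemma siteLaw_isStraight_ne_zero {d : ℕ} [NeZero d] (p : PMF ℕ)
    (hmean : ∑' k : ℕ, (k : ℝ≥0∞) * p k = 1) (h0 : p 0 ≠ 0) {r : ℕ} (hr : p (r + 1) ≠ 0) (b : Bool) :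
    siteLaw d p hmean {y | IsStraight r b y} ≠ 0 := by
  classical
  have hstep : ∀ s : Step d, (stepLaw d).toMeasure {s} ≠ 0 := by
    intro s
    rw [PMF.toMeasure_apply_singleton _ _ MeasurableSet.of_discrete]
    simp [stepLaw, ENNReal.mul_eq_top]
  let F : Finset (List ℕ) := (Finset.range r).image fun j => [j]
  let A : Set (List ℕ → ℕ) := Set.pi ((insert [] F : Finset (List ℕ)) : Set (List ℕ))
    fun u => if u = [] then {r} else {0}
  let B : Set (List ℕ → Step d) := (F : Set (List ℕ)).pi fun _ => {((0 : Fin d), b)}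
  have hset : ({((0 : Fin d), true)} : Set (Step d)) ×ˢ (A ×ˢ B) ⊆ {y : Site d | IsStraight r b y} := by
    rintro ⟨s, c, g⟩ ⟨hs, hA, hB⟩
    refine ⟨hs, ?_, fun j hj => ⟨?_, ?_⟩⟩
    · simpa using hA [] (by simp)
    · simpa using hA [j] (by simp [F, hj])
    · exact hB [j] (by simp [F, hj])
  refine ne_bot_of_le_ne_bot ?_ (measure_mono hset)
  unfold siteLaw bushLaw
  rw [Measure.prod_prod, Measure.prod_prod, Measure.infinitePi_pi _ (fun _ _ => MeasurableSet.of_discrete),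
    Measure.infinitePi_pi _ (fun _ _ => MeasurableSet.of_discrete)]
  refine mul_ne_zero (hstep _) (mul_ne_zero (Finset.prod_ne_zero_iff.2 fun u _ => ?_)
    (Finset.prod_ne_zero_iff.2 fun u _ => hstep _))
  by_cases hu : u = []
  · subst hu
    simp only [if_true, offspringLaw]
    rw [PMF.toMeasure_map_apply _ _ _ Measurable.of_discrete MeasurableSet.of_discrete]
    refine ne_bot_of_le_ne_bot ?_ (measure_mono (s := {r + 1}) (by simp))
    rw [PMF.toMeasure_apply_singleton _ _ MeasurableSet.of_discrete]
    exact mul_ne_zero (by exact_mod_cast Nat.succ_ne_zero r) hr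
  · simp only [if_neg hu, offspringLaw]
    rw [PMF.toMeasure_apply_singleton _ _ MeasurableSet.of_discrete]
    exact h0

end BRW

namespace BRW

open ProbabilityTheory

/-! ### A pivotal time has positive probability -/

lemma vec_zero_true {d : ℕ} [NeZero d] : Step.vec ((0 : Fin d), true) = Pi.single 0 1 := rfl

lemma vec_zero_false {d : ℕ} [NeZero d] : Step.vec ((0 : Fin d), false) = Pi.single 0 (-1) := rfl

lemma sum_vec_Ico_consecutive {d : ℕ} (ω : Sample d) {a b c : ℤ} (hab : a ≤ b) (hbc : b ≤ c) :
    ∑ k ∈ Finset.Ico a c, (ω k).1.vec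
      = ∑ k ∈ Finset.Ico a b, (ω k).1.vec + ∑ k ∈ Finset.Ico b c, (ω k).1.vec := by
  have h1 := backbone_eq_add_sum ω hab
  have h2 := backbone_eq_add_sum ω hbc
  have h3 := backbone_eq_add_sum ω (hab.trans hbc)
  rw [h3, h1, add_assoc, add_right_inj] at h2
  exact h2

/-- The backbone is straight between the times `-K` and `K`, with small bushes pointing outwards. -/
def straightEvent (d : ℕ) [NeZero d] (r K : ℕ) : Set (Sample d) :=
  {ω | ∀ m ∈ Finset.Icc (-(K : ℤ)) K, IsStraight r (decide (0 < m)) (ω m)}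

/-- A bush at a time before `-K` meets one at a time after `K`, in terms of the choices outside of
`[-K, K]`, if the backbone is straight in between. -/
def outerMeet (d : ℕ) [NeZero d] (K i j : ℕ) : Set (Sample d) :=
  {ω | MeetAt ω (Finset.Ico (-(K : ℤ) - 1 - i) (-K) ∪ Finset.Ico ((K : ℤ) + 1) (K + 1 + j))
    (-(K : ℤ) - 1 - i) (K + 1 + j) (Pi.single 0 (-(2 * (K : ℤ) + 1)))}

/-- A bush at a time before `-K` meets the straight line. -/
def leftMeet (d : ℕ) [NeZero d] (K i c : ℕ) : Set (Sample d) :=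
  {ω | MeetAt ω (Finset.Ico (-(K : ℤ) - 1 - i) (-K)) (-(K : ℤ) - 1 - i) (K + 1)
    (Pi.single 0 (-(c : ℤ)))}

/-- A bush at a time after `K` meets the straight line. -/
def rightMeet (d : ℕ) [NeZero d] (K j c : ℕ) : Set (Sample d) :=
  {ω | MeetAt ω (Finset.Ico ((K : ℤ) + 1) (K + 1 + j)) (-(K : ℤ) - 1) (K + 1 + j)
    (Pi.single 0 (-(c : ℤ)))}

/-- The obstructions to the pivotality of `0` on the event `straightEvent`. -/
def obstruction (d : ℕ) [NeZero d] (K : ℕ) : Set (Sample d) :=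
  (⋃ i, ⋃ j, outerMeet d K i j) ∪
    ((⋃ i, ⋃ c ∈ Finset.Icc (K + 1) (2 * K + 2), leftMeet d K i c) ∪
      (⋃ j, ⋃ c ∈ Finset.Icc (K + 1) (2 * K + 2), rightMeet d K j c))

lemma sum_vec_straight {d : ℕ} [NeZero d] {r K : ℕ} {ω : Sample d} (h : ω ∈ straightEvent d r K)
    {a b : ℤ} (ha : -(K : ℤ) ≤ a) (hab : a ≤ b) (hb : b ≤ K + 1) :
    ∑ k ∈ Finset.Ico a b, (ω k).1.vec = Pi.single 0 (b - a) := by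
  have h1 : ∀ k ∈ Finset.Ico a b, (ω k).1.vec = Pi.single 0 1 := by
    intro k hk
    rw [Finset.mem_Ico] at hk
    rw [(h k (Finset.mem_Icc.2 ⟨by omega, by omega⟩)).1, vec_zero_true]
  rw [Finset.sum_congr rfl h1, Finset.sum_const, Int.card_Ico, ← Pi.single_smul']
  congr 1
  simp [hab]

/-- Within the straight stretch the bushes at times `m ≤ 0` have first coordinate at most 0 and
those at times `m' > 0` at least 1, so they cannot meet. Any meeting involves an outer bush, and
deducting the deterministic displacement of the stretch turns it into an obstruction. -/
lemma isPivotal_zero_of_straight {d : ℕ} [NeZero d] {r K : ℕ} {ω : Sample d}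
    (h : ω ∈ straightEvent d r K) (hF : ω ∉ obstruction d K) : IsPivotal ω 0 := by
  rw [isPivotal_iff]
  rintro m hm m' hm' ⟨u, v, hu, hv, he⟩
  apply hF
  have hpv : m' ≤ K → ∃ δ : ℤ, 0 ≤ δ ∧ δ ≤ 1 ∧ (ω m').2.pos v = Pi.single 0 δ := by
    intro hK
    have hs := h m' (Finset.mem_Icc.2 ⟨by omega, hK⟩)
    rcases hs.pos_eq hv with h0 | h0
    · exact ⟨0, by simp, by simp, by simp [h0]⟩
    · exact ⟨1, by simp, by simp, by simpa [hm', vec_zero_true] using h0⟩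
  have hpu : -(K : ℤ) ≤ m → ∃ δ : ℤ, 0 ≤ δ ∧ δ ≤ 1 ∧ (ω m).2.pos u = Pi.single 0 (-δ) := by
    intro hK
    have hs := h m (Finset.mem_Icc.2 ⟨hK, by omega⟩)
    rcases hs.pos_eq hu with h0 | h0
    · exact ⟨0, by simp, by simp, by simp [h0]⟩
    · refine ⟨1, by simp, by simp, ?_⟩
      rwa [decide_eq_false (by omega), vec_zero_false] at h0
  by_cases h1 : -(K : ℤ) ≤ m
  · obtain ⟨δ, hδ0, hδ1, hδ⟩ := hpu h1
    by_cases h2 : m' ≤ K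
    · obtain ⟨δ', hδ0', hδ1', hδ'⟩ := hpv h2
      rw [sum_vec_straight h h1 (by omega) (by omega), hδ, hδ'] at he
      have := congrFun he 0
      simp at this
      omega
    · right; right
      rw [sum_vec_Ico_consecutive ω (show m ≤ K + 1 by omega) (show (K : ℤ) + 1 ≤ m' by omega),
        sum_vec_straight h h1 (by omega) le_rfl, hδ] at he
      simp only [Set.mem_iUnion, Finset.mem_Icc]
      refine ⟨(m' - (K + 1)).toNat, (K + 1 - m + δ).toNat, by omega, [], v, trivial, ?_⟩
      rw [Int.toNat_of_nonneg (by omega), Int.toNat_of_nonneg (by omega)]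
      rw [show (K : ℤ) + 1 + (m' - (K + 1)) = m' by ring]
      refine ⟨hv, ?_⟩
      rw [Pi.single_neg] at he
      rw [Pi.single_neg, Pi.single_add]
      simp only [Bush.pos, sub_zero]
      linear_combination he
  · by_cases h2 : m' ≤ K
    · obtain ⟨δ, hδ0, hδ1, hδ⟩ := hpv h2
      right; left
      rw [sum_vec_Ico_consecutive ω (show m ≤ -K by omega) (show -(K : ℤ) ≤ m' by omega),
        sum_vec_straight h le_rfl (by omega) (by omega), hδ] at he
      simp only [Set.mem_iUnion, Finset.mem_Icc]
      refine ⟨(-K - 1 - m).toNat, (m' - -K + δ).toNat, by omega, u, [], ?_⟩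
      rw [Int.toNat_of_nonneg (by omega), Int.toNat_of_nonneg (by omega)]
      rw [show -(K : ℤ) - 1 - (-K - 1 - m) = m by ring]
      refine ⟨hu, trivial, ?_⟩
      rw [Pi.single_neg, Pi.single_add]
      simp only [Bush.pos, add_zero]
      linear_combination he
    · left
      rw [sum_vec_Ico_consecutive ω (show m ≤ -K by omega) (show -(K : ℤ) ≤ m' by omega),
        sum_vec_Ico_consecutive ω (show -(K : ℤ) ≤ K + 1 by omega)
          (show (K : ℤ) + 1 ≤ m' by omega), sum_vec_straight h le_rfl (by omega) le_rfl] at he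
      simp only [Set.mem_iUnion]
      refine ⟨(-K - 1 - m).toNat, (m' - (K + 1)).toNat, u, v, ?_⟩
      rw [Int.toNat_of_nonneg (by omega), Int.toNat_of_nonneg (by omega)]
      rw [show -(K : ℤ) - 1 - (-K - 1 - m) = m by ring,
        show (K : ℤ) + 1 + (m' - (K + 1)) = m' by ring]
      refine ⟨hu, hv, ?_⟩
      rw [Finset.sum_union (Finset.disjoint_left.2 fun a h3 h4 => by
        rw [Finset.mem_Ico] at h3 h4; omega), Pi.single_neg,
        show (2 : ℤ) * K + 1 = K + 1 - -K by ring]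
      linear_combination he

/-- The times outside of `[-K, K]`. -/
def outerTimes (K : ℕ) : Set ℤ := {m | m < -K ∨ (K : ℤ) < m}

lemma measurableSet_obstruction {d : ℕ} [NeZero d] (K : ℕ) :
    MeasurableSet[timesAlg d (outerTimes K)] (obstruction d K) := by
  refine MeasurableSet.union ?_ (MeasurableSet.union ?_ ?_)
  · refine MeasurableSet.iUnion fun i => MeasurableSet.iUnion fun j => ?_
    refine measurableSet_meetAt_timesAlg _ (fun k hk => ?_) ?_ ?_
    · rw [Finset.mem_union, Finset.mem_Ico, Finset.mem_Ico] at hk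
      simp only [outerTimes, Set.mem_ofPred_eq]; omega
    all_goals simp only [outerTimes, Set.mem_ofPred_eq]; omega
  · refine MeasurableSet.iUnion fun i => MeasurableSet.iUnion fun j => MeasurableSet.iUnion fun _ => ?_
    refine measurableSet_meetAt_timesAlg _ (fun k hk => ?_) ?_ ?_
    · rw [Finset.mem_Ico] at hk
      simp only [outerTimes, Set.mem_ofPred_eq]; omega
    all_goals simp only [outerTimes, Set.mem_ofPred_eq]; omega
  · refine MeasurableSet.iUnion fun i => MeasurableSet.iUnion fun j => MeasurableSet.iUnion fun _ => ?_
    refine measurableSet_meetAt_timesAlg _ (fun k hk => ?_) ?_ ?_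
    · rw [Finset.mem_Ico] at hk
      simp only [outerTimes, Set.mem_ofPred_eq]; omega
    all_goals simp only [outerTimes, Set.mem_ofPred_eq]; omega

lemma measurableSet_straightEvent {d : ℕ} [NeZero d] (r K : ℕ) :
    MeasurableSet[timesAlg d (Finset.Icc (-(K : ℤ)) K)] (straightEvent d r K) := by
  unfold straightEvent
  simp only [Set.ofPred_forall]
  refine MeasurableSet.iInter fun m => MeasurableSet.iInter fun hm => ?_
  exact (measurable_site_timesAlg (d := d) (T := Finset.Icc (-(K : ℤ)) K) hm)
    (measurableSet_isStraight r _)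

section

variable {d : ℕ} [NeZero d] (p : PMF ℕ) (hmean : ∑' k : ℕ, (k : ℝ≥0∞) * p k = 1)

lemma law_straightEvent_ne_zero (h0 : p 0 ≠ 0) {r : ℕ} (hr : p (r + 1) ≠ 0) (K : ℕ) :
    law d p hmean (straightEvent d r K) ≠ 0 := by
  have : straightEvent d r K = Set.pi (Finset.Icc (-(K : ℤ)) K : Set ℤ)
      fun m => {y | IsStraight r (decide (0 < m)) y} := by
    ext ω
    simp [straightEvent, Set.mem_pi]
  rw [this]
  unfold law
  rw [Measure.infinitePi_pi _ (fun m _ => measurableSet_isStraight r _)]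
  exact Finset.prod_ne_zero_iff.2 fun m _ => siteLaw_isStraight_ne_zero p hmean h0 hr _

lemma abs_single_neg_natCast (c : ℕ) : |(Pi.single 0 (-(c : ℤ)) : Fin d → ℤ) 0| = c := by simp

/-- Two outer bushes: summing (K + 1 + i + j)^(-(d/2 - 2)) over `i` and `j` costs two powers. One
outer bush: one sum, and the other power is lost to the `K + 2` possible values of `c`. -/
lemma exists_law_obstruction_le (hd : 10 < d) (hsq : ∑' k : ℕ, (k : ℝ≥0∞) ^ 2 * p k < ⊤) :
    ∃ C : ℝ≥0∞, C ≠ ⊤ ∧ ∀ K : ℕ,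
      law d p hmean (obstruction d K) ≤ C * powInv (d / 2 - 4) (K + 1) := by
  have hd' : (11 : ℝ) ≤ d := by exact_mod_cast hd
  obtain ⟨C₀, hC₀, h0⟩ := exists_law_meetAt_le p hmean hd hsq
  obtain ⟨C₁, hC₁, h1⟩ := exists_tsum_powInv_le (r := (d : ℝ) / 2 - 2) (by linarith)
  obtain ⟨C₂, hC₂, h2⟩ := exists_tsum_powInv_le (r := (d : ℝ) / 2 - 2 - 1) (by linarith)
  have hr : (d : ℝ) / 2 - 2 - 1 - 1 = d / 2 - 4 := by ring
  have hone : ∀ (S : Finset ℤ) (m m' : ℤ) (c n K : ℕ), m ≠ m' → K + 1 ≤ c → n ≤ S.card + 1 →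
      law d p hmean {ω : Sample d | MeetAt ω S m m' (Pi.single 0 (-(c : ℤ)))}
        ≤ C₀ * powInv (d / 2 - 2) (K + 1 + n) := by
    intro S m m' c n K hm hK hn
    -- The target is at distance `c ≥ K + 1` in direction 0, so the bound decays in `K` even if `S`
    -- is empty.
    refine (h0 S m m' _ 0 c hm (abs_single_neg_natCast c).ge).trans ?_
    gcongr
    exact powInv_anti (by linarith) (by omega) (by omega)
  have hside : ∀ (K : ℕ) (f : ℕ → ℕ → Set (Sample d)),
      (∀ i, ∀ c ∈ Finset.Icc (K + 1) (2 * K + 2),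
        law d p hmean (f i c) ≤ C₀ * powInv (d / 2 - 2) (K + 1 + i)) →
      law d p hmean (⋃ i, ⋃ c ∈ Finset.Icc (K + 1) (2 * K + 2), f i c)
        ≤ 2 * C₀ * C₁ * powInv (d / 2 - 4) (K + 1) := by
    intro K f hf
    calc law d p hmean (⋃ i, ⋃ c ∈ Finset.Icc (K + 1) (2 * K + 2), f i c)
        ≤ ∑' i, ∑ c ∈ Finset.Icc (K + 1) (2 * K + 2), law d p hmean (f i c) :=
          (measure_iUnion_le _).trans (ENNReal.tsum_le_tsum fun i => measure_biUnion_finset_le _ _)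
      _ ≤ ∑' i, 2 * ((K + 1 : ℕ) : ℝ≥0∞) * C₀ * powInv (d / 2 - 2) (K + 1 + i) := by
          refine ENNReal.tsum_le_tsum fun i => (Finset.sum_le_sum (hf i)).trans ?_
          rw [Finset.sum_const, nsmul_eq_mul, ← mul_assoc]
          gcongr
          rw [Nat.card_Icc]
          exact_mod_cast (by omega)
      _ ≤ 2 * ((K + 1 : ℕ) : ℝ≥0∞) * C₀ * (C₁ * powInv (d / 2 - 2 - 1) (K + 1)) := by
          rw [ENNReal.tsum_mul_left]
          gcongr
          exact h1 (K + 1) (by omega)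
      _ = 2 * C₀ * C₁ * (((K + 1 : ℕ) : ℝ≥0∞) * powInv (d / 2 - 2 - 1) (K + 1)) := by ring
      _ = _ := by rw [natCast_mul_powInv (by omega), hr]
  refine ⟨C₀ * C₁ * C₂ + (2 * C₀ * C₁ + 2 * C₀ * C₁), by finiteness, fun K => ?_⟩
  unfold obstruction
  rw [add_mul, add_mul]
  refine (measure_union_le _ _).trans (add_le_add ?_ ((measure_union_le _ _).trans
    (add_le_add ?_ ?_)))
  · calc _ ≤ ∑' i, ∑' j, law d p hmean (outerMeet d K i j) :=
          (measure_iUnion_le _).trans (ENNReal.tsum_le_tsum fun i => measure_iUnion_le _)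
      _ ≤ ∑' i, ∑' j, C₀ * powInv (d / 2 - 2) (K + 1 + i + j) := by
          refine ENNReal.tsum_le_tsum fun i => ENNReal.tsum_le_tsum fun j => ?_
          have := hone (Finset.Ico (-(K : ℤ) - 1 - i) (-K) ∪ Finset.Ico ((K : ℤ) + 1) (K + 1 + j))
            (-(K : ℤ) - 1 - i) (K + 1 + j) (2 * K + 1) (i + j) K (by omega) (by omega) (by
              rw [Finset.card_union_of_disjoint (Finset.disjoint_left.2 fun a h3 h4 => by
                rw [Finset.mem_Ico] at h3 h4; omega), Int.card_Ico, Int.card_Ico]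
              omega)
          rw [← add_assoc] at this
          push_cast at this
          exact this
      _ ≤ ∑' i, C₀ * (C₁ * powInv (d / 2 - 2 - 1) (K + 1 + i)) := by
          refine ENNReal.tsum_le_tsum fun i => ?_
          rw [ENNReal.tsum_mul_left]
          gcongr
          exact h1 _ (by omega)
      _ ≤ C₀ * (C₁ * (C₂ * powInv (d / 2 - 2 - 1 - 1) (K + 1))) := by
          rw [ENNReal.tsum_mul_left, ENNReal.tsum_mul_left]
          gcongr
          exact h2 _ (by omega)
      _ = _ := by rw [hr]; ring
  · refine hside K _ fun i c hc => ?_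
    rw [Finset.mem_Icc] at hc
    refine hone _ _ _ c i K (by omega) (by omega) ?_
    rw [Int.card_Ico]
    omega
  · refine hside K _ fun i c hc => ?_
    rw [Finset.mem_Icc] at hc
    refine hone _ _ _ c i K (by omega) (by omega) ?_
    rw [Int.card_Ico]
    omega

lemma tendsto_powInv {r : ℝ} (hr : 0 < r) :
    Tendsto (fun n : ℕ => powInv r (n + 1)) atTop (nhds 0) := by
  have h := (tendsto_rpow_neg_atTop hr).comp
    (tendsto_natCast_atTop_atTop.comp (tendsto_add_atTop_nat 1))
  have h2 := ENNReal.tendsto_ofReal h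
  rwa [ENNReal.ofReal_zero] at h2

/-- The time `0` is pivotal with positive probability. -/
theorem law_isPivotal_zero_ne_zero (hd : 10 < d) (hone : p 1 ≠ 1)
    (hsq : ∑' k : ℕ, (k : ℝ≥0∞) ^ 2 * p k < ⊤) : law d p hmean {ω | IsPivotal ω 0} ≠ 0 := by
  have hd' : (11 : ℝ) ≤ d := by exact_mod_cast hd
  obtain ⟨C, hC, h⟩ := exists_law_obstruction_le p hmean hd hsq
  obtain ⟨r, hr⟩ := exists_succ_ne_zero p hmean
  have ht : Tendsto (fun K : ℕ => C * powInv (d / 2 - 4) (K + 1)) atTop (nhds 0) := by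
    have := ENNReal.Tendsto.const_mul (a := C)
      (tendsto_powInv (r := (d : ℝ) / 2 - 4) (by linarith)) (Or.inr hC)
    rwa [mul_zero] at this
  -- It suffices that the obstruction has probability less than 1. The straight event may be very
  -- unlikely for this `K`, but by independence its probability factors out.
  obtain ⟨K, hK⟩ := (ht.eventually (gt_mem_nhds one_pos)).exists
  have hE := law_straightEvent_ne_zero (d := d) p hmean (apply_zero_ne_zero p hmean hone) hr K
  intro hzero
  have hsub : straightEvent d r K ⊆ {ω | IsPivotal ω 0} ∪ (straightEvent d r K ∩ obstruction d K) := by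
    intro ω hω
    by_cases hF : ω ∈ obstruction d K
    · exact Or.inr ⟨hω, hF⟩
    · exact Or.inl (isPivotal_zero_of_straight hω hF)
  have hle := (measure_mono hsub).trans (measure_union_le (μ := law d p hmean) _ _)
  rw [hzero, zero_add, law_inter_of_disjoint_times p hmean ?_ (measurableSet_straightEvent r K)
    (measurableSet_obstruction K)] at hle
  · have hlt : law d p hmean (straightEvent d r K) * law d p hmean (obstruction d K)
        < law d p hmean (straightEvent d r K) * 1 :=
      ENNReal.mul_lt_mul_right hE (measure_ne_top _ _) ((h K).trans_lt hK)
    rw [mul_one] at hlt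
    exact absurd hle (not_le.2 hlt)
  · rw [Set.disjoint_left]
    intro m h1 h2
    rw [Finset.mem_coe, Finset.mem_Icc] at h1
    simp only [outerTimes, Set.mem_ofPred_eq] at h2
    omega

end

end BRW

namespace BRW

open ProbabilityTheory

/-! ### Intervals without pivotal times -/

/-- `i` is pivotal for the bushes at the times in `(i - L, i + L]`. -/
def IsLocalPivotal {d : ℕ} (ω : Sample d) (L : ℕ) (i : ℤ) : Prop :=
  ∀ m, i - L < m → m ≤ i → ∀ m', i < m' → m' ≤ i + L → ¬ Meet ω m m'

lemma IsPivotal.isLocalPivotal {d : ℕ} {ω : Sample d} {i : ℤ} (h : IsPivotal ω i) (L : ℕ) :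
    IsLocalPivotal ω L i :=
  fun m _ hm m' hm' _ => (isPivotal_iff ω i).1 h m hm m' hm'

lemma measurableSet_isLocalPivotal {d : ℕ} (L : ℕ) (i : ℤ) :
    MeasurableSet[timesAlg d (Set.Ioc (i - L) (i + L))] {ω : Sample d | IsLocalPivotal ω L i} := by
  simp only [IsLocalPivotal, Set.ofPred_forall]
  refine MeasurableSet.iInter fun m => MeasurableSet.iInter fun h1 => MeasurableSet.iInter fun h2 =>
    MeasurableSet.iInter fun m' => MeasurableSet.iInter fun h3 => MeasurableSet.iInter fun h4 =>
    MeasurableSet.compl (measurableSet_meet_timesAlg (fun k hk hk' => ?_) ?_ ?_)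
  all_goals rw [Set.mem_Ioc]; omega

/-- There is no pivotal time in `[a, a + n)`. -/
def noPivot (d : ℕ) (a : ℤ) (n : ℕ) : Set (Sample d) :=
  {ω | ∀ i, a ≤ i → i < a + n → ¬ IsPivotal ω i}

lemma measurableSet_noPivot {d : ℕ} (a : ℤ) (n : ℕ) : MeasurableSet (noPivot d a n) := by
  simp only [noPivot, Set.ofPred_forall]
  exact MeasurableSet.iInter fun i => MeasurableSet.iInter fun _ => MeasurableSet.iInter fun _ =>
    (measurableSet_isPivotal i).compl

/-- Two bushes meet whose times are more than `L` apart and which separate some time in `[0, n)`. -/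
def longMeet (d : ℕ) (n L : ℕ) : Set (Sample d) :=
  {ω | ∃ m m' : ℤ, m < n ∧ 0 < m' ∧ L < m' - m ∧ Meet ω m m'}

/-- The center of the block number `j`. -/
def blockCenter (L j : ℕ) : ℤ := 2 * j * L + L - 1

/-- The center of none of the first `J` blocks is pivotal in its block. -/
def noLocalPivot (d : ℕ) (L J : ℕ) : Set (Sample d) :=
  {ω | ∀ j < J, ¬ IsLocalPivotal ω L (blockCenter L j)}

/-- The window of the block `j` is [2jL, 2(j + 1)L), so the first `J` blocks are disjoint and lie in
[0, n). If a centre is pivotal in its window but not globally, then a meeting pair separated by it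
has a member outside of the window, hence times more than `L` apart. -/
lemma noPivot_subset {d n L J : ℕ} (hL : 1 ≤ L) (hn : 2 * J * L ≤ n) :
    noPivot d 0 n ⊆ longMeet d n L ∪ noLocalPivot d L J := by
  intro ω hω
  by_contra hcon
  simp only [Set.mem_union, not_or, noLocalPivot, Set.mem_ofPred_eq, not_forall, not_not] at hcon
  obtain ⟨h1, j, hj, h2⟩ := hcon
  have hjn : 2 * (j : ℤ) * L + 2 * L ≤ n := by
    have : 2 * (j + 1) * L ≤ 2 * J * L := by gcongr; omega
    have : 2 * (j + 1) * L ≤ n := this.trans hn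
    zify at this
    linarith
  have hj0 : (0 : ℤ) ≤ 2 * j * L := by positivity
  refine hω (blockCenter L j) (by unfold blockCenter; omega) (by unfold blockCenter; omega) ?_
  rw [isPivotal_iff]
  intro m hm m' hm' hmeet
  by_cases hloc : blockCenter L j - L < m ∧ m' ≤ blockCenter L j + L
  · exact h2 m hloc.1 hm m' hm' hloc.2 hmeet
  · refine h1 ⟨m, m', ?_, ?_, ?_, hmeet⟩
    all_goals unfold blockCenter at *; omega

section

variable {d : ℕ} [NeZero d] (p : PMF ℕ) (hmean : ∑' k : ℕ, (k : ℝ≥0∞) * p k = 1)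

lemma law_isPivotal (i : ℤ) :
    law d p hmean {ω | IsPivotal ω i} = law d p hmean {ω | IsPivotal ω 0} := by
  rw [← (measurePreserving_shift p hmean i).measure_preimage
    (measurableSet_isPivotal 0).nullMeasurableSet]
  congr 1
  ext ω
  rw [Set.mem_preimage, Set.mem_ofPred_eq, Set.mem_ofPred_eq, isPivotal_shift, zero_add]

lemma law_noPivot (a : ℤ) (n : ℕ) :
    law d p hmean (noPivot d a n) = law d p hmean (noPivot d 0 n) := by
  rw [← (measurePreserving_shift p hmean a).measure_preimage
    (measurableSet_noPivot 0 n).nullMeasurableSet]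
  congr 1
  ext ω
  simp only [noPivot, Set.mem_preimage, Set.mem_ofPred_eq, isPivotal_shift]
  constructor
  · intro h i h1 h2
    exact h _ (by omega) (by omega)
  · intro h i h1 h2
    have := h (i - a) (by omega) (by omega)
    rwa [sub_add_cancel] at this

/-- The events for different blocks depend on disjoint sets of times. Each centre is locally pivotal
with at least the probability of being pivotal. -/
lemma law_noLocalPivot_le (L J : ℕ) :
    law d p hmean (noLocalPivot d L J) ≤ (1 - law d p hmean {ω | IsPivotal ω 0}) ^ J := by
  have hmeas : ∀ J : ℕ, MeasurableSet[timesAlg d (Set.Iio (2 * J * L : ℤ))] (noLocalPivot d L J) := by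
    intro J
    simp only [noLocalPivot, Set.ofPred_forall]
    refine MeasurableSet.iInter fun j => MeasurableSet.iInter fun hj => ?_
    refine MeasurableSet.compl (timesAlg_mono ?_ _ (measurableSet_isLocalPivotal L (blockCenter L j)))
    intro k hk
    rw [Set.mem_Ioc] at hk
    have : 2 * ((j + 1 : ℕ) : ℤ) * L ≤ 2 * J * L := by gcongr; exact_mod_cast hj
    push_cast at this
    have h2 : 2 * ((j : ℤ) + 1) * L = 2 * j * L + 2 * L := by ring
    rw [Set.mem_Iio]
    unfold blockCenter at hk
    omega
  induction J with
  | zero => simpa using prob_le_one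
  | succ J ih =>
    have hset : noLocalPivot d L (J + 1)
        = noLocalPivot d L J ∩ {ω : Sample d | IsLocalPivotal ω L (blockCenter L J)}ᶜ := by
      ext ω
      simp only [noLocalPivot, Set.mem_inter_iff, Set.mem_compl_iff, Set.mem_ofPred_eq]
      constructor
      · exact fun h => ⟨fun j hj => h j (by omega), h J (by omega)⟩
      · rintro ⟨h1, h2⟩ j hj
        rcases Nat.lt_succ_iff_lt_or_eq.1 hj with h | rfl
        · exact h1 j h
        · exact h2
    have hloc := measurableSet_isLocalPivotal (d := d) L (blockCenter L J)
    rw [hset, law_inter_of_disjoint_times p hmean ?_ (hmeas J) (MeasurableSet.compl hloc), pow_succ]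
    · refine mul_le_mul' ih ?_
      rw [prob_compl_eq_one_sub (choiceAlg_le _ _ hloc)]
      refine tsub_le_tsub_left ?_ _
      rw [← law_isPivotal p hmean (blockCenter L J)]
      exact measure_mono fun ω hω => hω.isLocalPivotal L
    · rw [Set.disjoint_left]
      intro k h1 h2
      rw [Set.mem_Iio] at h1
      rw [Set.mem_Ioc] at h2
      unfold blockCenter at h2
      omega

/-- At most `n + l` pairs of times at distance `l` separate a time in [0, n), and each meets with
probability of order l^(-(d/2 - 2)); the sum is over `l > L`. -/
lemma exists_law_longMeet_le (hd : 10 < d) (hsq : ∑' k : ℕ, (k : ℝ≥0∞) ^ 2 * p k < ⊤) :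
    ∃ C : ℝ≥0∞, C ≠ ⊤ ∧ ∀ n L : ℕ, law d p hmean (longMeet d n L)
      ≤ C * (n * powInv (d / 2 - 3) (L + 1) + powInv (d / 2 - 4) (L + 1)) := by
  have hd' : (11 : ℝ) ≤ d := by exact_mod_cast hd
  obtain ⟨C₀, hC₀, h0⟩ := exists_law_meetAt_le p hmean hd hsq
  obtain ⟨C₁, hC₁, h1⟩ := exists_tsum_powInv_le (r := (d : ℝ) / 2 - 2) (by linarith)
  obtain ⟨C₂, hC₂, h2⟩ := exists_tsum_powInv_le (r := (d : ℝ) / 2 - 2 - 1) (by linarith)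
  have hr3 : (d : ℝ) / 2 - 2 - 1 = d / 2 - 3 := by ring
  have hr4 : (d : ℝ) / 2 - 3 - 1 = d / 2 - 4 := by ring
  refine ⟨C₀ * (C₁ + C₂), by finiteness, fun n L => ?_⟩
  have hsub : longMeet d n L ⊆ ⋃ j : ℕ, ⋃ q ∈ Finset.range (n + (L + 1 + j)),
      {ω | Meet ω ((n : ℤ) - 1 - q) (n - 1 - q + (L + 1 + j))} := by
    rintro ω ⟨m, m', hm, hm', hl, hmeet⟩
    simp only [Set.mem_iUnion, Finset.mem_range, Set.mem_ofPred_eq]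
    refine ⟨(m' - m - (L + 1)).toNat, (n - 1 - m).toNat, by omega, ?_⟩
    rw [Int.toNat_of_nonneg (by omega), Int.toNat_of_nonneg (by omega)]
    convert hmeet using 1 <;> ring
  calc law d p hmean (longMeet d n L)
      ≤ ∑' j : ℕ, ∑ q ∈ Finset.range (n + (L + 1 + j)),
        law d p hmean {ω | Meet ω ((n : ℤ) - 1 - q) (n - 1 - q + (L + 1 + j))} :=
        (measure_mono hsub).trans ((measure_iUnion_le _).trans
          (ENNReal.tsum_le_tsum fun i => measure_biUnion_finset_le _ _))
    _ ≤ ∑' j : ℕ, ∑ q ∈ Finset.range (n + (L + 1 + j)), C₀ * powInv (d / 2 - 2) (L + 1 + j) := by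
        refine ENNReal.tsum_le_tsum fun j => Finset.sum_le_sum fun q _ => ?_
        refine (h0 _ _ _ 0 0 0 (by omega) (by simp)).trans ?_
        gcongr
        refine powInv_anti (by linarith) (by omega) ?_
        rw [Int.card_Ico]
        omega
    _ = ∑' j : ℕ, C₀ * (n * powInv (d / 2 - 2) (L + 1 + j) + powInv (d / 2 - 3) (L + 1 + j)) := by
        refine tsum_congr fun j => ?_
        rw [Finset.sum_const, Finset.card_range, nsmul_eq_mul, ← hr3,
          ← natCast_mul_powInv (show 1 ≤ L + 1 + j by omega)]
        push_cast
        ring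
    _ ≤ C₀ * (n * (C₁ * powInv (d / 2 - 3) (L + 1)) + C₂ * powInv (d / 2 - 4) (L + 1)) := by
        rw [ENNReal.tsum_mul_left, ENNReal.tsum_add, ENNReal.tsum_mul_left]
        rw [hr3] at h1 h2
        rw [hr4] at h2
        gcongr
        · exact h1 _ (by omega)
        · exact h2 _ (by omega)
    _ ≤ C₀ * (n * ((C₁ + C₂) * powInv (d / 2 - 3) (L + 1))
          + (C₁ + C₂) * powInv (d / 2 - 4) (L + 1)) := by
        gcongr
        · exact le_self_add
        · exact le_add_self
    _ = _ := by ring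

/-- The tail of the length of an interval without pivotal times. -/
theorem exists_law_noPivot_le (hd : 10 < d) (hone : p 1 ≠ 1)
    (hsq : ∑' k : ℕ, (k : ℝ≥0∞) ^ 2 * p k < ⊤) :
    ∃ C : ℝ, 0 < C ∧ ∀ (a : ℤ) (n : ℕ), 2 ≤ n → (law d p hmean).real (noPivot d a n)
      ≤ C * (Real.log n ^ (((d : ℝ) - 6) / 2) * (n : ℝ) ^ (-(((d : ℝ) - 8) / 2))) := by
  have hd' : (11 : ℝ) ≤ d := by exact_mod_cast hd
  obtain ⟨C₀, hC₀, hlong⟩ := exists_law_longMeet_le p hmean hd hsq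
  set c : ℝ := (law d p hmean).real {ω | IsPivotal ω 0} with hc
  have hc0 : 0 < c := ENNReal.toReal_pos (law_isPivotal_zero_ne_zero p hmean hd hone hsq)
    (measure_ne_top _ _)
  have hc1 : c ≤ 1 := measureReal_le_one
  set q : ℝ := ((d : ℝ) - 8) / 2 with hq
  have hq0 : 0 < q := by rw [hq]; linarith
  have hq1 : ((d : ℝ) - 6) / 2 = q + 1 := by rw [hq]; ring
  have hl2 : 0 < Real.log 2 := Real.log_pos one_lt_two
  -- `J ≤ B * log n`; the summand `1 / log 2` absorbs the rounding up, as `n ≥ 2`.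
  set B : ℝ := q / c + 1 / Real.log 2 with hB
  have hB0 : 0 < B := by positivity
  rw [hq1]
  refine ⟨C₀.toReal * ((2 * B) ^ (q + 1) + (2 * B) ^ q / Real.log 2)
    + (Real.log 2 ^ (q + 1))⁻¹ + (2 * B) ^ q / Real.log 2, by positivity, fun a n hn => ?_⟩
  have hlaw : (law d p hmean).real (noPivot d a n) = (law d p hmean).real (noPivot d 0 n) := by
    rw [Measure.real, Measure.real, law_noPivot]
  rw [hlaw]
  have hn0 : (0 : ℝ) < n := by positivity
  have hn2 : (2 : ℝ) ≤ n := by exact_mod_cast hn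
  set ℓ : ℝ := Real.log n with hℓ
  have hℓ2 : Real.log 2 ≤ ℓ := Real.log_le_log two_pos hn2
  have hℓ0 : 0 < ℓ := hl2.trans_le hℓ2
  -- The least number of blocks that guarantees `exp (-c * J) ≤ n ^ (-q)`.
  set J : ℕ := ⌈q / c * ℓ⌉₊ with hJ
  have hJ1 : q / c * ℓ ≤ J := Nat.le_ceil _
  have hJ0 : 0 < J := Nat.ceil_pos.2 (by positivity)
  have hJB : (J : ℝ) ≤ B * ℓ := by
    have h1 := (Nat.ceil_lt_add_one (show 0 ≤ q / c * ℓ by positivity)).le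
    have h2 : 1 ≤ 1 / Real.log 2 * ℓ := by
      rw [div_mul_eq_mul_div, one_mul]
      exact (one_le_div hl2).2 hℓ2
    rw [hB, add_mul]
    linarith
  have hnq : (0 : ℝ) < (n : ℝ) ^ (-q) := by positivity
  have hℓq : (0 : ℝ) < ℓ ^ (q + 1) := by positivity
  have hprod : ((2 * B * ℓ) ^ q : ℝ) ≤ (2 * B) ^ q / Real.log 2 * ℓ ^ (q + 1) := by
    rw [Real.mul_rpow (by positivity) hℓ0.le, Real.rpow_add_one hℓ0.ne', div_mul_eq_mul_div,
      le_div_iff₀ hl2]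
    have : (0 : ℝ) ≤ (2 * B) ^ q * ℓ ^ q := by positivity
    nlinarith
  -- If the blocks do not fit then `n` is at most a multiple of `log n`, and the claimed bound
  -- exceeds 1.
  by_cases hcase : n < 2 * J
  · have h1 : (n : ℝ) ≤ 2 * B * ℓ := by
      have : (n : ℝ) ≤ 2 * J := by exact_mod_cast hcase.le
      linarith
    have h2 : (n : ℝ) ^ q ≤ (2 * B * ℓ) ^ q := Real.rpow_le_rpow hn0.le h1 hq0.le
    have h3 : (1 : ℝ) ≤ (2 * B) ^ q / Real.log 2 * (ℓ ^ (q + 1) * (n : ℝ) ^ (-q)) := by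
      rw [Real.rpow_neg hn0.le, ← mul_assoc, ← div_eq_mul_inv, one_le_div (by positivity)]
      exact h2.trans hprod
    refine (measureReal_le_one).trans (h3.trans ?_)
    gcongr
    have : 0 ≤ C₀.toReal := ENNReal.toReal_nonneg
    exact le_add_of_nonneg_left (by positivity)
  · set L : ℕ := n / (2 * J) with hL
    have hL1 : 1 ≤ L := (Nat.one_le_div_iff (by omega)).2 (by omega)
    have hLn : 2 * J * L ≤ n := Nat.mul_div_le n (2 * J)
    have hy : (n : ℝ) / (2 * B * ℓ) ≤ ((L + 1 : ℕ) : ℝ) := by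
      have h1 : n < 2 * J * (L + 1) := Nat.lt_mul_div_succ n (by omega)
      have h2 : (n : ℝ) ≤ 2 * J * ((L + 1 : ℕ) : ℝ) := by exact_mod_cast h1.le
      rw [div_le_iff₀ (by positivity)]
      have h3 : (0 : ℝ) ≤ ((L + 1 : ℕ) : ℝ) := by positivity
      nlinarith
    have hpow : ∀ t : ℝ, 0 ≤ t →
        ((L + 1 : ℕ) : ℝ) ^ (-t) ≤ (2 * B * ℓ) ^ t * (n : ℝ) ^ (-t) := by
      intro t ht
      have h1 := Real.rpow_le_rpow_of_nonpos (show 0 < (n : ℝ) / (2 * B * ℓ) by positivity) hy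
        (show -t ≤ 0 by linarith)
      refine h1.trans (le_of_eq ?_)
      rw [Real.div_rpow hn0.le (by positivity), Real.rpow_neg (show 0 ≤ 2 * B * ℓ by positivity),
        div_inv_eq_mul, mul_comm]
    have hloc : (law d p hmean).real (noLocalPivot d L J) ≤ (n : ℝ) ^ (-q) := by
      have h1 : (law d p hmean).real (noLocalPivot d L J) ≤ (1 - c) ^ J := by
        have := ENNReal.toReal_mono (by finiteness) (law_noLocalPivot_le (d := d) p hmean L J)
        rw [ENNReal.toReal_pow, ENNReal.toReal_sub_of_le prob_le_one ENNReal.one_ne_top] at this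
        exact this
      refine h1.trans ?_
      have h2 : 1 - c ≤ Real.exp (-c) := by
        have := Real.add_one_le_exp (-c)
        linarith
      refine (pow_le_pow_left₀ (by linarith) h2 J).trans ?_
      rw [← Real.exp_nat_mul, Real.rpow_def_of_pos hn0]
      refine Real.exp_le_exp.2 ?_
      have h3 : q * ℓ ≤ c * J := by
        calc q * ℓ = c * (q / c * ℓ) := by field_simp
          _ ≤ c * J := by gcongr
      linarith
    have hlong' : (law d p hmean).real (longMeet d n L)
        ≤ C₀.toReal * ((n : ℝ) * ((L + 1 : ℕ) : ℝ) ^ (-(q + 1)) + ((L + 1 : ℕ) : ℝ) ^ (-q)) := by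
      have h1 := hlong n L
      have h2 : C₀ * (n * powInv (d / 2 - 3) (L + 1) + powInv (d / 2 - 4) (L + 1))
          = ENNReal.ofReal (C₀.toReal * ((n : ℝ) * ((L + 1 : ℕ) : ℝ) ^ (-(q + 1))
            + ((L + 1 : ℕ) : ℝ) ^ (-q))) := by
        rw [ENNReal.ofReal_mul ENNReal.toReal_nonneg, ENNReal.ofReal_toReal hC₀,
          ENNReal.ofReal_add (by positivity) (by positivity), ENNReal.ofReal_mul hn0.le,
          ENNReal.ofReal_natCast, powInv, powInv,
          show -(q + 1) = -((d : ℝ) / 2 - 3) by rw [hq]; ring,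
          show -q = -((d : ℝ) / 2 - 4) by rw [hq]; ring]
      rw [h2] at h1
      refine ENNReal.toReal_le_of_le_ofReal ?_ h1
      have : 0 ≤ C₀.toReal := ENNReal.toReal_nonneg
      positivity
    have hn1 : (n : ℝ) * (n : ℝ) ^ (-(q + 1)) = (n : ℝ) ^ (-q) := by
      rw [show -q = 1 + -(q + 1) by ring, Real.rpow_add hn0, Real.rpow_one]
    have e1 : (n : ℝ) * ((L + 1 : ℕ) : ℝ) ^ (-(q + 1))
        ≤ (2 * B) ^ (q + 1) * (ℓ ^ (q + 1) * (n : ℝ) ^ (-q)) := by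
      calc (n : ℝ) * ((L + 1 : ℕ) : ℝ) ^ (-(q + 1))
          ≤ (n : ℝ) * ((2 * B * ℓ) ^ (q + 1) * (n : ℝ) ^ (-(q + 1))) := by
            gcongr
            exact hpow (q + 1) (by linarith)
        _ = (2 * B) ^ (q + 1) * (ℓ ^ (q + 1) * ((n : ℝ) * (n : ℝ) ^ (-(q + 1)))) := by
            rw [Real.mul_rpow (by positivity) hℓ0.le]; ring
        _ = _ := by rw [hn1]
    have e2 : ((L + 1 : ℕ) : ℝ) ^ (-q)
        ≤ (2 * B) ^ q / Real.log 2 * (ℓ ^ (q + 1) * (n : ℝ) ^ (-q)) := by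
      refine (hpow q hq0.le).trans ?_
      rw [← mul_assoc]
      gcongr
    have e3 : (n : ℝ) ^ (-q) ≤ (Real.log 2 ^ (q + 1))⁻¹ * (ℓ ^ (q + 1) * (n : ℝ) ^ (-q)) := by
      rw [← mul_assoc]
      refine le_mul_of_one_le_left hnq.le ?_
      rw [inv_mul_eq_div, one_le_div (by positivity)]
      exact Real.rpow_le_rpow hl2.le hℓ2 (by linarith)
    have hX : (0 : ℝ) ≤ ℓ ^ (q + 1) * (n : ℝ) ^ (-q) := by positivity
    calc (law d p hmean).real (noPivot d 0 n)
        ≤ (law d p hmean).real (longMeet d n L) + (law d p hmean).real (noLocalPivot d L J) :=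
          (measureReal_mono (noPivot_subset hL1 hLn)).trans (measureReal_union_le _ _)
      _ ≤ C₀.toReal * ((2 * B) ^ (q + 1) * (ℓ ^ (q + 1) * (n : ℝ) ^ (-q))
            + (2 * B) ^ q / Real.log 2 * (ℓ ^ (q + 1) * (n : ℝ) ^ (-q)))
            + (Real.log 2 ^ (q + 1))⁻¹ * (ℓ ^ (q + 1) * (n : ℝ) ^ (-q)) :=
          add_le_add (hlong'.trans (mul_le_mul_of_nonneg_left (add_le_add e1 e2)
            ENNReal.toReal_nonneg)) (hloc.trans e3)
      _ = (C₀.toReal * ((2 * B) ^ (q + 1) + (2 * B) ^ q / Real.log 2)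
            + (Real.log 2 ^ (q + 1))⁻¹) * (ℓ ^ (q + 1) * (n : ℝ) ^ (-q)) := by ring
      _ ≤ _ := mul_le_mul_of_nonneg_right (le_add_of_nonneg_right (by positivity)) hX

end

end BRW

namespace BRW

open ProbabilityTheory

/-! ### The enumeration of the pivotal times -/

/-- The pivotal times are unbounded in both directions. -/
def IsGood {d : ℕ} (ω : Sample d) : Prop :=
  (∀ a : ℕ, ∃ i : ℤ, a ≤ i ∧ IsPivotal ω i) ∧ ∀ a : ℕ, ∃ i : ℤ, i ≤ -a ∧ IsPivotal ω i

lemma measurableSet_isGood {d : ℕ} : MeasurableSet {ω : Sample d | IsGood ω} := by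
  refine MeasurableSet.inter ?_ ?_
  · change MeasurableSet {ω : Sample d | ∀ a : ℕ, ∃ i : ℤ, a ≤ i ∧ IsPivotal ω i}
    simp only [Set.ofPred_forall, Set.ofPred_exists]
    exact MeasurableSet.iInter fun a => MeasurableSet.iUnion fun i =>
      (MeasurableSet.const _).inter (measurableSet_isPivotal i)
  · change MeasurableSet {ω : Sample d | ∀ a : ℕ, ∃ i : ℤ, i ≤ -a ∧ IsPivotal ω i}
    simp only [Set.ofPred_forall, Set.ofPred_exists]
    exact MeasurableSet.iInter fun a => MeasurableSet.iUnion fun i =>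
      (MeasurableSet.const _).inter (measurableSet_isPivotal i)

lemma IsGood.shift {d : ℕ} {ω : Sample d} (h : IsGood ω) (s : ℤ) : IsGood (shift s ω) := by
  refine ⟨fun a => ?_, fun a => ?_⟩
  · obtain ⟨i, h1, h2⟩ := h.1 (a + s).toNat
    refine ⟨i - s, by omega, ?_⟩
    rwa [isPivotal_shift, sub_add_cancel]
  · obtain ⟨i, h1, h2⟩ := h.2 (a - s).toNat
    refine ⟨i - s, by omega, ?_⟩
    rwa [isPivotal_shift, sub_add_cancel]

lemma IsGood.isPivotalEnumeration {d : ℕ} {ω : Sample d} (h : IsGood ω) :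
    IsPivotalEnumeration ω (pivotalTime ω) := by
  have hP : (Set.ofPred fun m : ℕ => IsPivotal ω ((m : ℤ) + 1)).Infinite := by
    refine Set.infinite_of_forall_exists_gt fun a => ?_
    obtain ⟨i, h1, h2⟩ := h.1 (a + 2)
    refine ⟨(i - 1).toNat, ?_, by omega⟩
    change IsPivotal ω (((i - 1).toNat : ℤ) + 1)
    rwa [Int.toNat_of_nonneg (by omega), sub_add_cancel]
  have hN : (Set.ofPred fun m : ℕ => IsPivotal ω (-(m : ℤ))).Infinite := by
    refine Set.infinite_of_forall_exists_gt fun a => ?_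
    obtain ⟨i, h1, h2⟩ := h.2 (a + 1)
    refine ⟨(-i).toNat, ?_, by omega⟩
    change IsPivotal ω (-((-i).toNat : ℤ))
    rwa [Int.toNat_of_nonneg (by omega), neg_neg]
  have hpos : ∀ i : ℤ, 0 < i → pivotalTime ω i
      = (Nat.nth (fun m : ℕ => IsPivotal ω ((m : ℤ) + 1)) (i - 1).toNat : ℤ) + 1 :=
    fun i hi => if_pos hi
  have hneg : ∀ i : ℤ, i ≤ 0 → pivotalTime ω i
      = -(Nat.nth (fun m : ℕ => IsPivotal ω (-(m : ℤ))) (-i).toNat : ℤ) :=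
    fun i hi => if_neg (by omega)
  refine ⟨strictMono_int_of_lt_succ fun i => ?_, ?_, ?_, ?_⟩
  · rcases lt_trichotomy i 0 with hi | rfl | hi
    · rw [hneg i hi.le, hneg (i + 1) (by omega), neg_lt_neg_iff, Nat.cast_lt]
      exact Nat.nth_strictMono hN (by omega)
    · rw [hneg 0 le_rfl, hpos (0 + 1) (by omega)]
      omega
    · rw [hpos i hi, hpos (i + 1) (by omega), add_lt_add_iff_right, Nat.cast_lt]
      exact Nat.nth_strictMono hP (by omega)
  · ext j
    constructor
    · rintro ⟨i, rfl⟩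
      rcases lt_or_ge 0 i with hi | hi
      · rw [hpos i hi]
        exact Nat.nth_mem_of_infinite hP _
      · rw [hneg i hi]
        exact Nat.nth_mem_of_infinite hN _
    · intro hj
      have hj : IsPivotal ω j := hj
      classical
      rcases lt_or_ge 0 j with hj0 | hj0
      · have h1 : IsPivotal ω (((j - 1).toNat : ℤ) + 1) := by
          rwa [Int.toNat_of_nonneg (by omega), sub_add_cancel]
        have h2 := Nat.nth_count (p := fun m : ℕ => IsPivotal ω ((m : ℤ) + 1)) h1
        refine ⟨(Nat.count (fun m : ℕ => IsPivotal ω ((m : ℤ) + 1)) (j - 1).toNat : ℤ) + 1, ?_⟩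
        rw [hpos _ (by omega), add_sub_cancel_right, Int.toNat_natCast, h2]
        omega
      · have h1 : IsPivotal ω (-((-j).toNat : ℤ)) := by
          rwa [Int.toNat_of_nonneg (by omega), neg_neg]
        have h2 := Nat.nth_count (p := fun m : ℕ => IsPivotal ω (-(m : ℤ))) h1
        refine ⟨-(Nat.count (fun m : ℕ => IsPivotal ω (-(m : ℤ))) (-j).toNat : ℤ), ?_⟩
        rw [hneg _ (by omega), neg_neg, Int.toNat_natCast, h2]
        omega
  · rw [hneg 0 le_rfl]; omega
  · rw [hpos 1 one_pos]; omega

namespace IsPivotalEnumeration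

variable {d : ℕ} {ω : Sample d} {γ γ' : ℤ → ℤ}

lemma isPivotal (h : IsPivotalEnumeration ω γ) (i : ℤ) : IsPivotal ω (γ i) := by
  have : γ i ∈ Set.range γ := ⟨i, rfl⟩
  rwa [h.range_eq] at this

lemma exists_eq (h : IsPivotalEnumeration ω γ) {j : ℤ} (hj : IsPivotal ω j) : ∃ i, γ i = j := by
  have : j ∈ Set.range γ := by rw [h.range_eq]; exact hj
  exact this

lemma zero_le (h : IsPivotalEnumeration ω γ) (h' : IsPivotalEnumeration ω γ') : γ 0 ≤ γ' 0 := by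
  obtain ⟨j, hj⟩ := h'.exists_eq (h.isPivotal 0)
  rw [← hj]
  refine h'.strictMono.monotone ?_
  by_contra hcon
  have h1 := h'.strictMono.monotone (show 1 ≤ j by omega)
  have h2 := h'.one_pos
  have h3 := h.zero_nonpos
  omega

lemma succ_le (h : IsPivotalEnumeration ω γ) (h' : IsPivotalEnumeration ω γ') {i : ℤ}
    (hi : γ i = γ' i) : γ (i + 1) ≤ γ' (i + 1) := by
  obtain ⟨j, hj⟩ := h.exists_eq (h'.isPivotal (i + 1))
  rw [← hj]
  refine h.strictMono.monotone ?_
  have h1 := h'.strictMono (show i < i + 1 by omega)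
  rw [← hj, ← hi] at h1
  have := h.strictMono.lt_iff_lt.1 h1
  omega

lemma pred_le (h : IsPivotalEnumeration ω γ) (h' : IsPivotalEnumeration ω γ') {i : ℤ}
    (hi : γ i = γ' i) : γ (i - 1) ≤ γ' (i - 1) := by
  obtain ⟨j, hj⟩ := h'.exists_eq (h.isPivotal (i - 1))
  rw [← hj]
  refine h'.strictMono.monotone ?_
  have h1 := h.strictMono (show i - 1 < i by omega)
  rw [← hj, hi] at h1
  have := h'.strictMono.lt_iff_lt.1 h1
  omega

/-- Allows the pivotal times of a shifted sample to be computed from those of the original one. The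
index 0 is pinned by the signs at 0 and 1, and successors and predecessors are then determined. -/
lemma unique (h : IsPivotalEnumeration ω γ) (h' : IsPivotalEnumeration ω γ') : γ = γ' := by
  funext i
  induction i using Int.induction_on with
  | zero => exact le_antisymm (h.zero_le h') (h'.zero_le h)
  | succ n ih => exact le_antisymm (h.succ_le h' ih) (h'.succ_le h ih.symm)
  | pred n ih => exact le_antisymm (h.pred_le h' ih) (h'.pred_le h ih.symm)

lemma shift (h : IsPivotalEnumeration ω γ) {s j : ℤ} (h1 : γ j ≤ s) (h2 : s < γ (j + 1)) :
    IsPivotalEnumeration (shift s ω) fun i => γ (i + j) - s where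
  strictMono := fun a b hab => by
    have := h.strictMono (show a + j < b + j by omega)
    dsimp only
    omega
  range_eq := by
    ext i
    rw [Set.mem_ofPred_eq, isPivotal_shift]
    constructor
    · rintro ⟨k, rfl⟩
      simpa using h.isPivotal (k + j)
    · intro hi
      obtain ⟨k, hk⟩ := h.exists_eq hi
      exact ⟨k - j, by simp [hk]⟩
  zero_nonpos := by rw [zero_add]; omega
  one_pos := by rw [add_comm]; omega

lemma not_isPivotal (h : IsPivotalEnumeration ω γ) {i j : ℤ} (h1 : γ i < j) (h2 : j < γ (i + 1)) :
    ¬ IsPivotal ω j := by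
  intro hj
  obtain ⟨k, rfl⟩ := h.exists_eq hj
  have h3 := h.strictMono.lt_iff_lt.1 h1
  have h4 := h.strictMono.lt_iff_lt.1 h2
  omega

end IsPivotalEnumeration

/-! ### Measurability of the pivotal times -/

lemma measurable_sInf_nat {Ω : Type*} [MeasurableSpace Ω] {S : Ω → Set ℕ}
    (h : ∀ k, MeasurableSet {x | k ∈ S x}) : Measurable fun x => sInf (S x) := by
  refine measurable_to_countable' fun k => ?_
  -- The infimum of the empty set is 0, hence the second piece for `k = 0`.
  have hset : (fun x => sInf (S x)) ⁻¹' {k}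
      = ({x | k ∈ S x} ∩ ⋂ j, ⋂ (_ : j < k), {x | j ∈ S x}ᶜ) ∪
        (({_x | k = 0}) ∩ ⋂ j, {x | j ∈ S x}ᶜ) := by
    ext x
    simp only [Set.mem_preimage, Set.mem_singleton_iff, Set.mem_union, Set.mem_inter_iff,
      Set.mem_iInter, Set.mem_compl_iff, Set.mem_ofPred_eq]
    constructor
    · rintro rfl
      rcases (S x).eq_empty_or_nonempty with he | hne
      · right; simp [he]
      · left; exact ⟨Nat.sInf_mem hne, fun j hj => Nat.notMem_of_lt_sInf hj⟩
    · rintro (⟨h1, h2⟩ | ⟨rfl, h2⟩)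
      · refine le_antisymm (Nat.sInf_le h1) ?_
        by_contra hcon
        exact h2 _ (not_le.1 hcon) (Nat.sInf_mem ⟨k, h1⟩)
      · have : S x = ∅ := Set.eq_empty_of_forall_notMem h2
        simp [this]
  rw [hset]
  exact ((h k).inter (MeasurableSet.iInter fun j => MeasurableSet.iInter fun _ => (h j).compl)).union
    ((MeasurableSet.const _).inter (MeasurableSet.iInter fun j => (h j).compl))

lemma measurable_nth {Ω : Type*} [MeasurableSpace Ω] {P : Ω → ℕ → Prop}
    (h : ∀ k, MeasurableSet {x | P x k}) (n : ℕ) : Measurable fun x => Nat.nth (P x) n := by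
  induction n using Nat.strong_induction_on with
  | _ n ih =>
    have hn : (fun x => Nat.nth (P x) n)
        = fun x => sInf {k | P x k ∧ ∀ j < n, Nat.nth (P x) j < k} :=
      funext fun x => Nat.nth_eq_sInf (P x) n
    rw [hn]
    refine measurable_sInf_nat fun k => ?_
    refine MeasurableSet.inter (h k) ?_
    change MeasurableSet {x | ∀ j < n, Nat.nth (P x) j < k}
    simp only [Set.ofPred_forall]
    exact MeasurableSet.iInter fun j => MeasurableSet.iInter fun hj => ih j hj measurableSet_Iio

lemma measurable_pivotalTime {d : ℕ} (i : ℤ) :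
    Measurable fun ω : Sample d => pivotalTime ω i := by
  unfold pivotalTime
  split_ifs
  · exact ((Measurable.of_discrete (f := fun n : ℕ => (n : ℤ) + 1)).comp
      (measurable_nth (P := fun (ω : Sample d) (m : ℕ) => IsPivotal ω ((m : ℤ) + 1))
        (fun k => measurableSet_isPivotal _) _))
  · exact ((Measurable.of_discrete (f := fun n : ℕ => -(n : ℤ))).comp
      (measurable_nth (P := fun (ω : Sample d) (m : ℕ) => IsPivotal ω (-(m : ℤ)))
        (fun k => measurableSet_isPivotal _) _))

/-! ### Transport of gaps -/

/-- The gap number `i` has at least the length `M`. -/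
def largeGap (d : ℕ) (i : ℤ) (M : ℕ) : Set (Sample d) :=
  {ω | IsGood ω ∧ (M : ℤ) ≤ pivotalTime ω (i + 1) - pivotalTime ω i}

/-- The gap of the origin has at least the length `M`, and the origin lies in the part number `r`
of length `b` of it. -/
def largeGapAt (d : ℕ) (M b r : ℕ) : Set (Sample d) :=
  {ω | ω ∈ largeGap d 0 M ∧ (r * b : ℤ) ≤ -pivotalTime ω 0 ∧ -pivotalTime ω 0 < (r + 1) * b}

lemma measurableSet_largeGap {d : ℕ} (i : ℤ) (M : ℕ) : MeasurableSet (largeGap d i M) :=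
  measurableSet_isGood.inter (((measurable_pivotalTime (i + 1)).sub (measurable_pivotalTime i))
    measurableSet_Ici)

lemma measurableSet_largeGapAt {d : ℕ} (M b r : ℕ) : MeasurableSet (largeGapAt d M b r) :=
  (measurableSet_largeGap 0 M).inter (((measurable_pivotalTime 0).neg measurableSet_Ici).inter
    ((measurable_pivotalTime 0).neg measurableSet_Iio))

section

variable {d : ℕ} [NeZero d] (p : PMF ℕ) (hmean : ∑' k : ℕ, (k : ℝ≥0∞) * p k = 1)

/-- The shift by γ_i - γ_0 + r b carries the origin into part `r` of the gap `i`, keeping its offset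
-γ_0 from the start of its own gap, which is less than `b`. The shift depends on the sample, so the
event is split according to k = γ_i - γ_0. After the shift, `k` is still visible as γ_0 - γ_{-i}, so
the images are disjoint and no mass is counted twice. -/
lemma law_gap_le_largeGapAt (i : ℤ) {M b R r : ℕ} (hR : R * b ≤ M) (hr : r < R) :
    law d p hmean {ω | ω ∈ largeGap d i M ∧ pivotalTime ω (0 + 1) - pivotalTime ω 0 ≤ b}
      ≤ law d p hmean (largeGapAt d M b r) := by
  set A := {ω : Sample d | ω ∈ largeGap d i M ∧ pivotalTime ω (0 + 1) - pivotalTime ω 0 ≤ b}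
  let D : ℤ → Set (Sample d) := fun k =>
    largeGapAt d M b r ∩ {ω | pivotalTime ω 0 - pivotalTime ω (-i) = k}
  have hD : ∀ k, MeasurableSet (D k) := fun k => (measurableSet_largeGapAt M b r).inter
    (((measurable_pivotalTime 0).sub (measurable_pivotalTime (-i))) (measurableSet_singleton k))
  have hsub : A ⊆ ⋃ k : ℤ, shift (k + r * b) ⁻¹' D k := by
    rintro ω ⟨⟨hg, hM⟩, hb⟩
    rw [zero_add] at hb
    have hE := hg.isPivotalEnumeration
    set γ := pivotalTime ω
    have h0 := hE.zero_nonpos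
    have h1 := hE.one_pos
    have hrb : ((r + 1 : ℕ) : ℤ) * b ≤ M := by
      have : (r + 1) * b ≤ R * b := by gcongr; omega
      exact_mod_cast this.trans hR
    push_cast at hrb
    have hrb' : ((r : ℤ) + 1) * b = r * b + b := by ring
    have hrb0 : (0 : ℤ) ≤ r * b := by positivity
    refine Set.mem_iUnion.2 ⟨γ i - γ 0, ?_⟩
    -- This lies in the gap `i`: it exceeds γ_i by `r * b - γ 0`, which is less than `(r + 1) * b ≤
    -- M`.
    set s : ℤ := γ i - γ 0 + r * b
    have hs := hE.shift (s := s) (j := i) (by omega) (by omega)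
    have hγ := (hg.shift s).isPivotalEnumeration.unique hs
    refine ⟨⟨⟨hg.shift s, ?_⟩, ?_, ?_⟩, ?_⟩
    · rw [hγ]
      dsimp only
      rw [zero_add, zero_add, add_comm 1 i]
      omega
    · rw [hγ]; dsimp only; rw [zero_add]; omega
    · rw [hγ]; dsimp only; rw [zero_add]; omega
    · change pivotalTime (shift s ω) 0 - pivotalTime (shift s ω) (-i) = γ i - γ 0
      rw [hγ]; dsimp only; rw [zero_add, neg_add_cancel]; omega
  calc law d p hmean A ≤ ∑' k : ℤ, law d p hmean (shift (k + r * b) ⁻¹' D k) :=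
        (measure_mono hsub).trans (measure_iUnion_le _)
    _ = ∑' k : ℤ, law d p hmean (D k) := by
        refine tsum_congr fun k => ?_
        exact (measurePreserving_shift p hmean _).measure_preimage (hD k).nullMeasurableSet
    _ = law d p hmean (⋃ k, D k) := by
        refine (measure_iUnion (fun k l hkl => Set.disjoint_left.2 ?_) hD).symm
        rintro ω ⟨_, h1⟩ ⟨_, h2⟩
        exact hkl (h1.symm.trans h2)
    _ ≤ _ := measure_mono (Set.iUnion_subset fun k => Set.inter_subset_left)

/-- The mass transport inequality for gaps. -/
lemma natCast_mul_law_gap_le (i : ℤ) {M b R : ℕ} (hR : R * b ≤ M) :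
    (R : ℝ≥0∞) * law d p hmean
      {ω | ω ∈ largeGap d i M ∧ pivotalTime ω (0 + 1) - pivotalTime ω 0 ≤ b}
      ≤ law d p hmean (largeGap d 0 M) := by
  calc _ = ∑ r ∈ Finset.range R, law d p hmean
        {ω | ω ∈ largeGap d i M ∧ pivotalTime ω (0 + 1) - pivotalTime ω 0 ≤ b} := by simp
    _ ≤ ∑ r ∈ Finset.range R, law d p hmean (largeGapAt d M b r) :=
        Finset.sum_le_sum fun r hr => law_gap_le_largeGapAt p hmean i hR (Finset.mem_range.1 hr)
    _ = law d p hmean (⋃ r ∈ Finset.range R, largeGapAt d M b r) := by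
        refine (measure_biUnion_finset (fun r _ r' _ hrr => Set.disjoint_left.2 ?_)
          fun r _ => measurableSet_largeGapAt M b r).symm
        rintro ω ⟨_, h1, h2⟩ ⟨_, h3, h4⟩
        have hb : (0 : ℤ) ≤ b := by positivity
        rcases lt_or_gt_of_ne hrr with h | h
        · have : ((r : ℤ) + 1) * b ≤ r' * b := by gcongr; exact_mod_cast h
          omega
        · have : ((r' : ℤ) + 1) * b ≤ r * b := by gcongr; exact_mod_cast h
          omega
    _ ≤ _ := measure_mono (Set.iUnion₂_subset fun r _ ω hω => hω.1)

/-- Either the gap of the origin is itself long, or the transport applies with a single part, `b =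
M`. -/
lemma law_largeGap_le (i : ℤ) (M : ℕ) :
    law d p hmean (largeGap d i M) ≤ 2 * law d p hmean (largeGap d 0 M) := by
  have hsub : largeGap d i M ⊆ largeGap d 0 M ∪
      {ω | ω ∈ largeGap d i M ∧ pivotalTime ω (0 + 1) - pivotalTime ω 0 ≤ M} := by
    intro ω hω
    rcases le_total (M : ℤ) (pivotalTime ω (0 + 1) - pivotalTime ω 0) with h | h
    · exact Or.inl ⟨hω.1, h⟩
    · exact Or.inr ⟨hω, h⟩
  have h := natCast_mul_law_gap_le (d := d) p hmean i (M := M) (b := M) (R := 1) (by simp)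
  rw [Nat.cast_one, one_mul] at h
  rw [two_mul]
  exact (measure_mono hsub).trans ((measure_union_le _ _).trans (add_le_add le_rfl h))

/-- The gap of index 0 surrounds the origin, so it extends at least `M / 2` to one of the two sides.
-/
lemma law_largeGap_zero_le (M : ℕ) :
    law d p hmean (largeGap d 0 M) ≤ 2 * law d p hmean (noPivot d 0 (M / 2)) := by
  have hsub : largeGap d 0 M ⊆ noPivot d 1 (M / 2) ∪ noPivot d (1 - (M / 2 : ℕ)) (M / 2) := by
    rintro ω ⟨hg, hM⟩
    have hE := hg.isPivotalEnumeration
    have h0 := hE.zero_nonpos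
    have h1 := hE.one_pos
    rw [zero_add] at hM
    by_cases h : ((M / 2 : ℕ) : ℤ) < pivotalTime ω 1
    · exact Or.inl fun j h2 h3 => hE.not_isPivotal (i := 0) (by omega) (by rw [zero_add]; omega)
    · refine Or.inr fun j h2 h3 => hE.not_isPivotal (i := 0) (by omega) (by rw [zero_add]; omega)
  refine (measure_mono hsub).trans ((measure_union_le _ _).trans (le_of_eq ?_))
  rw [law_noPivot p hmean 1, law_noPivot p hmean (1 - _), two_mul]

end

end BRW

namespace BRW

/-! ### Effective resistance and graph distance -/

/-- Along the path the increments of `f` add up to 1, so by Cauchy–Schwarz their squares add up to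
at least 1 / length. A path visits distinct vertices, so no edge is used twice. -/
lemma inv_length_le_energy {V : Type*} {G : SimpleGraph V} {x y : V} (w : G.Walk x y)
    (hw : w.IsPath) {f : V → ℝ} (hx : f x = 1) (hy : f y = 0) :
    ((w.length : ℝ≥0∞))⁻¹ ≤ energy G f := by
  classical
  set k := w.length
  let v : ℕ → V := w.getVert
  have hinj : ∀ i j, i ≤ k → j ≤ k → v i = v j → i = j := fun i j hi hj h =>
    hw.getVert_injOn hi hj h
  have hadj : ∀ i < k, G.Adj (v i) (v (i + 1)) := fun i hi => w.adj_getVert_succ hi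
  let F : V × V → ℝ≥0∞ := fun a =>
    if G.Adj a.1 a.2 then ENNReal.ofReal ((f a.1 - f a.2) ^ 2) else 0
  -- Both orientations of every edge of the path, matching the division by 2 in `energy`.
  let φ : Fin k × Bool → V × V := fun a =>
    if a.2 then (v a.1, v (a.1 + 1)) else (v (a.1 + 1), v a.1)
  have hφ : Function.Injective φ := by
    rintro ⟨⟨i, hi⟩, b⟩ ⟨⟨j, hj⟩, b'⟩ h
    cases b <;> cases b' <;> simp only [φ, if_true, Bool.false_eq_true, if_false,
      Prod.mk.injEq] at h
    · have := hinj _ _ hi.le hj.le h.2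
      simp [this]
    · have h1 := hinj _ _ hi hj.le h.1
      have h2 := hinj _ _ hi.le hj h.2
      omega
    · have h1 := hinj _ _ hi.le hj h.1
      have h2 := hinj _ _ hi hj.le h.2
      omega
    · have := hinj _ _ hi.le hj.le h.1
      simp [this]
  let Δ : ℕ → ℝ := fun i => f (v i) - f (v (i + 1))
  have hF : ∀ (i : Fin k) (b : Bool), F (φ (i, b)) = ENNReal.ofReal (Δ i ^ 2) := by
    intro i b
    cases b
    · simp only [F, φ, Bool.false_eq_true, if_false, if_pos (hadj i i.2).symm, Δ]
      rw [← neg_sub, neg_sq]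
    · simp only [F, φ, if_true, if_pos (hadj i i.2), Δ]
  have h1 : 2 * ENNReal.ofReal (∑ i ∈ Finset.range k, Δ i ^ 2) ≤ ∑' a, F a := by
    refine le_trans (le_of_eq ?_) (ENNReal.tsum_comp_le_tsum_of_injective hφ F)
    rw [tsum_fintype, Fintype.sum_prod_type]
    simp only [hF, Finset.sum_const, Finset.card_univ, Fintype.card_bool, nsmul_eq_mul]
    rw [← Finset.mul_sum, ENNReal.ofReal_sum_of_nonneg fun _ _ => sq_nonneg _,
      Finset.sum_range]
    rfl
  have h2 : ENNReal.ofReal (∑ i ∈ Finset.range k, Δ i ^ 2) ≤ energy G f := by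
    unfold energy
    rw [ENNReal.le_div_iff_mul_le (by simp) (by simp), mul_comm]
    refine h1.trans (le_of_eq ?_)
    rw [ENNReal.tsum_prod']
  have hsum : ∑ i ∈ Finset.range k, Δ i = 1 := by
    rw [Finset.sum_range_sub' (fun i => f (v i))]
    simp [v, k, hx, hy]
  have hcs := sq_sum_le_card_mul_sum_sq (s := Finset.range k) (f := Δ)
  rw [hsum, one_pow, Finset.card_range] at hcs
  have hk : (0 : ℝ) < k := by
    rcases Nat.eq_zero_or_pos k with h | h
    · rw [h] at hcs
      norm_num at hcs
    · exact_mod_cast h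
  refine le_trans ?_ h2
  rw [← ENNReal.ofReal_natCast, ← ENNReal.ofReal_inv_of_pos hk]
  refine ENNReal.ofReal_le_ofReal ?_
  rw [inv_le_iff_one_le_mul₀ hk, mul_comm]
  exact hcs

/-- The effective resistance is at most the length of any walk. -/
lemma effectiveResistance_le_length {V : Type*} {G : SimpleGraph V} {x y : V} (w : G.Walk x y) :
    effectiveResistance G x y ≤ w.length := by
  classical
  refine le_trans ?_ (Nat.cast_le.2 w.length_bypass_le_length)
  unfold effectiveResistance
  rw [← inv_inv ((w.bypass.length : ℝ≥0∞))]
  refine ENNReal.inv_le_inv.2 (le_iInf₂ fun f hf => ?_)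
  exact inv_length_le_energy w.bypass w.bypass_isPath hf.1 hf.2

lemma vec_ne_zero {d : ℕ} (s : Step d) : s.vec ≠ 0 := by
  intro h
  have := congrFun h s.1
  unfold Step.vec at this
  rw [Pi.single_eq_same] at this
  split_ifs at this
  all_goals simp at this

lemma graph_adj_backbone {d : ℕ} (ω : Sample d) (n : ℤ) :
    (graph ω).Adj (backbone ω n) (backbone ω (n + 1)) := by
  unfold graph
  rw [SimpleGraph.fromRel_adj]
  refine ⟨?_, Or.inl ⟨_, _, TreeEdge.backbone n, ?_, ?_⟩⟩
  · rw [backbone_add_one]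
    exact fun h => vec_ne_zero _ (left_eq_add.1 h)
  · simp [embed, Bush.pos]
  · simp [embed, Bush.pos]

lemma exists_walk_backbone {d : ℕ} (ω : Sample d) (a : ℤ) (n : ℕ) :
    ∃ w : (graph ω).Walk (backbone ω (a + n)) (backbone ω a), w.length = n := by
  induction n with
  | zero => exact ⟨SimpleGraph.Walk.nil.copy (by simp) rfl, by simp⟩
  | succ n ih =>
    obtain ⟨w, hw⟩ := ih
    have h := (graph_adj_backbone ω (a + n)).symm
    have he : a + ((n + 1 : ℕ) : ℤ) = a + n + 1 := by push_cast; ring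
    exact ⟨(SimpleGraph.Walk.cons h w).copy (by rw [he]) rfl, by simp [hw]⟩

lemma exists_walk_pivotalTime {d : ℕ} {ω : Sample d} (hg : IsGood ω) (i : ℤ) :
    ∃ w : (graph ω).Walk (backbone ω (pivotalTime ω (i + 1))) (backbone ω (pivotalTime ω i)),
      (w.length : ℝ) = gap ω i := by
  have hlt := hg.isPivotalEnumeration.strictMono (show i < i + 1 by omega)
  obtain ⟨w, hw⟩ := exists_walk_backbone ω (pivotalTime ω i)
    (pivotalTime ω (i + 1) - pivotalTime ω i).toNat
  have he : pivotalTime ω i + ((pivotalTime ω (i + 1) - pivotalTime ω i).toNat : ℤ)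
      = pivotalTime ω (i + 1) := by omega
  refine ⟨w.copy (by rw [he]) rfl, ?_⟩
  rw [SimpleGraph.Walk.length_copy, hw]
  unfold gap
  rw [← Int.cast_natCast, Int.toNat_of_nonneg (by omega), Int.cast_sub]

lemma pivotalResistance_le_gap {d : ℕ} {ω : Sample d} (hg : IsGood ω) (i : ℤ) :
    pivotalResistance ω i ≤ ENNReal.ofReal (gap ω i) := by
  obtain ⟨w, hw⟩ := exists_walk_pivotalTime hg i
  rw [← hw, ENNReal.ofReal_natCast]
  exact effectiveResistance_le_length w

lemma pivotalDist_le_gap {d : ℕ} {ω : Sample d} (hg : IsGood ω) (i : ℤ) :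
    pivotalDist ω i ≤ gap ω i := by
  obtain ⟨w, hw⟩ := exists_walk_pivotalTime hg i
  rw [← hw]
  exact Nat.cast_le.2 (SimpleGraph.dist_le w)

end BRW

/-! ### Tail bounds for a single gap and for the maximum over a window. -/

namespace BRW

lemma mem_largeGap_of_le_gap {d : ℕ} {ω : Sample d} (hg : IsGood ω) {i : ℤ} {x : ℝ}
    (h : x ≤ gap ω i) : ω ∈ largeGap d i ⌈x⌉₊ := by
  refine ⟨hg, ?_⟩
  have hlt := hg.isPivotalEnumeration.strictMono (show i < i + 1 by omega)
  have h1 : x ≤ ((pivotalTime ω (i + 1) - pivotalTime ω i).toNat : ℕ) := by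
    refine h.trans (le_of_eq ?_)
    unfold gap
    rw [← Int.cast_natCast, Int.toNat_of_nonneg (by omega), Int.cast_sub]
  have h2 := Nat.ceil_le.2 h1
  omega

section

variable {d : ℕ} [NeZero d] (p : PMF ℕ) (hmean : ∑' k : ℕ, (k : ℝ≥0∞) * p k = 1)

/-- The logarithm is absorbed into an arbitrarily small power of `n`, so that only exponents remain
to be compared. -/
lemma exists_law_noPivot_le_rpow (hd : 10 < d) (hone : p 1 ≠ 1)
    (hsq : ∑' k : ℕ, (k : ℝ≥0∞) ^ 2 * p k < ⊤) {η : ℝ} (hη : 0 < η) :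
    ∃ C : ℝ, 0 < C ∧ ∀ (a : ℤ) (n : ℕ), 1 ≤ n → (law d p hmean).real (noPivot d a n)
      ≤ C * (n : ℝ) ^ (-(((d : ℝ) - 8) / 2 - η)) := by
  have hd' : (11 : ℝ) ≤ d := by exact_mod_cast hd
  obtain ⟨C, hC, h⟩ := exists_law_noPivot_le p hmean hd hone hsq
  set r : ℝ := ((d : ℝ) - 6) / 2 with hr
  have hr0 : 0 < r := by rw [hr]; linarith
  set q : ℝ := ((d : ℝ) - 8) / 2
  refine ⟨C * (r / η) ^ r + 1, by positivity, fun a n hn => ?_⟩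
  rcases Nat.lt_or_ge n 2 with h2 | h2
  · have : n = 1 := by omega
    subst this
    rw [Nat.cast_one, Real.one_rpow, mul_one]
    exact measureReal_le_one.trans (le_add_of_nonneg_left (by positivity))
  · have hn0 : (0 : ℝ) < n := by positivity
    have hl : Real.log n ^ r ≤ (r / η) ^ r * (n : ℝ) ^ η := by
      have h1 : Real.log n ≤ r / η * (n : ℝ) ^ (η / r) := by
        refine (Real.log_le_rpow_div hn0.le (div_pos hη hr0)).trans (le_of_eq ?_)
        field_simp
      refine (Real.rpow_le_rpow (Real.log_natCast_nonneg n) h1 hr0.le).trans (le_of_eq ?_)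
      rw [Real.mul_rpow (by positivity) (by positivity), ← Real.rpow_mul hn0.le,
        div_mul_cancel₀ _ hr0.ne']
    calc (law d p hmean).real (noPivot d a n) ≤ C * (Real.log n ^ r * (n : ℝ) ^ (-q)) := h a n h2
      _ ≤ C * ((r / η) ^ r * (n : ℝ) ^ η * (n : ℝ) ^ (-q)) := by gcongr
      _ = C * (r / η) ^ r * (n : ℝ) ^ (-(q - η)) := by
          rw [show -(q - η) = η + -q by ring, Real.rpow_add hn0]; ring
      _ ≤ _ := by
          gcongr
          linarith

/-- Almost surely, the pivotal times are unbounded in both directions. -/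
lemma law_not_isGood (hd : 10 < d) (hone : p 1 ≠ 1)
    (hsq : ∑' k : ℕ, (k : ℝ≥0∞) ^ 2 * p k < ⊤) : law d p hmean {ω | ¬ IsGood ω} = 0 := by
  have hd' : (11 : ℝ) ≤ d := by exact_mod_cast hd
  -- With `η = 1` the exponent is still -(d - 10)/2 < 0.
  obtain ⟨C, hC, h⟩ := exists_law_noPivot_le_rpow p hmean hd hone hsq (η := 1) one_pos
  have ht : Tendsto (fun n : ℕ => C * ((n : ℝ)) ^ (-(((d : ℝ) - 8) / 2 - 1))) atTop (nhds 0) := by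
    have h1 := (tendsto_rpow_neg_atTop (y := ((d : ℝ) - 8) / 2 - 1) (by linarith)).comp
      tendsto_natCast_atTop_atTop
    simpa using h1.const_mul C
  have hzero : ∀ (A : Set (Sample d)) (f : ℕ → ℤ), (∀ n, A ⊆ noPivot d (f n) n) →
      law d p hmean A = 0 := by
    intro A f hA
    have h0 : (law d p hmean).real A ≤ 0 := by
      refine ge_of_tendsto ht ?_
      filter_upwards [eventually_ge_atTop 1] with n hn
      exact (measureReal_mono (hA n)).trans (h (f n) n hn)
    exact (measureReal_eq_zero_iff).1 (le_antisymm h0 measureReal_nonneg)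
  have hsub : {ω : Sample d | ¬ IsGood ω} ⊆
      (⋃ a : ℕ, {ω | ∀ i : ℤ, a ≤ i → ¬ IsPivotal ω i}) ∪
        ⋃ a : ℕ, {ω | ∀ i : ℤ, i ≤ -a → ¬ IsPivotal ω i} := by
    intro ω hω
    by_contra hcon
    simp only [Set.mem_union, Set.mem_iUnion, Set.mem_ofPred_eq, not_or, not_exists,
      not_forall, not_not] at hcon
    refine hω ⟨fun a => ?_, fun a => ?_⟩
    · obtain ⟨i, h1, h2⟩ := hcon.1 a
      exact ⟨i, h1, h2⟩
    · obtain ⟨i, h1, h2⟩ := hcon.2 a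
      exact ⟨i, h1, h2⟩
  refine measure_mono_null hsub (measure_union_null ?_ ?_)
  · refine measure_iUnion_null fun a => hzero _ (fun _ => a) fun n ω hω i h1 _ => hω i h1
  · refine measure_iUnion_null fun a => hzero _ (fun n => -a - n + 1) fun n ω hω i _ h2 =>
      hω i (by omega)

/-- Inclusions are only needed on the almost sure event `IsGood`, and neither set has to be
measurable. -/
lemma real_le_largeGap (hd : 10 < d) (hone : p 1 ≠ 1)
    (hsq : ∑' k : ℕ, (k : ℝ≥0∞) ^ 2 * p k < ⊤) {A B : Set (Sample d)}
    (h : ∀ ω, IsGood ω → ω ∈ A → ω ∈ B) : (law d p hmean).real A ≤ (law d p hmean).real B := by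
  refine ENNReal.toReal_mono (measure_ne_top _ _) (measure_mono_ae ?_)
  have hg : ∀ᵐ ω ∂(law d p hmean), IsGood ω := law_not_isGood p hmean hd hone hsq
  filter_upwards [hg] with ω hω hA
  exact h ω hω hA

lemma exists_law_gap_le (hd : 10 < d) (hone : p 1 ≠ 1)
    (hsq : ∑' k : ℕ, (k : ℝ≥0∞) ^ 2 * p k < ⊤) :
    ∃ C : ℝ, 0 < C ∧ ∀ (i : ℤ) (n : ℕ), 2 ≤ n →
      (law d p hmean).real {ω | (n : ℝ) ≤ gap ω i} ≤
        C * Real.log n ^ (((d : ℝ) - 6) / 2) * (n : ℝ) ^ (-(((d : ℝ) - 8) / 2)) := by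
  have hd' : (11 : ℝ) ≤ d := by exact_mod_cast hd
  obtain ⟨C, hC, h⟩ := exists_law_noPivot_le p hmean hd hone hsq
  set r : ℝ := ((d : ℝ) - 6) / 2 with hr
  have hr0 : 0 < r := by rw [hr]; linarith
  set q : ℝ := ((d : ℝ) - 8) / 2 with hq
  have hq0 : 0 < q := by rw [hq]; linarith
  have hl2 : 0 < Real.log 2 := Real.log_pos one_lt_two
  refine ⟨4 * C * 4 ^ q + (Real.log 2 ^ r)⁻¹ * 4 ^ q, by positivity, fun i n hn => ?_⟩
  have hn0 : (0 : ℝ) < n := by positivity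
  have hn2 : (2 : ℝ) ≤ n := by exact_mod_cast hn
  have hlog : Real.log 2 ≤ Real.log n := Real.log_le_log two_pos hn2
  rw [mul_assoc]
  set X := Real.log n ^ r * (n : ℝ) ^ (-q) with hX
  have hX0 : 0 ≤ X := mul_nonneg (Real.rpow_nonneg (hl2.le.trans hlog) _) (by positivity)
  -- The bound is applied to intervals of length `n / 2`, which has to be at least 2; for `n < 4`
  -- the constant makes the right-hand side at least 1.
  rcases Nat.lt_or_ge n 4 with h4 | h4
  · refine measureReal_le_one.trans ?_
    have h1 : 1 ≤ (Real.log 2 ^ r)⁻¹ * 4 ^ q * X := by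
      have e1 : (4 : ℝ) ^ (-q) ≤ (n : ℝ) ^ (-q) :=
        Real.rpow_le_rpow_of_nonpos hn0 (by exact_mod_cast h4.le) (by linarith)
      have e2 : Real.log 2 ^ r ≤ Real.log n ^ r := Real.rpow_le_rpow hl2.le hlog hr0.le
      calc (1 : ℝ) = (Real.log 2 ^ r)⁻¹ * 4 ^ q * (Real.log 2 ^ r * 4 ^ (-q)) := by
            rw [Real.rpow_neg (by norm_num)]; field_simp
        _ ≤ _ := by rw [hX]; gcongr
    refine h1.trans ?_
    gcongr
    exact le_add_of_nonneg_left (by positivity)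
  · have e1 : (law d p hmean).real {ω | (n : ℝ) ≤ gap ω i}
        ≤ (law d p hmean).real (largeGap d i n) := by
      refine real_le_largeGap p hmean hd hone hsq fun ω hg hω => ?_
      have := mem_largeGap_of_le_gap hg hω
      rwa [Nat.ceil_natCast] at this
    have e2 : (law d p hmean).real (largeGap d i n)
        ≤ 4 * (law d p hmean).real (noPivot d 0 (n / 2)) := by
      have h1 := (law_largeGap_le (d := d) p hmean i n).trans
        (mul_le_mul_right (law_largeGap_zero_le p hmean n) 2)
      rw [← mul_assoc] at h1
      have h2 := ENNReal.toReal_mono (by finiteness) h1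
      rw [ENNReal.toReal_mul] at h2
      norm_num at h2
      exact h2
    have e3 := h 0 (n / 2) (by omega)
    have hh : (n : ℝ) / 4 ≤ ((n / 2 : ℕ) : ℝ) := by
      rw [div_le_iff₀ (by norm_num)]
      exact_mod_cast (by omega)
    have hh' : ((n / 2 : ℕ) : ℝ) ≤ n := by exact_mod_cast Nat.div_le_self n 2
    have e4 : Real.log ((n / 2 : ℕ) : ℝ) ^ r ≤ Real.log n ^ r :=
      Real.rpow_le_rpow (Real.log_natCast_nonneg _)
        (Real.log_le_log (lt_of_lt_of_le (by positivity) hh) hh') hr0.le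
    have e5 : ((n / 2 : ℕ) : ℝ) ^ (-q) ≤ 4 ^ q * (n : ℝ) ^ (-q) := by
      refine (Real.rpow_le_rpow_of_nonpos (by positivity) hh (by linarith)).trans (le_of_eq ?_)
      rw [Real.div_rpow hn0.le (by norm_num), Real.rpow_neg (show (0 : ℝ) ≤ 4 by norm_num),
        div_inv_eq_mul, mul_comm]
    calc (law d p hmean).real {ω | (n : ℝ) ≤ gap ω i}
        ≤ 4 * (C * (Real.log ((n / 2 : ℕ) : ℝ) ^ r * ((n / 2 : ℕ) : ℝ) ^ (-q))) :=
          e1.trans (e2.trans (mul_le_mul_of_nonneg_left e3 (by norm_num)))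
      _ ≤ 4 * (C * (Real.log n ^ r * (4 ^ q * (n : ℝ) ^ (-q)))) := by
          gcongr
      _ = 4 * C * 4 ^ q * X := by rw [hX]; ring
      _ ≤ _ := mul_le_mul_of_nonneg_right (le_add_of_nonneg_right (by positivity)) hX0

lemma exists_law_largeGap_zero_le_rpow (hd : 10 < d) (hone : p 1 ≠ 1)
    (hsq : ∑' k : ℕ, (k : ℝ≥0∞) ^ 2 * p k < ⊤) {η : ℝ} (hη : 0 < η)
    (hη' : η ≤ ((d : ℝ) - 8) / 2) :
    ∃ C : ℝ, 0 < C ∧ ∀ n : ℕ, 1 ≤ n → (law d p hmean).real (largeGap d 0 n)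
      ≤ C * (n : ℝ) ^ (-(((d : ℝ) - 8) / 2 - η)) := by
  obtain ⟨C, hC, h⟩ := exists_law_noPivot_le_rpow p hmean hd hone hsq hη
  set t : ℝ := ((d : ℝ) - 8) / 2 - η
  have ht : 0 ≤ t := sub_nonneg.2 hη'
  refine ⟨2 * C * 4 ^ t + 1, by positivity, fun n hn => ?_⟩
  rcases Nat.lt_or_ge n 2 with h2 | h2
  · have : n = 1 := by omega
    subst this
    rw [Nat.cast_one, Real.one_rpow, mul_one]
    exact measureReal_le_one.trans (le_add_of_nonneg_left (by positivity))
  · have hn0 : (0 : ℝ) < n := by positivity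
    have e2 : (law d p hmean).real (largeGap d 0 n)
        ≤ 2 * (law d p hmean).real (noPivot d 0 (n / 2)) := by
      have h2 := ENNReal.toReal_mono (by finiteness) (law_largeGap_zero_le (d := d) p hmean n)
      rwa [ENNReal.toReal_mul] at h2
    have hh : (n : ℝ) / 4 ≤ ((n / 2 : ℕ) : ℝ) := by
      rw [div_le_iff₀ (by norm_num)]
      exact_mod_cast (by omega)
    have e5 : ((n / 2 : ℕ) : ℝ) ^ (-t) ≤ 4 ^ t * (n : ℝ) ^ (-t) := by
      refine (Real.rpow_le_rpow_of_nonpos (by positivity) hh (by linarith)).trans (le_of_eq ?_)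
      rw [Real.div_rpow hn0.le (by norm_num), Real.rpow_neg (show (0 : ℝ) ≤ 4 by norm_num),
        div_inv_eq_mul, mul_comm]
    calc (law d p hmean).real (largeGap d 0 n)
        ≤ 2 * (C * ((n / 2 : ℕ) : ℝ) ^ (-t)) :=
          e2.trans (mul_le_mul_of_nonneg_left (h 0 (n / 2) (by omega)) (by norm_num))
      _ ≤ 2 * (C * (4 ^ t * (n : ℝ) ^ (-t))) := by gcongr
      _ = 2 * C * 4 ^ t * (n : ℝ) ^ (-t) := by ring
      _ ≤ _ := by gcongr; linarith

/-- Some gap with a number in `[-n, n]` has at least the length `M`. -/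
def someLargeGap (d n M : ℕ) : Set (Sample d) :=
  ⋃ i ∈ Finset.Icc (-(n : ℤ)) n, largeGap d i M

/-- The event that the gap of the origin is at least `b` is paid for once, not for every `i`. Off
this event, each of the `2 * n + 1` gaps is transported to the origin with a gain of order `b / M`.
-/
lemma real_someLargeGap_le (n : ℕ) {M b : ℕ} (hb : 1 ≤ b) (hbM : b ≤ M) :
    (law d p hmean).real (someLargeGap d n M) ≤ (law d p hmean).real (largeGap d 0 b)
      + (2 * n + 1) * (2 * b / M * (law d p hmean).real (largeGap d 0 M)) := by
  let A : ℤ → Set (Sample d) := fun i =>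
    {ω | ω ∈ largeGap d i M ∧ pivotalTime ω (0 + 1) - pivotalTime ω 0 ≤ b}
  have hsub : someLargeGap d n M ⊆ largeGap d 0 b ∪ ⋃ i ∈ Finset.Icc (-(n : ℤ)) n, A i := by
    intro ω hω
    simp only [someLargeGap, Set.mem_iUnion] at hω
    obtain ⟨i, hi, hω⟩ := hω
    rcases le_total (b : ℤ) (pivotalTime ω (0 + 1) - pivotalTime ω 0) with h | h
    · exact Or.inl ⟨hω.1, h⟩
    · exact Or.inr (Set.mem_biUnion hi ⟨hω, h⟩)
  have hA : ∀ i, (law d p hmean).real (A i)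
      ≤ 2 * b / M * (law d p hmean).real (largeGap d 0 M) := by
    intro i
    have h1 := ENNReal.toReal_mono (measure_ne_top _ _)
      (natCast_mul_law_gap_le (d := d) p hmean i (Nat.div_mul_le_self M b))
    rw [ENNReal.toReal_mul, ENNReal.toReal_natCast] at h1
    have hR : 1 ≤ M / b := (Nat.one_le_div_iff (by omega)).2 hbM
    -- Rounding `M / b ≥ 1` down loses at most a factor 2.
    have hM : (M : ℝ) ≤ 2 * b * ((M / b : ℕ) : ℝ) := by
      have h2 : M < b * (M / b + 1) := Nat.lt_mul_div_succ M (by omega)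
      have h3 : b * (M / b + 1) ≤ 2 * b * (M / b) := by nlinarith
      exact_mod_cast (h2.le.trans h3)
    have hM0 : (0 : ℝ) < M := by exact_mod_cast (by omega)
    rw [div_mul_eq_mul_div, le_div_iff₀ hM0]
    calc (law d p hmean).real (A i) * M
        ≤ (law d p hmean).real (A i) * (2 * b * ((M / b : ℕ) : ℝ)) := by gcongr
      _ = 2 * b * (((M / b : ℕ) : ℝ) * (law d p hmean).real (A i)) := by ring
      _ ≤ _ := mul_le_mul_of_nonneg_left h1 (by positivity)
  calc _ ≤ (law d p hmean).real (largeGap d 0 b)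
        + ∑ i ∈ Finset.Icc (-(n : ℤ)) n, (law d p hmean).real (A i) :=
        (measureReal_mono hsub).trans ((measureReal_union_le _ _).trans
          (add_le_add le_rfl (measureReal_biUnion_finset_le _ _)))
    _ ≤ _ := by
        gcongr
        refine (Finset.sum_le_card_nsmul _ _ _ fun i _ => hA i).trans (le_of_eq ?_)
        rw [nsmul_eq_mul, Int.card_Icc, show ((n : ℤ) + 1 - -n).toNat = 2 * n + 1 by omega]
        push_cast
        ring

lemma isLittleO_natCast_rpow {s t : ℝ} (h : s < t) :
    (fun n : ℕ => (n : ℝ) ^ (-t)) =o[atTop] fun n : ℕ => (n : ℝ) ^ (-s) := by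
  refine isLittleO_of_tendsto' ?_ ?_
  · filter_upwards [eventually_gt_atTop 0] with n hn h0
    have : (0 : ℝ) < (n : ℝ) ^ (-s) := by positivity
    exact absurd h0 this.ne'
  · have h1 := (tendsto_rpow_neg_atTop (sub_pos.2 h)).comp tendsto_natCast_atTop_atTop
    refine h1.congr' ?_
    filter_upwards [eventually_gt_atTop 0] with n hn
    have hn0 : (0 : ℝ) < n := by exact_mod_cast hn
    rw [Function.comp_apply, ← Real.rpow_sub hn0]
    congr 1
    ring

/-- Take M ≈ n^(1 - ε) and b ≈ n^(1 - u). The single event at the origin has exponent about q - qu =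
q - 1/2, and the union over the gaps about q - 1 + u. Both exceed q - 1 = (d - 10)/2 by a fixed
amount, so a small enough `ε` leaves room. -/
lemma exists_isLittleO_someLargeGap (hd : 10 < d) (hone : p 1 ≠ 1)
    (hsq : ∑' k : ℕ, (k : ℝ≥0∞) ^ 2 * p k < ⊤) :
    ∃ ε : ℝ, 0 < ε ∧
      (fun n : ℕ => (law d p hmean).real (someLargeGap d n ⌈(n : ℝ) ^ (1 - ε)⌉₊))
        =o[atTop] fun n : ℕ => (n : ℝ) ^ (-(((d : ℝ) - 10) / 2) - ε) := by
  have hd' : (11 : ℝ) ≤ d := by exact_mod_cast hd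
  set q : ℝ := ((d : ℝ) - 8) / 2 with hq
  have hq0 : 3 / 2 ≤ q := by rw [hq]; linarith
  -- Chosen so that q u = 1/2: shrinking `b` costs only half a power.
  set u : ℝ := 1 / (2 * q) with hu
  have hqu : q * u = 1 / 2 := by rw [hu]; field_simp
  have hu0 : 0 < u := by positivity
  have hu1 : u ≤ 1 / 3 := by nlinarith
  -- The second comparison below requires u > ε (q + 3) - ε², and u = ε (q + 4) meets it.
  set ε : ℝ := u / (q + 4) with hε
  have hεu : ε * (q + 4) = u := by rw [hε]; field_simp
  have hε0 : 0 < ε := by positivity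
  have hε1 : ε ≤ 1 / 8 := by nlinarith
  have hεu' : ε ≤ u := by nlinarith
  obtain ⟨C, hC, h⟩ := exists_law_largeGap_zero_le_rpow p hmean hd hone hsq hε0
    (show ε ≤ q by linarith)
  rw [← hq] at h
  refine ⟨ε, hε0, ?_⟩
  have hexp : -(((d : ℝ) - 10) / 2) - ε = -(q - 1 + ε) := by rw [hq]; ring
  rw [hexp]
  set θ₁ : ℝ := (1 - u) * (q - ε) with hθ₁
  set θ₂ : ℝ := (1 - ε) * (q - ε) + (1 - ε) - (1 - u) - 1 with hθ₂
  have h1 : q - 1 + ε < θ₁ := by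
    rw [hθ₁]
    have : 0 < u * ε := by positivity
    nlinarith
  have h2 : q - 1 + ε < θ₂ := by
    rw [hθ₂]
    have : 0 < ε * ε := by positivity
    nlinarith
  have hbound : ∀ n : ℕ, 1 ≤ n →
      (law d p hmean).real (someLargeGap d n ⌈(n : ℝ) ^ (1 - ε)⌉₊)
        ≤ C * (n : ℝ) ^ (-θ₁) + 12 * C * (n : ℝ) ^ (-θ₂) := by
    intro n hn
    have hn1 : (1 : ℝ) ≤ n := by exact_mod_cast hn
    have hn0 : (0 : ℝ) < n := by linarith
    have hβ1 : (1 : ℝ) ≤ (n : ℝ) ^ (1 - u) := Real.one_le_rpow hn1 (by linarith)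
    have hβκ : (n : ℝ) ^ (1 - u) ≤ (n : ℝ) ^ (1 - ε) :=
      Real.rpow_le_rpow_of_exponent_le hn1 (by linarith)
    set b := ⌈(n : ℝ) ^ (1 - u)⌉₊
    set M := ⌈(n : ℝ) ^ (1 - ε)⌉₊
    have hb1 : 1 ≤ b := Nat.one_le_ceil_iff.2 (by positivity)
    have hbM : b ≤ M := Nat.ceil_mono hβκ
    have hbn : (n : ℝ) ^ (1 - u) ≤ b := Nat.le_ceil _
    have hMn : (n : ℝ) ^ (1 - ε) ≤ M := Nat.le_ceil _
    have hb2 : (b : ℝ) ≤ 2 * (n : ℝ) ^ (1 - u) := by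
      have := (Nat.ceil_lt_add_one (show 0 ≤ (n : ℝ) ^ (1 - u) by positivity)).le
      linarith
    have e1 : (law d p hmean).real (largeGap d 0 b) ≤ C * (n : ℝ) ^ (-θ₁) := by
      refine (h b hb1).trans ?_
      gcongr
      rw [hθ₁, ← mul_neg, Real.rpow_mul hn0.le]
      exact Real.rpow_le_rpow_of_nonpos (by positivity) hbn (by linarith)
    have e2 : (law d p hmean).real (largeGap d 0 M) ≤ C * (n : ℝ) ^ (-((1 - ε) * (q - ε))) := by
      refine (h M (hb1.trans hbM)).trans ?_
      gcongr
      rw [← mul_neg, Real.rpow_mul hn0.le]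
      exact Real.rpow_le_rpow_of_nonpos (by positivity) hMn (by linarith)
    have e3 : 2 * (b : ℝ) / M ≤ 4 * ((n : ℝ) ^ (1 - u) * (n : ℝ) ^ (-(1 - ε))) := by
      rw [Real.rpow_neg hn0.le, ← div_eq_mul_inv, ← mul_div_assoc]
      exact div_le_div₀ (by positivity) (by linarith) (by positivity) hMn
    calc _ ≤ _ := real_someLargeGap_le p hmean n hb1 hbM
      _ ≤ C * (n : ℝ) ^ (-θ₁) + (3 * n) * (4 * ((n : ℝ) ^ (1 - u) * (n : ℝ) ^ (-(1 - ε))) *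
            (C * (n : ℝ) ^ (-((1 - ε) * (q - ε))))) := by
          gcongr
          linarith
      _ = C * (n : ℝ) ^ (-θ₁) + 12 * C * ((n : ℝ) ^ (1 : ℝ) * (n : ℝ) ^ (1 - u) *
            (n : ℝ) ^ (-(1 - ε)) * (n : ℝ) ^ (-((1 - ε) * (q - ε)))) := by
          rw [Real.rpow_one]; ring
      _ = _ := by
          rw [← Real.rpow_add hn0, ← Real.rpow_add hn0, ← Real.rpow_add hn0]
          congr 3
          rw [hθ₂]; ring
  refine IsBigO.trans_isLittleO (g := fun n : ℕ => C * (n : ℝ) ^ (-θ₁) + 12 * C * (n : ℝ) ^ (-θ₂))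
    (IsBigO.of_bound 1 ?_)
    (((isLittleO_natCast_rpow h1).const_mul_left C).add
      ((isLittleO_natCast_rpow h2).const_mul_left (12 * C)))
  filter_upwards [eventually_ge_atTop 1] with n hn
  rw [one_mul, Real.norm_of_nonneg measureReal_nonneg, Real.norm_of_nonneg (by positivity)]
  exact hbound n hn

end

lemma le_maxOver_iff {β : Type*} [LinearOrder β] {n : ℕ} {f : ℤ → β} {x : β} :
    x ≤ maxOver n f ↔ ∃ i ∈ Finset.Icc (-(n : ℤ)) n, x ≤ f i :=
  Finset.le_sup'_iff _

end BRW

/-! ### The theorem, with resistances and distances reduced to gaps. -/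

theorem lemma4p5 (d : ℕ) [NeZero d] (hd : 10 < d)
    (p : PMF ℕ) (hmean : ∑' k : ℕ, (k : ℝ≥0∞) * p k = 1) (hone : p 1 ≠ 1)
    (hsq : ∑' k : ℕ, (k : ℝ≥0∞) ^ 2 * p k < ⊤) :
    (∀ᵐ ω ∂(BRW.law d p hmean), BRW.IsPivotalEnumeration ω (BRW.pivotalTime ω)) ∧
    (∃ C : ℝ, 0 < C ∧ ∀ (i : ℤ) (n : ℕ), 2 ≤ n →
      (BRW.law d p hmean).real {ω | (n : ℝ) ≤ BRW.gap ω i} ≤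
        C * Real.log n ^ (((d : ℝ) - 6) / 2) * (n : ℝ) ^ (-(((d : ℝ) - 8) / 2))) ∧
    (∃ ε : ℝ, 0 < ε ∧
      ((fun n : ℕ => (BRW.law d p hmean).real
          {ω | (n : ℝ) ^ (1 - ε) ≤ BRW.maxOver n (BRW.gap ω)})
        =o[atTop] fun n : ℕ => (n : ℝ) ^ (-(((d : ℝ) - 10) / 2) - ε)) ∧
      ((fun n : ℕ => (BRW.law d p hmean).real
          {ω | ENNReal.ofReal ((n : ℝ) ^ (1 - ε)) ≤
            BRW.maxOver n (BRW.pivotalResistance ω)})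
        =o[atTop] fun n : ℕ => (n : ℝ) ^ (-(((d : ℝ) - 10) / 2) - ε)) ∧
      ((fun n : ℕ => (BRW.law d p hmean).real
          {ω | (n : ℝ) ^ (1 - ε) ≤ BRW.maxOver n (BRW.pivotalDist ω)})
        =o[atTop] fun n : ℕ => (n : ℝ) ^ (-(((d : ℝ) - 10) / 2) - ε))) := by
  refine ⟨?_, BRW.exists_law_gap_le p hmean hd hone hsq, ?_⟩
  · have hg : ∀ᵐ ω ∂(BRW.law d p hmean), BRW.IsGood ω := BRW.law_not_isGood p hmean hd hone hsq
    exact hg.mono fun ω hω => hω.isPivotalEnumeration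
  obtain ⟨ε, hε, h⟩ := BRW.exists_isLittleO_someLargeGap p hmean hd hone hsq
  -- All three maxima are controlled by the same event: a large maximum forces some gap with index
  -- in the window to be large.
  have key : ∀ A : ℕ → Set (BRW.Sample d),
      (∀ n ω, BRW.IsGood ω → ω ∈ A n → ∃ i ∈ Finset.Icc (-(n : ℤ)) n,
        (n : ℝ) ^ (1 - ε) ≤ BRW.gap ω i) →
      (fun n : ℕ => (BRW.law d p hmean).real (A n))
        =o[atTop] fun n : ℕ => (n : ℝ) ^ (-(((d : ℝ) - 10) / 2) - ε) := by
    intro A hA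
    refine IsBigO.trans_isLittleO (IsBigO.of_bound 1 (Eventually.of_forall fun n => ?_)) h
    rw [one_mul, Real.norm_of_nonneg measureReal_nonneg, Real.norm_of_nonneg measureReal_nonneg]
    refine BRW.real_le_largeGap p hmean hd hone hsq fun ω hg hω => ?_
    obtain ⟨i, hi, hgap⟩ := hA n ω hg hω
    exact Set.mem_biUnion hi (BRW.mem_largeGap_of_le_gap hg hgap)
  refine ⟨ε, hε, key _ fun n ω _ hω => ?_, key _ fun n ω hg hω => ?_, key _ fun n ω hg hω => ?_⟩
  · exact BRW.le_maxOver_iff.1 hω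
  · rw [Set.mem_ofPred_eq, BRW.le_maxOver_iff] at hω
    obtain ⟨i, hi, hle⟩ := hω
    refine ⟨i, hi, ?_⟩
    have hlt := hg.isPivotalEnumeration.strictMono (show i < i + 1 by omega)
    have hgap : 0 ≤ BRW.gap ω i := by
      unfold BRW.gap
      exact sub_nonneg.2 (by exact_mod_cast hlt.le)
    exact (ENNReal.ofReal_le_ofReal_iff hgap).1 (hle.trans (BRW.pivotalResistance_le_gap hg i))
  · rw [Set.mem_ofPred_eq, BRW.le_maxOver_iff] at hω
    obtain ⟨i, hi, hle⟩ := hω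
    exact ⟨i, hi, hle.trans (BRW.pivotalDist_le_gap hg i)⟩
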